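/- **Definitions.** All diagrams are generic drawings in the plane, considered with planar isotopy; edges may intersect transversely in points that are not vertices. *Virtual links.* A virtual link diagram is a drawing of finitely many closed curves in the plane whose double points are either classical crossings (with over/under information) or virtual crossings. The $Z$-move interchanges a classical crossing and an adjacent virtual crossing of the same two strands: if $\sigma$ denotes a classical crossing and $v$ the virtual crossing of two parallel strands, it replaces $\sigma v$ by $v\sigma$. A *$Z$-virtual link* is an equivalence class of virtual link diagrams under planar isotopy, the virtual Reidemeister moves (the classical moves $R1,R2,R3$, the purely virtual moves $V1,V2,V3$, and the mixed move $VM$ moving a strand with virtual crossings past a classical crossing) and the $Z$-move. $\widetilde{\mathbb L}$ is the category whose objects are the $Z$-virtual links and whose only morphisms are identities. *$Z$-graphenes.* An undirected matched diagram is a drawing in the plane of a finite trivalent graph (loops, multiple edges and unmatched circles without vertices are allowed) whose vertices are each marked solid or hollow, with a perfect matching each of whose edges joins two vertices and carries a sign $\pm$ (but no direction). Write $E_\varepsilon$ for two parallel vertical unmatched strands joined by a straight horizontal matched edge of sign $\varepsilon$, with solid vertices unless said otherwise. The *$Z$-graphene moves* are: - the ribbon moves: $M1,M2,M3$ (removal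 of a kink, removal of a bigon, and the triangle move, for intersections of arbitrary edges), $M4$ (an edge is moved across a vertex), $M5$ (a hollow vertex is replaced by a solid vertex with two of its legs interchanged); - $G1$: a bigon formed by a matched edge (of either sign, with solid vertices) and an unmatched edge is replaced by a single unmatched strand; - $G2$: $E_\varepsilon E_{-\varepsilon}$ (a square) is replaced by two parallel strands; - $G3$: on three strands, $E^{12}_\varepsilon E^{13}_\varepsilon E^{23}_\varepsilon$ is replaced by $E^{23}_\varepsilon E^{13}_\varepsilon E^{12}_\varepsilon$ (a hexagon), where $E^{ij}_\varepsilon$ is a matched edge between the strands $i$ and $j$, and $E^{13}_\varepsilon$ is $E^{23}_\varepsilon$ preceded and followed by an intersection of the strands $1$ and $2$; - $G4$: both vertices of a matched edge are changed between solid and hollow; - $G5$: a matched edge of sign $\varepsilon$ with one solid and one hollow vertex is replaced by a matched edge of sign $-\varepsilon$ with two solid vertices. A *$Z$-graphene* is an equivalence class of undirected matched diagrams under planar isotopy and these moves. $\widetilde{\mathbb G}$ is the category whose objects are the $Z$-graphenes and whose only morphisms are identities. *The functor.* Given an undirected matched diagram with all vertices solid and whose matched edges have no intersections in their interiors, put a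 direction (a dot at one of its ends) on each matched edge, and replace each $E_\varepsilon$ by $\sigma_\varepsilon v$ or by $v\sigma_\varepsilon$, according to the direction; here $\sigma_+$ is the classical crossing whose over-strand runs from top left to bottom right and $\sigma_-$ is the opposite crossing. Replace the intersections of unmatched edges by virtual crossings. **Theorem.** There is exactly one functor $\widetilde{\mathbb K}:\widetilde{\mathbb G}\to\widetilde{\mathbb L}$ that sends, for every such diagram and every choice of directions, the $Z$-graphene of the diagram to the $Z$-virtual link of the diagram obtained by the replacement, and $\widetilde{\mathbb K}$ is an isomorphism of categories. -/

import Mathlib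

/-!
# Diagrams in the plane

A drawing in the plane (of a graph, or of a link) is put in general position with respect to a
height function and is then read from top to bottom as a finite word of elementary pieces.
At each height between two pieces the drawing meets a horizontal line in a finite list of strands.
Planar isotopy is generated by the local isotopies of `PlanarIsotopy`.
-/

/-- A kind of plane drawing: the colours that its edges carry, the kinds of decorated vertices
("nodes") that it may contain, for each node the colours of its legs, listed counterclockwise from
a chosen first leg, and the operation `rot` which makes the second leg the first one
without changing the vertex as it is drawn. -/
structure DrawingKind where
  Color : Type
  Node : Type
  legs : Node → List Color
  rot : Node → Node
  legs_rot : ∀ g, legs (rot g) = (legs g).rotate 1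

namespace DrawingKind

variable (S : DrawingKind)

/-- Elementary pieces of a drawing, read downwards: a local maximum, a local minimum,
a transverse intersection of two edges (which is not a vertex), and a vertex with all its legs
pointing down. -/
inductive Piece where
  | cup (c : S.Color)
  | cap (c : S.Color)
  | cross (c d : S.Color)
  | node (g : S.Node)

variable {S}

/-- Colours of the strands that enter a piece from above, from left to right. -/
def Piece.src : S.Piece → List S.Color
  | .cup _ => []
  | .cap c => [c, c]
  | .cross c d => [c, d]
  | .node _ => []

/-- Colours of the strands that leave a piece below, from left to right. -/
def Piece.tgt : S.Piece → List S.Color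
  | .cup c => [c, c]
  | .cap _ => []
  | .cross c d => [d, c]
  | .node g => S.legs g

variable (S) in
/-- A drawing, read downwards. The entry `(k, e)` is the piece `e` with exactly `k` strands
passing to its left. -/
abbrev Word := List (ℕ × S.Piece)

/-- The piece `s.2`, with `s.1` strands to its left, leads from the strands `a` to the strands `b`. -/
def Fits (a : List S.Color) (s : ℕ × S.Piece) (b : List S.Color) : Prop :=
  ∃ x y : List S.Color, x.length = s.1 ∧ a = x ++ s.2.src ++ y ∧ b = x ++ s.2.tgt ++ y

/-- The word is a well-formed drawing with upper boundary `a` and lower boundary `b`. -/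
def Runs : List S.Color → S.Word → List S.Color → Prop
  | a, [], b => a = b
  | a, s :: w, b => ∃ a', Fits a s a' ∧ Runs a' w b

/-- A drawing of a closed object: nothing enters from above and nothing leaves below. -/
def IsClosedDrawing (w : S.Word) : Prop := Runs [] w []

/-- Put `k` more strands to the left of a drawing. -/
def shift (k : ℕ) (w : S.Word) : S.Word := w.map fun s => (k + s.1, s.2)

/-- A strand of colour `c`, with `k` strands to its left, runs to the right across the strands `l`. -/
def passRight (c : S.Color) : ℕ → List S.Color → S.Word
  | _, [] => []
  | k, d :: l => (k, .cross c d) :: passRight c (k + 1) l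

/-- A strand of colour `c` runs to the left across the strands `l`, which have `k` strands to
their left. -/
def passLeft (c : S.Color) : ℕ → List S.Color → S.Word
  | _, [] => []
  | k, d :: l => passLeft c (k + 1) l ++ [(k, .cross d c)]

/-- Local planar isotopies. -/
inductive PlanarIsotopy : S.Word → S.Word → Prop
  /-- pieces that lie side by side can be moved to either order of heights -/
  | exchange (e e' : S.Piece) (j : ℕ) :
      PlanarIsotopy [(0, e), (e.tgt.length + j, e')] [(e.src.length + j, e'), (0, e)]
  /-- a maximum followed by a minimum on the same strand is straightened -/
  | zigzag (c : S.Color) : PlanarIsotopy [(1, .cup c), (0, .cap c)] []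
  | zagzig (c : S.Color) : PlanarIsotopy [(0, .cup c), (1, .cap c)] []
  /-- an intersection slides across a maximum or a minimum -/
  | slideCup (c d : S.Color) :
      PlanarIsotopy [(1, .cup c), (0, .cross d c)] [(0, .cup c), (1, .cross c d)]
  | slideCap (c d : S.Color) :
      PlanarIsotopy [(0, .cross c d), (1, .cap c)] [(1, .cross d c), (0, .cap c)]
  /-- a vertex is turned in the plane: its first leg is carried over the top to become the last -/
  | rotate (g : S.Node) (c : S.Color) (l : List S.Color) (h : S.legs g = c :: l) :
      PlanarIsotopy [(0, .node (S.rot g))] [(0, .cup c), (1, .node g), (0, .cap c)]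

/-- The moves on the mere intersections of edges. For ribbon diagrams these are the
moves `M1`, ..., `M4`; for link diagrams, where the mere intersections are the virtual crossings,
these are the purely virtual moves and the mixed move. -/
inductive IntersectionMove : S.Word → S.Word → Prop
  /-- removal of a kink -/
  | kink (c : S.Color) : IntersectionMove [(0, .cup c), (0, .cross c c)] [(0, .cup c)]
  /-- removal of a bigon between two edges -/
  | bigon (c d : S.Color) : IntersectionMove [(0, .cross c d), (0, .cross d c)] []
  /-- the triangle move for three edges -/
  | triangle (c d e : S.Color) :
      IntersectionMove [(0, .cross c d), (1, .cross c e), (0, .cross d e)]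
        [(1, .cross d e), (0, .cross c e), (1, .cross c d)]
  /-- an edge is moved across a vertex: instead of crossing the legs `l₁` of the vertex, on one
  side of it, it crosses the other legs `l₂` -/
  | pass (c : S.Color) (g : S.Node) (l₁ l₂ : List S.Color) (h : S.legs g = l₁ ++ l₂) :
      IntersectionMove ((1, .node g) :: passRight c 0 l₁)
        ((0, .node g) :: passLeft c l₁.length l₂)

/-- `w'` is obtained from `w` by replacing somewhere a subdrawing `u` by `v`, where `R u v`. -/
def Rewrite (R : S.Word → S.Word → Prop) (w w' : S.Word) : Prop :=
  ∃ (p q u v : S.Word) (k : ℕ),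
    R u v ∧ w = p ++ shift k u ++ q ∧ w' = p ++ shift k v ++ q

/-- Immediate neighbours along an edge of the drawing. The point `(i, j)` is the strand number `j`
(from the left, starting with `0`) at the height just above the `i`-th piece. -/
inductive Neighbours (w : S.Word) : ℕ × ℕ → ℕ × ℕ → Prop
  | left {i k : ℕ} {e : S.Piece} (h : w[i]? = some (k, e)) (j : ℕ) (hj : j < k) :
      Neighbours w (i, j) (i + 1, j)
  | right {i k : ℕ} {e : S.Piece} (h : w[i]? = some (k, e)) (j : ℕ) :
      Neighbours w (i, k + e.src.length + j) (i + 1, k + e.tgt.length + j)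
  | cup {i k : ℕ} {c : S.Color} (h : w[i]? = some (k, .cup c)) :
      Neighbours w (i + 1, k) (i + 1, k + 1)
  | cap {i k : ℕ} {c : S.Color} (h : w[i]? = some (k, .cap c)) :
      Neighbours w (i, k) (i, k + 1)
  | crossLeft {i k : ℕ} {c d : S.Color} (h : w[i]? = some (k, .cross c d)) :
      Neighbours w (i, k) (i + 1, k + 1)
  | crossRight {i k : ℕ} {c d : S.Color} (h : w[i]? = some (k, .cross c d)) :
      Neighbours w (i, k + 1) (i + 1, k)

/-- The point `p` is the beginning of a leg of a vertex. -/
def IsLeg (w : S.Word) (p : ℕ × ℕ) : Prop :=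
  ∃ (i k t : ℕ) (g : S.Node),
    w[i]? = some (k, .node g) ∧ t < (S.legs g).length ∧ p = (i + 1, k + t)

/-- Every edge with a colour in `P` ends at vertices, i.e. it is not a closed curve without
vertices. -/
def EdgesEndAtVertices (P : S.Color → Prop) (w : S.Word) : Prop :=
  ∀ (i j : ℕ) (a : List S.Color) (c : S.Color),
    Runs [] (w.take i) a → a[j]? = some c → P c →
      ∃ p, IsLeg w p ∧ Relation.EqvGen (Neighbours w) (i, j) p

end DrawingKind

open DrawingKind

/-! ## Virtual links -/

/-- Link diagrams: the edges carry no decoration; the vertices are the classical crossings.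
The over-strand of `crossing b` joins the legs number `1` and `3` if `b = true`, and the legs number
`0` and `2` if `b = false` (the legs are numbered `0, 1, 2, 3` counterclockwise). -/
@[reducible] def linkKind : DrawingKind where
  Color := Unit
  Node := Bool
  legs := fun _ => [(), (), (), ()]
  rot := fun b => !b
  legs_rot := fun _ => rfl

/-- A virtual link diagram. -/
def VirtualLinkDiagram : Type := {w : linkKind.Word // IsClosedDrawing w}

/-- The virtual crossing of two downward strands. -/
def virtualCrossing : linkKind.Word := [(0, .cross () ())]

/-- The classical crossing of two downward strands: the over-strand runs from top left
to bottom right if `b = true`, and from top right to bottom left if `b = false`.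
(The legs of the vertex are, counterclockwise: top right, top left, bottom left, bottom right.) -/
def classicalCrossing (b : Bool) : linkKind.Word :=
  [(2, .node b), (1, .cap ()), (0, .cap ())]

/-- The classical Reidemeister moves. -/
inductive ReidemeisterMove : linkKind.Word → linkKind.Word → Prop
  | r1 (b : Bool) : ReidemeisterMove ((0, .cup ()) :: classicalCrossing b) [(0, .cup ())]
  | r2 (b : Bool) : ReidemeisterMove (classicalCrossing b ++ classicalCrossing (!b)) []
  | r3 (b : Bool) :
      ReidemeisterMove
        (classicalCrossing b ++ shift 1 (classicalCrossing b) ++ classicalCrossing b)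
        (shift 1 (classicalCrossing b) ++ classicalCrossing b ++ shift 1 (classicalCrossing b))

/-- The `Z`-move: a classical crossing is interchanged with an adjacent virtual crossing of the same
two strands. -/
inductive ZMove : linkKind.Word → linkKind.Word → Prop
  | z (b : Bool) : ZMove (classicalCrossing b ++ virtualCrossing)
      (virtualCrossing ++ classicalCrossing b)

/-- Two virtual link diagrams differ by one planar isotopy, virtual Reidemeister move, or
`Z`-move. -/
def ZLinkStep (D D' : VirtualLinkDiagram) : Prop :=
  Rewrite (fun u v => PlanarIsotopy u v ∨ IntersectionMove u v ∨ ReidemeisterMove u v ∨ ZMove u v)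
    D.1 D'.1

/-- Equivalence of virtual link diagrams up to planar isotopy, virtual Reidemeister moves and the
`Z`-move. -/
def zLinkSetoid : Setoid VirtualLinkDiagram := Relation.EqvGen.setoid ZLinkStep

/-- The category of `Z`-virtual links: its objects are the `Z`-virtual links, and it has
only identity morphisms. -/
abbrev ZVirtualLink : Type := CategoryTheory.Discrete (Quotient zLinkSetoid)

/-! ## Graphenes -/

/-- An edge of a matched diagram is unmatched, or it is matched and has a sign
(`true` is positive, `false` is negative). -/
inductive EdgeColor where
  | unmatched
  | matched (sign : Bool)

/-- A trivalent vertex, solid or hollow, incident to exactly one matched edge; `sign` is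
the sign of that edge, and `pos` its position among the three legs. -/
structure MatchedVertex where
  solid : Bool
  sign : Bool
  pos : Fin 3

/-- The colour of the leg number `j`. -/
def MatchedVertex.leg (g : MatchedVertex) (j : Fin 3) : EdgeColor :=
  if j = g.pos then .matched g.sign else .unmatched

/-- Ribbon diagrams with an undirected (but signed) perfect matching. -/
@[reducible] def matchedKind : DrawingKind where
  Color := EdgeColor
  Node := MatchedVertex
  legs := fun g => [g.leg 0, g.leg 1, g.leg 2]
  rot := fun g => { g with pos := g.pos - 1 }
  legs_rot := by
    rintro ⟨a, b, i⟩
    fin_cases i <;> rfl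

/-- A ribbon diagram with an undirected perfect matching. A circle without vertices is
allowed as an unmatched edge; a matched edge joins vertices. -/
def UndirectedMatchedDiagram : Type :=
  {w : matchedKind.Word //
    IsClosedDrawing w ∧ EdgesEndAtVertices (fun c => ∃ ε, c = EdgeColor.matched ε) w}

/-- Two vertical unmatched strands joined by a straight horizontal matched edge of sign `ε`:
a vertex on the left strand (with legs, counterclockwise: top, bottom, right), solid if
`a = true`, and a vertex on the right strand (with legs, counterclockwise: top, left, bottom), solid
if `b = true`. -/
def rung (ε a b : Bool) : matchedKind.Word :=
  [(1, .node ⟨a, ε, 2⟩), (0, .cap .unmatched),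
   (3, .node ⟨b, ε, 1⟩), (2, .cap .unmatched), (1, .cap (.matched ε))]

/-- The ribbon move `M5`: a hollow vertex is a solid vertex with two of its legs interchanged. -/
inductive TwistMove : matchedKind.Word → matchedKind.Word → Prop
  | m5 (ε : Bool) (i : Fin 3) :
      TwistMove [(0, .node ⟨false, ε, i⟩)]
        [(0, .node ⟨true, ε, Equiv.swap 0 1 i⟩),
         (0, .cross (MatchedVertex.leg ⟨true, ε, Equiv.swap 0 1 i⟩ 0)
           (MatchedVertex.leg ⟨true, ε, Equiv.swap 0 1 i⟩ 1))]

/-- The non-ribbon moves, with the direction of the matched edges forgotten. -/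
inductive NonRibbonMove : matchedKind.Word → matchedKind.Word → Prop
  /-- removal of a bigon formed by a matched and an unmatched edge -/
  | g1 (ε : Bool) :
      NonRibbonMove ((0, .cup .unmatched) :: rung ε true true) [(0, .cup .unmatched)]
  /-- removal of a square with two matched edges of opposite signs -/
  | g2 (ε : Bool) : NonRibbonMove (rung ε true true ++ rung (!ε) true true) []
  /-- the hexagon move: each two of three strands are joined by a matched edge;
  the one between the outer strands runs across the middle strand, which is expressed by
  drawing the first two strands interchanged at that height -/
  | g3 (ε : Bool) :
      NonRibbonMove
        (rung ε true true ++
          ([(0, .cross .unmatched .unmatched)] ++ shift 1 (rung ε true true) ++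
            [(0, .cross .unmatched .unmatched)]) ++
          shift 1 (rung ε true true))
        (shift 1 (rung ε true true) ++
          ([(0, .cross .unmatched .unmatched)] ++ shift 1 (rung ε true true) ++
            [(0, .cross .unmatched .unmatched)]) ++
          rung ε true true)
  /-- both vertices of a matched edge change between solid and hollow -/
  | g4 (ε a b : Bool) : NonRibbonMove (rung ε a b) (rung ε (!a) (!b))
  /-- one vertex of a matched edge changes between solid and hollow, and the sign changes -/
  | g5 (ε : Bool) : NonRibbonMove (rung ε true false) (rung (!ε) true true)

/-- Two diagrams differ by one planar isotopy or one `Z`-graphene move. -/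
def ZGrapheneStep (D D' : UndirectedMatchedDiagram) : Prop :=
  Rewrite
    (fun u v => PlanarIsotopy u v ∨ IntersectionMove u v ∨ TwistMove u v ∨ NonRibbonMove u v)
    D.1 D'.1

/-- Equivalence of ribbon diagrams with undirected perfect matchings up to planar isotopy and
`Z`-graphene moves. -/
def zGrapheneSetoid : Setoid UndirectedMatchedDiagram := Relation.EqvGen.setoid ZGrapheneStep

/-- The category of `Z`-graphenes: its objects are the `Z`-graphenes, and it has only
identity morphisms. -/
abbrev ZGraphene : Type := CategoryTheory.Discrete (Quotient zGrapheneSetoid)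

/-! ## The functor -/

/-- Elementary pieces of a directed matched diagram all of whose vertices are solid and all
of whose matched edges are drawn without any intersections (as straight segments between two
vertical strands). In `rung ε d`, the sign of the matched edge is `ε`, and its direction puts
the dot at its left end if `d = true`, at its right end if `d = false`. -/
inductive LadderPiece where
  | cup
  | cap
  | cross
  | rung (ε d : Bool)

/-- A matched diagram made of such pieces; the entry `(k, e)` is the piece `e` with `k`
strands to its left. -/
abbrev Ladder := List (ℕ × LadderPiece)

/-- The underlying undirected matched drawing of a piece: the direction is forgotten. -/
def LadderPiece.toMatched : LadderPiece → matchedKind.Word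
  | .cup => [(0, .cup .unmatched)]
  | .cap => [(0, .cap .unmatched)]
  | .cross => [(0, .cross .unmatched .unmatched)]
  | .rung ε _ => _root_.rung ε true true

/-- The replacement that defines the functor: a matched edge becomes a classical crossing and an
adjacent virtual crossing of the two strands, the order of the two being dictated by the direction,
and the type of the classical crossing by the sign; intersections of unmatched edges become virtual
crossings. -/
def LadderPiece.toLink : LadderPiece → linkKind.Word
  | .cup => [(0, .cup ())]
  | .cap => [(0, .cap ())]
  | .cross => virtualCrossing
  | .rung ε true => classicalCrossing ε ++ virtualCrossing
  | .rung ε false => virtualCrossing ++ classicalCrossing ε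

/-- The undirected matched drawing of a ladder. -/
def Ladder.toMatched (L : Ladder) : matchedKind.Word :=
  L.flatMap fun s => shift s.1 s.2.toMatched

/-- The link drawing obtained from a ladder by the replacement at every matched edge. -/
def Ladder.toLink (L : Ladder) : linkKind.Word :=
  L.flatMap fun s => shift s.1 s.2.toLink

/-- `K` is induced by the replacement of matched edges: for every directed matched diagram with
solid vertices and embedded matched edges, the replacement yields a virtual link diagram, which
represents the image under `K` of the `Z`-graphene represented by the undirected diagram. -/
def IsInducedByReplacement (K : CategoryTheory.Functor ZGraphene ZVirtualLink) : Prop :=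
  ∀ (L : Ladder)
    (hG : IsClosedDrawing L.toMatched ∧
      EdgesEndAtVertices (fun c => ∃ ε, c = EdgeColor.matched ε) L.toMatched),
    ∃ hL : IsClosedDrawing L.toLink,
      K.obj ⟨Quotient.mk zGrapheneSetoid ⟨L.toMatched, hG⟩⟩ =
        ⟨Quotient.mk zLinkSetoid ⟨L.toLink, hL⟩⟩

/-!
Every matched edge of a graphene carries one classical crossing of the corresponding link. The proof
makes this precise by drawing a matched edge as a cable of two parallel strands. At each vertex these
strands continue in the two unmatched edges that end there (a hollow vertex adds a virtual crossing),
and at one chosen point of the edge, its mark, they meet in a classical and a virtual crossing.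

From links to graphenes: a classical crossing is replaced by a straight matched edge followed by an
intersection (`toGraphene`). The moves on link diagrams become consequences of the moves on matched
diagrams (`Eqv.toGraphene`). The classical moves are the moves `G1`, `G2`, `G3` up to intersections,
the `Z`-move holds because a straight matched edge slides along an intersection of its two strands
(`Eqv.rung_cross`), and a quarter turn of a crossing, which changes its sign, is the move `G5`.

From graphenes to links: a marking of a matched diagram is a choice of one mark on each matched edge,
encoded by labels that tell on which side of the mark a strand lies; `markedLink` is the link diagram
of a marking. Three facts make this a map on equivalence classes.

* Each diagram has a marking, and the matched diagram of its link diagram is equivalent to the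
  diagram itself (`exists_marking`). To see this, all of the matched edge except for short ends at
  some of the vertices is taken as an inner section, which is drawn as a matched edge, and the rest
  is drawn as a cable. The ends of the inner sections are then moved along the edges until the inner
  sections shrink to marks (`slide_induction`). The only obstruction is a closed matched curve
  without vertices. The existence of such curves is expressed by shadings of the diagram in which
  edges with vertices are not shaded (`isMatching_iff`). These can be computed piece by piece, which
  also shows that the moves create no closed matched curves (`Eqv.isMatching`).
* The link does not depend on the marking (`Eqv.markedLink`): of two markings of the same diagram,
  the part of an edge between its two marks is an inner section, and it shrinks to a point while the
  crossings at its end or at its beginning are moved along the cable. A crossing that passes a maximum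
  or a minimum is turned by a half turn, and this is where the `Z`-move is needed.
* The link does not change under the moves (`eqv_markedLink`): a move on a diagram is followed by a
  move of suitable markings of the changed part (`follows_localMove`), and these extend to the whole
  diagram up to further marks on the boundary of that part.

Every link diagram `w` is recovered from the ladder `resolve w` by the replacement
(`Eqv.toLink_resolve`), and the replacement in a ladder is the link diagram of its standard marking
(`Ladder.eqv_marking`). Hence the two maps are inverse to each other. Moreover every graphene is
represented by a ladder, so that a functor with the required property is unique.

The many identities that hold by planar isotopy and moves on intersections alone are verified by
computation. A drawing without lower boundary is determined up to these moves by its vertices and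
the pairing of their legs, provided that it contains no closed curves without vertices. This
normal form is computed by `nf`, and `Eqv.of_nf` compares two drawings by their normal forms.
-/

/-! ### Typed equivalence of drawings -/

namespace DrawingKind

variable {S : DrawingKind}

@[simp] lemma shift_nil (k : ℕ) : shift k ([] : S.Word) = [] := rfl

@[simp] lemma shift_cons (k : ℕ) (s : ℕ × S.Piece) (w : S.Word) :
    shift k (s :: w) = (k + s.1, s.2) :: shift k w := rfl

@[simp] lemma shift_append (k : ℕ) (u v : S.Word) : shift k (u ++ v) = shift k u ++ shift k v := by
  simp [shift]

@[simp] lemma shift_zero (w : S.Word) : shift 0 w = w := by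
  simp [shift]

lemma shift_shift (k l : ℕ) (w : S.Word) : shift k (shift l w) = shift (k + l) w := by
  simp [shift, Nat.add_assoc]

lemma passRight_shift (c : S.Color) (k j : ℕ) (l : List S.Color) :
    passRight c (k + j) l = shift k (passRight c j l) := by
  induction l generalizing j with
  | nil => rfl
  | cons d l ih => simp [passRight, ← ih, Nat.add_assoc]

lemma passRight_eq_shift (c : S.Color) (k : ℕ) (l : List S.Color) :
    passRight c k l = shift k (passRight c 0 l) := passRight_shift c k 0 l

lemma passLeft_shift (c : S.Color) (k j : ℕ) (l : List S.Color) :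
    passLeft c (k + j) l = shift k (passLeft c j l) := by
  induction l generalizing j with
  | nil => rfl
  | cons d l ih => simp [passLeft, ← ih, Nat.add_assoc]

lemma passRight_append (c : S.Color) (k : ℕ) (l l' : List S.Color) :
    passRight c k (l ++ l') = passRight c k l ++ passRight c (k + l.length) l' := by
  induction l generalizing k with
  | nil => simp [passRight]
  | cons d l ih => simp [passRight, ih]; congr 1; omega

lemma passLeft_append (c : S.Color) (k : ℕ) (l l' : List S.Color) :
    passLeft c k (l ++ l') = passLeft c (k + l.length) l' ++ passLeft c k l := by
  induction l generalizing k with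
  | nil => simp [passLeft]
  | cons d l ih => simp [passLeft, ih]; congr 1; omega

lemma Fits.mk' (x : List S.Color) (e : S.Piece) (y : List S.Color) {k : ℕ} (h : x.length = k) :
    Fits (x ++ e.src ++ y) (k, e) (x ++ e.tgt ++ y) := ⟨x, y, h, rfl, rfl⟩

@[simp] lemma runs_nil {a b : List S.Color} : Runs a [] b ↔ a = b := Iff.rfl

lemma Runs.nil (a : List S.Color) : Runs a [] a := rfl

lemma runs_append {a c : List S.Color} {u v : S.Word} :
    Runs a (u ++ v) c ↔ ∃ b, Runs a u b ∧ Runs b v c := by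
  induction u generalizing a with
  | nil => simp [Runs]
  | cons s u ih =>
    simp only [List.cons_append, Runs, ih]
    constructor
    · rintro ⟨a', h, b, h1, h2⟩; exact ⟨b, ⟨a', h, h1⟩, h2⟩
    · rintro ⟨b, ⟨a', h, h1⟩, h2⟩; exact ⟨a', h, b, h1, h2⟩

lemma Runs.append {a b c : List S.Color} {u v : S.Word} (h : Runs a u b) (h' : Runs b v c) :
    Runs a (u ++ v) c := runs_append.2 ⟨b, h, h'⟩

lemma runs_singleton {a b : List S.Color} {s : ℕ × S.Piece} : Runs a [s] b ↔ Fits a s b := by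
  simp [Runs]

lemma Fits.whisker {a b : List S.Color} {s : ℕ × S.Piece} (h : Fits a s b) (x y : List S.Color) :
    Fits (x ++ a ++ y) (x.length + s.1, s.2) (x ++ b ++ y) := by
  obtain ⟨x', y', hx, rfl, rfl⟩ := h
  exact ⟨x ++ x', y' ++ y, by simp [hx], by simp, by simp⟩

lemma Runs.whisker {a b : List S.Color} {w : S.Word} (h : Runs a w b) (x y : List S.Color) :
    Runs (x ++ a ++ y) (shift x.length w) (x ++ b ++ y) := by
  induction w generalizing a with
  | nil => cases h; rfl
  | cons s w ih =>
    obtain ⟨a', h1, h2⟩ := h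
    exact ⟨_, h1.whisker x y, ih h2⟩

lemma Fits.det {a b b' : List S.Color} {s : ℕ × S.Piece} (h : Fits a s b) (h' : Fits a s b') :
    b = b' := by
  obtain ⟨x, y, hx, rfl, rfl⟩ := h
  obtain ⟨x', y', hx', h, rfl⟩ := h'
  simp only [List.append_assoc] at h
  obtain ⟨rfl, h⟩ := List.append_inj h (hx.trans hx'.symm)
  simp at h
  simp [h]

lemma Runs.det {a b b' : List S.Color} {w : S.Word} (h : Runs a w b) (h' : Runs a w b') :
    b = b' := by
  induction w generalizing a with
  | nil => cases h; cases h'; rfl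
  | cons s w ih =>
    obtain ⟨a1, h1, h2⟩ := h
    obtain ⟨a2, h3, h4⟩ := h'
    cases h1.det h3
    exact ih h2 h4

/-- A piece with strands to its left leaves the strands on the far left alone. -/
lemma Runs.strip {A B : List S.Color} {k : ℕ} {w : S.Word} (h : Runs A (shift k w) B)
    (hw : w ≠ [] ∨ k ≤ A.length) :
    ∃ X a b, X.length = k ∧ A = X ++ a ∧ B = X ++ b ∧ Runs a w b := by
  have key : ∀ (w : S.Word) (X a : List S.Color), X.length = k → Runs (X ++ a) (shift k w) B →
      ∃ b, B = X ++ b ∧ Runs a w b := by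
    intro w
    induction w with
    | nil => intro X a _ h; exact ⟨a, h.symm, rfl⟩
    | cons s w ih =>
      rintro X a hX ⟨a', ⟨x, y, hx, h1, rfl⟩, h2⟩
      simp only [List.append_assoc] at h1
      have hx' : x = X ++ x.drop k := by
        have h3 := congrArg (List.take k) h1
        rw [List.take_append_of_le_length (by omega), List.take_append_of_le_length (by
          simp at hx; omega), ← hX, List.take_length] at h3
        nth_rw 1 [← List.take_append_drop k x, ← hX, ← h3]
      rw [hx'] at h2 h1
      simp only [List.append_assoc] at h1 h2
      obtain ⟨b, rfl, h4⟩ := ih X _ hX h2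
      refine ⟨b, rfl, _, ⟨x.drop k, y, ?_, ?_, ?_⟩, h4⟩
      · simp [hx]
      · simpa using h1
      · simp
  have hk : k ≤ A.length := by
    rcases hw with hw | hw
    · cases w with
      | nil => exact absurd rfl hw
      | cons s w =>
        obtain ⟨_, ⟨x, y, hx, rfl, rfl⟩, _⟩ := h
        simp at hx
        simp; omega
    · exact hw
  obtain ⟨b, hb, h'⟩ := key w (A.take k) (A.drop k) (by simp [hk]) (by rwa [List.take_append_drop])
  exact ⟨A.take k, A.drop k, b, by simp [hk], by simp, hb, h'⟩

/-- The moves common to all kinds of drawings, together with some special moves `Q`. -/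
abbrev Moves (Q : S.Word → S.Word → Prop) (u v : S.Word) : Prop :=
  PlanarIsotopy u v ∨ IntersectionMove u v ∨ Q u v

/-- Two drawings with upper boundary `a` and lower boundary `b` are connected by planar isotopy,
the moves on intersections, and the moves `Q`, through drawings with the same boundaries. -/
inductive Eqv (Q : S.Word → S.Word → Prop) (a b : List S.Color) : S.Word → S.Word → Prop
  | refl {u : S.Word} (h : Runs a u b) : Eqv Q a b u u
  | step {u v : S.Word} (h : Rewrite (Moves Q) u v) (hu : Runs a u b) (hv : Runs a v b) :
      Eqv Q a b u v
  | symm {u v : S.Word} (h : Eqv Q a b u v) : Eqv Q a b v u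
  | trans {u v w : S.Word} (h : Eqv Q a b u v) (h' : Eqv Q a b v w) : Eqv Q a b u w

variable {Q : S.Word → S.Word → Prop}

lemma Eqv.runs {a b : List S.Color} {u v : S.Word} (h : Eqv Q a b u v) :
    Runs a u b ∧ Runs a v b := by
  induction h with
  | refl h => exact ⟨h, h⟩
  | step _ h h' => exact ⟨h, h'⟩
  | symm _ ih => exact ih.symm
  | trans _ _ ih ih' => exact ⟨ih.1, ih'.2⟩

lemma Eqv.move {a b : List S.Color} {u v : S.Word} (h : Moves Q u v) (hu : Runs a u b)
    (hv : Runs a v b) : Eqv Q a b u v :=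
  .step ⟨[], [], u, v, 0, h, by simp, by simp⟩ hu hv

lemma Eqv.comp {a b c : List S.Color} {u u' v v' : S.Word} (h : Eqv Q a b u u')
    (h' : Eqv Q b c v v') : Eqv Q a c (u ++ v) (u' ++ v') := by
  have h1 : ∀ {v}, Runs b v c → Eqv Q a c (u ++ v) (u' ++ v) := by
    intro v hv
    clear h'
    induction h with
    | refl h => exact .refl (h.append hv)
    | step h hu hu' =>
      obtain ⟨p, q, s, t, k, hst, rfl, rfl⟩ := h
      exact .step ⟨p, q ++ v, s, t, k, hst, by simp, by simp⟩ (hu.append hv) (hu'.append hv)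
    | symm _ ih => exact ih.symm
    | trans _ _ ih ih' => exact ih.trans ih'
  have h2 : ∀ {u}, Runs a u b → Eqv Q a c (u ++ v) (u ++ v') := by
    intro u hu
    clear h h1
    induction h' with
    | refl h => exact .refl (hu.append h)
    | step h hv hv' =>
      obtain ⟨p, q, s, t, k, hst, rfl, rfl⟩ := h
      exact .step ⟨u ++ p, q, s, t, k, hst, by simp, by simp⟩ (hu.append hv) (hu.append hv')
    | symm _ ih => exact ih.symm
    | trans _ _ ih ih' => exact ih.trans ih'
  exact (h1 h'.runs.1).trans (h2 h.runs.2)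

lemma Eqv.left {a b c : List S.Color} {u v v' : S.Word} (h' : Eqv Q b c v v') (h : Runs a u b) :
    Eqv Q a c (u ++ v) (u ++ v') := (Eqv.refl h).comp h'

lemma Eqv.right {a b c : List S.Color} {u u' v : S.Word} (h : Eqv Q a b u u') (h' : Runs b v c) :
    Eqv Q a c (u ++ v) (u' ++ v) := h.comp (.refl h')

lemma Eqv.cons {a b c : List S.Color} {s : ℕ × S.Piece} {v v' : S.Word} (h' : Eqv Q b c v v')
    (h : Fits a s b) : Eqv Q a c (s :: v) (s :: v') :=
  h'.left (u := [s]) (runs_singleton.2 h)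

lemma Eqv.whisker {a b : List S.Color} {u v : S.Word} (h : Eqv Q a b u v) (x y : List S.Color) :
    Eqv Q (x ++ a ++ y) (x ++ b ++ y) (shift x.length u) (shift x.length v) := by
  induction h with
  | refl h => exact .refl (h.whisker x y)
  | step h hu hv =>
    refine .step ?_ (hu.whisker x y) (hv.whisker x y)
    obtain ⟨p, q, s, t, k, hst, rfl, rfl⟩ := h
    exact ⟨shift x.length p, shift x.length q, s, t, x.length + k, hst, by simp [shift_shift],
      by simp [shift_shift]⟩
  | symm _ ih => exact ih.symm
  | trans _ _ ih ih' => exact ih.trans ih'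

lemma Eqv.whisker' {a b A B : List S.Color} {u v : S.Word} (h : Eqv Q a b u v)
    (x y : List S.Color) {k : ℕ} (hk : x.length = k) (hA : A = x ++ a ++ y)
    (hB : B = x ++ b ++ y) : Eqv Q A B (shift k u) (shift k v) := by
  subst hA hB hk; exact h.whisker x y

/-- Replacement of a subdrawing by an equivalent one. -/
lemma Eqv.replace {a b A B A' B' : List S.Color} {p q u v : S.Word} (h : Eqv Q a b u v) (x y : List S.Color)
    {k : ℕ} (hk : x.length = k) (hp : Runs A' p A) (hq : Runs B q B') (hA : A = x ++ a ++ y)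
    (hB : B = x ++ b ++ y) :
    Eqv Q A' B' (p ++ shift k u ++ q) (p ++ shift k v ++ q) :=
  ((h.whisker' x y hk hA hB).left hp).right hq

/-- The boundary of a drawing, computed from the drawing and its upper boundary. -/
def runList [DecidableEq S.Color] : List S.Color → S.Word → Option (List S.Color)
  | a, [] => some a
  | a, s :: w =>
    if s.1 ≤ a.length ∧ (a.drop s.1).take s.2.src.length = s.2.src then
      runList (a.take s.1 ++ s.2.tgt ++ a.drop (s.1 + s.2.src.length)) w
    else none

lemma runs_of_runList [DecidableEq S.Color] {a b : List S.Color} {w : S.Word}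
    (h : runList a w = some b) : Runs a w b := by
  induction w generalizing a with
  | nil => simpa [runList, Runs] using h
  | cons s w ih =>
    rw [runList] at h
    split_ifs at h with hs
    refine ⟨_, ⟨a.take s.1, a.drop (s.1 + s.2.src.length), by simp [hs.1], ?_, rfl⟩, ih h⟩
    nth_rw 1 [← List.take_append_drop s.1 a, ← List.take_append_drop s.2.src.length (a.drop s.1), hs.2]
    simp

/-- Two subdrawings that lie side by side can be moved to either order of heights. -/
lemma Eqv.interchange {a a' b b' : List S.Color} {u v : S.Word} (hu : Runs a u a')
    (hv : Runs b v b') :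
    Eqv Q (a ++ b) (a' ++ b') (u ++ shift a'.length v) (shift a.length v ++ u) := by
  have base : ∀ (e e' : S.Piece) (x y x' y' : List S.Color),
      Eqv Q ((x ++ e.src ++ y) ++ (x' ++ e'.src ++ y')) ((x ++ e.tgt ++ y) ++ (x' ++ e'.tgt ++ y'))
        [(x.length, e), ((x ++ e.tgt ++ y).length + x'.length, e')]
        [((x ++ e.src ++ y).length + x'.length, e'), (x.length, e)] := by
    intro e e' x y x' y'
    have h1 : Eqv Q (e.src ++ (y ++ x') ++ e'.src) (e.tgt ++ (y ++ x') ++ e'.tgt)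
        [(0, e), (e.tgt.length + (y ++ x').length, e')]
        [(e.src.length + (y ++ x').length, e'), (0, e)] := by
      refine .move (.inl (.exchange e e' _)) ?_ ?_
      · exact ⟨_, ⟨[], (y ++ x') ++ e'.src, rfl, by simp, rfl⟩, _,
          ⟨e.tgt ++ (y ++ x'), [], by simp, by simp, rfl⟩, by simp⟩
      · exact ⟨_, ⟨e.src ++ (y ++ x'), [], by simp, by simp, rfl⟩, _,
          ⟨[], (y ++ x') ++ e'.tgt, rfl, by simp, rfl⟩, by simp⟩
    have h2 := h1.whisker x y'
    simpa [Nat.add_assoc, List.append_assoc] using h2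
  have one : ∀ (s : ℕ × S.Piece) {a a' : List S.Color}, Fits a s a' → ∀ (v : S.Word) (b : List S.Color),
      Runs b v b' → Eqv Q (a ++ b) (a' ++ b') ([s] ++ shift a'.length v) (shift a.length v ++ [s]) := by
    intro s a a' hs v
    induction v with
    | nil =>
      intro b hb
      cases hb
      exact .refl (by simpa using (runs_singleton.2 hs).whisker [] b')
    | cons t v ih =>
      rintro b ⟨b1, ⟨x', y', hx', rfl, rfl⟩, h2⟩
      have h3 := ih _ h2
      obtain ⟨k, e⟩ := s
      obtain ⟨l, e'⟩ := t
      obtain ⟨x, y, hx, rfl, rfl⟩ := hs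
      simp only at hx hx'
      subst hx hx'
      have h4 := base e e' x y x' y'
      have h5 := h4.right (v := shift (x ++ e.tgt ++ y).length v)
        (by simpa using h2.whisker (x ++ e.tgt ++ y) [])
      have h6 := h3.cons (s := ((x ++ e.src ++ y).length + x'.length, e'))
        (a := (x ++ e.src ++ y) ++ (x' ++ e'.src ++ y'))
        (by have := (Fits.mk' x' e' y' rfl).whisker (x ++ e.src ++ y) []; simpa using this)
      refine Eqv.trans (v := ((x ++ e.src ++ y).length + x'.length, e') ::
        ([(x.length, e)] ++ shift (x ++ e.tgt ++ y).length v)) ?_ ?_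
      · simpa using h5
      · simpa using h6
  induction u generalizing a with
  | nil =>
    cases hu
    simpa using Eqv.refl (Q := Q) (hv.whisker a' [])
  | cons s u ih =>
    obtain ⟨a1, h1, h2⟩ := hu
    have h3 := (ih h2).cons (s := s) (a := a ++ b) (by simpa using h1.whisker [] b)
    have h4 := (one s h1 v b hv).right (v := u) (by simpa using h2.whisker [] b')
    exact h3.trans (by simpa using h4)

end DrawingKind

/-! ### Strands passing across drawings -/

namespace DrawingKind

variable {S : DrawingKind} {Q : S.Word → S.Word → Prop}

lemma runs_cons {a b : List S.Color} {k : ℕ} {e : S.Piece} {w : S.Word} :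
    Runs a ((k, e) :: w) b ↔ (k ≤ a.length ∧ (a.drop k).take e.src.length = e.src) ∧
      Runs (a.take k ++ e.tgt ++ a.drop (k + e.src.length)) w b := by
  constructor
  · rintro ⟨_, ⟨x, y, hx, rfl, rfl⟩, h⟩
    simp only at hx h ⊢
    subst hx
    refine ⟨by simp, ?_⟩
    have : List.drop (x.length + e.src.length) x = [] := by simp
    simpa [List.take_append, List.drop_append, this] using h
  · rintro ⟨⟨h1, h2⟩, h⟩
    refine ⟨_, ⟨a.take k, a.drop (k + e.src.length), by simp [h1], ?_, rfl⟩, h⟩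
    nth_rw 1 [← List.take_append_drop k a, ← List.take_append_drop e.src.length (a.drop k), h2]
    simp

lemma Eqv.zigzag (c : S.Color) : Eqv Q [c] [c] [(1, .cup c), (0, .cap c)] [] :=
  .move (.inl (.zigzag c)) (by simp [runs_cons, Piece.src, Piece.tgt]) rfl

lemma Eqv.zagzig (c : S.Color) : Eqv Q [c] [c] [(0, .cup c), (1, .cap c)] [] :=
  .move (.inl (.zagzig c)) (by simp [runs_cons, Piece.src, Piece.tgt]) rfl

lemma Eqv.slideCup (c d : S.Color) : Eqv Q [d] [c, d, c]
    [(1, .cup c), (0, .cross d c)] [(0, .cup c), (1, .cross c d)] :=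
  .move (.inl (.slideCup c d)) (by simp [runs_cons, Piece.src, Piece.tgt])
    (by simp [runs_cons, Piece.src, Piece.tgt])

lemma Eqv.slideCap (c d : S.Color) : Eqv Q [c, d, c] [d]
    [(0, .cross c d), (1, .cap c)] [(1, .cross d c), (0, .cap c)] :=
  .move (.inl (.slideCap c d)) (by simp [runs_cons, Piece.src, Piece.tgt])
    (by simp [runs_cons, Piece.src, Piece.tgt])

lemma Eqv.kink (c : S.Color) : Eqv Q [] [c, c] [(0, .cup c), (0, .cross c c)] [(0, .cup c)] :=
  .move (.inr (.inl (.kink c))) (by simp [runs_cons, Piece.src, Piece.tgt])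
    (by simp [runs_cons, Piece.src, Piece.tgt])

lemma Eqv.bigon (c d : S.Color) : Eqv Q [c, d] [c, d] [(0, .cross c d), (0, .cross d c)] [] :=
  .move (.inr (.inl (.bigon c d))) (by simp [runs_cons, Piece.src, Piece.tgt]) rfl

lemma Eqv.triangle (c d e : S.Color) : Eqv Q [c, d, e] [e, d, c]
    [(0, .cross c d), (1, .cross c e), (0, .cross d e)]
    [(1, .cross d e), (0, .cross c e), (1, .cross c d)] :=
  .move (.inr (.inl (.triangle c d e))) (by simp [runs_cons, Piece.src, Piece.tgt])
    (by simp [runs_cons, Piece.src, Piece.tgt])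

lemma runs_passRight (c : S.Color) (l : List S.Color) :
    Runs (c :: l) (passRight c 0 l) (l ++ [c]) := by
  induction l with
  | nil => rfl
  | cons d l ih =>
    refine ⟨_, ⟨[], l, rfl, rfl, rfl⟩, ?_⟩
    simpa [passRight_eq_shift c (0 + 1), Piece.tgt] using ih.whisker [d] []

lemma runs_passLeft (c : S.Color) (l : List S.Color) :
    Runs (l ++ [c]) (passLeft c 0 l) (c :: l) := by
  induction l with
  | nil => rfl
  | cons d l ih =>
    have h := (ih.whisker [d] []).append (v := [(0, .cross d c)]) (c := c :: d :: l)
      (runs_singleton.2 ⟨[], l, rfl, by simp [Piece.src], by simp [Piece.tgt]⟩)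
    simpa [passLeft, passLeft_shift c 1 0] using h

/-- An intersection of two ends of a minimum is removed, like that of two ends of a maximum. -/
lemma Eqv.kinkCap (c : S.Color) : Eqv Q [c, c] [] [(0, .cross c c), (0, .cap c)] [(0, .cap c)] := by
  -- The curl on the strand obtained by bending one end up is an ordinary kink.
  have h1 : Eqv Q [c] [c] [(0, .cup c), (1, .cross c c), (1, .cap c)] [] := by
    have e1 := (Eqv.slideCup (Q := Q) c c).symm.right (v := [(1, .cap c)]) (c := [c])
      (by simp [runs_cons, Piece.src, Piece.tgt])
    have e2 := (Eqv.slideCap (Q := Q) c c).left (u := [(1, .cup c)]) (a := [c])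
      (by simp [runs_cons, Piece.src, Piece.tgt])
    have e3 := ((Eqv.kink (Q := Q) c).whisker [c] []).right (v := [(0, .cap c)]) (c := [c])
      (by simp [runs_cons, Piece.src, Piece.tgt])
    exact e1.trans (e2.trans (e3.trans (Eqv.zigzag c)))
  have h2 := ((h1.whisker [c] []).right (v := [(0, .cap c)]) (c := [])
      (by simp [runs_cons, Piece.src, Piece.tgt]))
  have h3 : Eqv Q [c, c] [] [(1, .cup c), (2, .cross c c), (2, .cap c), (0, .cap c)]
      [(1, .cup c), (0, .cap c), (0, .cross c c), (0, .cap c)] := by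
    have := (Eqv.interchange (Q := Q) (a := [c, c]) (a' := []) (b := [c, c]) (b' := [])
      (u := [(0, .cap c)]) (v := [(0, .cross c c), (0, .cap c)])
      (by simp [runs_cons, Piece.src, Piece.tgt]) (by simp [runs_cons, Piece.src, Piece.tgt])).symm
    exact this.cons (s := (1, .cup c)) ⟨[c], [c], rfl, rfl, rfl⟩
  have h4 := ((Eqv.zigzag (Q := Q) c).whisker [] [c]).right (v := [(0, .cross c c), (0, .cap c)])
    (c := []) (by simp [runs_cons, Piece.src, Piece.tgt])
  exact (h4.symm.trans (h3.symm.trans h2))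

/-- A strand passes a single piece. -/
lemma Eqv.pass_piece (c : S.Color) (e : S.Piece) :
    Eqv Q (c :: e.src) (e.tgt ++ [c]) (passRight c 0 e.src ++ [(0, e)])
      ((1, e) :: passRight c 0 e.tgt) := by
  cases e with
  | cup d =>
    have e1 := (Eqv.slideCup (Q := Q) d c).right (v := [(1, .cross c d)]) (c := [d, d, c])
      (by simp [runs_cons, Piece.src, Piece.tgt])
    have e2 := ((Eqv.bigon (Q := Q) d c).whisker [d] []).cons (s := (0, .cup d)) (a := [c])
      ⟨[], [c], rfl, rfl, rfl⟩
    exact (e1.trans e2).symm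
  | cap d =>
    have e1 := (Eqv.slideCap (Q := Q) d c).symm.cons (s := (0, .cross c d)) (a := [c, d, d])
      ⟨[], [d], rfl, rfl, rfl⟩
    have e2 := ((Eqv.bigon (Q := Q) c d).whisker [] [d]).right (v := [(1, .cap d)]) (c := [c])
      (by simp [runs_cons, Piece.src, Piece.tgt])
    exact e1.trans e2
  | cross d e => exact .triangle c d e
  | node g =>
    have h := IntersectionMove.pass c g (S.legs g) [] (by simp)
    refine .symm (.move (.inr (.inl h)) ?_ ?_)
    · refine ⟨_, ⟨[c], [], rfl, rfl, rfl⟩, ?_⟩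
      simpa [Piece.tgt] using runs_passRight c (S.legs g)
    · exact ⟨_, ⟨[], [c], rfl, rfl, rfl⟩, by simp [Runs]⟩

/-- A strand passes any drawing. -/
lemma Eqv.pass {a b : List S.Color} {w : S.Word} (h : Runs a w b) (c : S.Color) :
    Eqv Q (c :: a) (b ++ [c]) (passRight c 0 a ++ w) (shift 1 w ++ passRight c 0 b) := by
  induction w generalizing a with
  | nil => cases h; simpa using Eqv.refl (Q := Q) (runs_passRight c b)
  | cons s w ih =>
    obtain ⟨_, ⟨x, y, hx, rfl, rfl⟩, h⟩ := h
    obtain ⟨k, e⟩ := s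
    simp only at hx h
    subst hx
    have e1 := ((Eqv.interchange (Q := Q) (runs_singleton.2 (Fits.mk' [] e [] rfl))
      (runs_passRight c y)).whisker x []).symm
    have e2 := (Eqv.pass_piece (Q := Q) c e).whisker x y
    have e3 := (Eqv.interchange (Q := Q) (runs_passRight c x)
      (runs_singleton.2 (Fits.mk' [] e [] rfl))).whisker [] y
    simp only [shift_append, shift_shift, shift_cons, shift_nil, List.append_nil, List.nil_append,
      Nat.add_zero, List.length_append, List.length_cons, List.length_nil, shift_zero,
      List.cons_append, List.append_assoc] at e1 e2 e3
    have e1' := e1.left (a := c :: (x ++ (e.src ++ y)))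
      (u := passRight c 0 x ++ shift x.length (passRight c 0 e.src)) (by
        have h1 := ((runs_passRight c x).whisker [] (e.src ++ y)).append
          (by simpa using ((runs_passRight c e.src).whisker x y))
        simpa using h1)
    have e2' := (e2.left (a := c :: (x ++ (e.src ++ y))) (u := passRight c 0 x)
      (by simpa using (runs_passRight c x).whisker [] (e.src ++ y))).right
        (v := shift (x.length + e.tgt.length) (passRight c 0 y)) (c := x ++ (e.tgt ++ (y ++ [c])))
        (by simpa using (runs_passRight c y).whisker (x ++ e.tgt) [])
    have e3' := e3.right (v := shift x.length (passRight c 0 e.tgt) ++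
        shift (x.length + e.tgt.length) (passRight c 0 y)) (c := x ++ (e.tgt ++ (y ++ [c]))) (by
        have h1 := ((runs_passRight c e.tgt).whisker x y).append
          (v := shift (x.length + e.tgt.length) (passRight c 0 y)) (c := x ++ (e.tgt ++ (y ++ [c])))
          (by simpa using (runs_passRight c y).whisker (x ++ e.tgt) [])
        simpa using h1)
    have e4 := (ih h).cons (s := (x.length + 1, e)) (a := c :: (x ++ (e.src ++ y)))
      ⟨c :: x, y, by simp, by simp, by simp⟩
    have e5 : Eqv Q (c :: (x ++ (e.src ++ y))) (x ++ (e.tgt ++ (y ++ [c])))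
        (passRight c 0 (x ++ (e.src ++ y)) ++ [(x.length, e)])
        ((x.length + 1, e) :: passRight c 0 (x ++ (e.tgt ++ y))) := by
      simp only [passRight_append, Nat.zero_add, List.append_assoc, List.cons_append]
        at e1' e2' e3' ⊢
      simp only [passRight_eq_shift c x.length, passRight_eq_shift c (x.length + _)]
      exact e1'.trans (e2'.trans e3')
    have e6 := e5.right (v := w) (c := b ++ [c]) (by simpa using h.whisker [] [c])
    have e7 : Eqv Q (c :: (x ++ e.src ++ y)) (b ++ [c])
      (passRight c 0 (x ++ (e.src ++ y)) ++ [(x.length, e)] ++ w) _ :=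
      Eqv.trans (by simpa using e6) (by simpa using e4)
    simpa [Nat.add_comm] using e7

/-! ### Closing up pairs of strands -/

/-- The strand on the left runs across the strands `m` and ends, in a minimum, at the strand that
follows. -/
def hook (c : S.Color) (m : List S.Color) : S.Word := passRight c 0 m ++ [(m.length, .cap c)]

lemma runs_hook (c : S.Color) (m : List S.Color) : Runs (c :: (m ++ [c])) (hook c m) m := by
  have h := ((runs_passRight c m).whisker [] [c]).append (v := [(m.length, .cap c)]) (c := m)
    (runs_singleton.2 ⟨m, [], rfl, by simp [Piece.src], by simp [Piece.tgt]⟩)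
  simpa [hook] using h

lemma hook_cons (c d : S.Color) (m : List S.Color) :
    hook c (d :: m) = (0, .cross c d) :: shift 1 (hook c m) := by
  simp [hook, passRight, passRight_eq_shift c 1, Nat.add_comm]

lemma runs_hook' (c : S.Color) (m n : List S.Color) :
    Runs (c :: (m ++ c :: n)) (hook c m) (m ++ n) := by
  simpa using (runs_hook c m).whisker [] n

/-- Whatever lies inside of a hook can be moved out of it. -/
lemma Eqv.hook_left {m m' : List S.Color} {w : S.Word} (h : Runs m w m') (c : S.Color)
    (n : List S.Color) :
    Eqv Q (c :: (m ++ c :: n)) (m' ++ n) (shift 1 w ++ hook c m') (hook c m ++ w) := by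
  have e1 := ((Eqv.pass (Q := Q) h c).symm.whisker [] [c]).right (v := [(m'.length, .cap c)])
    (c := m') (runs_singleton.2 ⟨m', [], rfl, by simp [Piece.src], by simp [Piece.tgt]⟩)
  have e2 := (Eqv.interchange (Q := Q) h (b := [c, c]) (b' := []) (v := [(0, .cap c)])
    (by simp [runs_cons, Piece.src, Piece.tgt])).left (a := c :: (m ++ [c])) (u := passRight c 0 m)
    (by simpa using (runs_passRight c m).whisker [] [c])
  have e3 := (Eqv.trans (by simpa [hook] using e1) (by simpa [hook] using e2) : Eqv Q (c :: (m ++ [c])) m'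
    (shift 1 w ++ hook c m') (hook c m ++ w))
  simpa using e3.whisker [] n

/-- Whatever lies to the right of a hook can be moved below it. -/
lemma Eqv.hook_right {n n' : List S.Color} {w : S.Word} (h : Runs n w n') (c : S.Color)
    (m : List S.Color) :
    Eqv Q (c :: (m ++ c :: n)) (m ++ n') (shift (m.length + 2) w ++ hook c m)
      (hook c m ++ shift m.length w) := by
  have := (Eqv.interchange (Q := Q) (runs_hook c m) h).symm
  simpa [Nat.add_assoc] using this

lemma Eqv.cross_hook_snoc (c e : S.Color) (m : List S.Color) :
    Eqv Q (c :: (m ++ [e, c])) (m ++ [e]) ((m.length + 1, .cross e c) :: hook c m)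
      (hook c (m ++ [e])) := by
  have e1 := (Eqv.interchange (Q := Q) (runs_passRight c m) (b := [e, c]) (b' := [c, e])
    (v := [(0, .cross e c)]) (by simp [runs_cons, Piece.src, Piece.tgt])).symm.right
    (v := [(m.length, .cap c)]) (c := m ++ [e])
    (runs_singleton.2 ⟨m, [e], rfl, by simp [Piece.src], by simp [Piece.tgt]⟩)
  have e2 := ((Eqv.slideCap (Q := Q) c e).symm.whisker m []).left (a := c :: (m ++ [e, c]))
    (u := passRight c 0 m) (by simpa using (runs_passRight c m).whisker [] [e, c])
  refine Eqv.trans (v := passRight c 0 m ++ [(m.length + 1, .cross e c), (m.length, .cap c)]) ?_ ?_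
  · simpa [hook] using e1
  · simpa [hook, passRight_append, passRight] using e2

lemma Eqv.cross_hook_snoc' (c e : S.Color) (m : List S.Color) :
    Eqv Q (c :: (m ++ [c, e])) (m ++ [e]) ((m.length + 1, .cross c e) :: hook c (m ++ [e]))
      (hook c m) := by
  have e1 := (Eqv.cross_hook_snoc (Q := Q) c e m).symm.cons (s := (m.length + 1, .cross c e))
    (a := c :: (m ++ [c, e])) ⟨c :: m, [], by simp, by simp [Piece.src], by simp [Piece.tgt]⟩
  have e2 := ((Eqv.bigon (Q := Q) c e).whisker (c :: m) []).right (v := hook c m) (c := m ++ [e])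
    (by simpa using runs_hook' c m [e])
  exact e1.trans (by simpa using e2)

lemma Eqv.cross_hook_cons (e f : S.Color) (l : List S.Color) :
    Eqv Q (e :: f :: (l ++ [f])) (e :: l) ((0, .cross e f) :: hook f (e :: l))
      (shift 1 (hook f l)) := by
  have e2 := ((Eqv.bigon (Q := Q) e f).whisker [] (l ++ [f])).right (v := shift 1 (hook f l))
    (c := e :: l) (by simpa using (runs_hook f l).whisker [e] [])
  simpa [hook_cons] using e2

lemma Eqv.hook_hook (e f : S.Color) (n n' : List S.Color) :
    Eqv Q (e :: f :: (n ++ e :: n' ++ [f])) (n ++ n')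
      (shift 1 (hook f (n ++ e :: n')) ++ hook e n) (hook e (f :: n) ++ hook f (n ++ n')) := by
  have e1 := (Eqv.hook_left (Q := Q) (runs_hook' e n n') f []).cons
    (s := (0, .cross e f)) (a := e :: f :: (n ++ e :: n' ++ [f])) ⟨[], _, rfl, rfl, by simp [Piece.tgt]⟩
  have e2 := (Eqv.cross_hook_cons (Q := Q) e f (n ++ e :: n')).right (v := hook e n) (c := n ++ n')
    (runs_hook' e n n')
  simp only [List.cons_append, List.append_assoc, List.append_nil, hook_cons e f] at e1 e2 ⊢
  exact e2.symm.trans e1.symm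

lemma Eqv.cup_shift_hook (c : S.Color) (l : List S.Color) :
    Eqv Q (l ++ [c]) (c :: l) ((0, .cup c) :: shift 1 (hook c l)) (passLeft c 0 l) := by
  induction l with
  | nil => exact Eqv.zagzig c
  | cons d l ih =>
    have e1 := ((Eqv.slideCup (Q := Q) c d).symm.whisker [] (l ++ [c])).right
      (v := shift 2 (hook c l)) (c := c :: d :: l) (by simpa using (runs_hook c l).whisker [c, d] [])
    have e2 := (Eqv.interchange (Q := Q) (a := [d, c]) (a' := [c, d]) (u := [(0, .cross d c)])
      (by simp [runs_cons, Piece.src, Piece.tgt]) (runs_hook c l)).cons (s := (1, .cup c))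
      (a := d :: (l ++ [c])) ⟨[d], l ++ [c], rfl, rfl, rfl⟩
    have e3 := (ih.whisker [d] []).right (v := [(0, .cross d c)]) (c := c :: d :: l)
      (runs_singleton.2 ⟨[], l, rfl, by simp [Piece.src], by simp [Piece.tgt]⟩)
    simp only [hook_cons, passLeft, passLeft_shift c 1 0, shift_cons, shift_shift] at e1 e2 e3 ⊢
    exact e1.trans (e2.trans (by simpa [shift_shift] using e3))

lemma Eqv.cup_hook_cons (c : S.Color) (l : List S.Color) :
    Eqv Q (l ++ [c]) (c :: l) ((0, .cup c) :: hook c (c :: l)) (passLeft c 0 l) := by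
  have e1 := ((Eqv.kink (Q := Q) c).whisker [] (l ++ [c])).right (v := shift 1 (hook c l))
    (c := c :: l) (by simpa using (runs_hook c l).whisker [c] [])
  rw [hook_cons]
  exact Eqv.trans (by simpa using e1) (Eqv.cup_shift_hook c l)

lemma Eqv.cup_hook (c : S.Color) (m : List S.Color) :
    Eqv Q (c :: m) (m ++ [c]) ((m.length + 1, .cup c) :: hook c m) (passRight c 0 m) := by
  have e1 := (Eqv.interchange (Q := Q) (runs_passRight c m) (b := []) (b' := [c, c])
    (v := [(0, .cup c)]) (by simp [runs_cons, Piece.src, Piece.tgt])).symm.right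
    (v := [(m.length, .cap c)]) (c := m ++ [c])
    (runs_singleton.2 ⟨m, [c], rfl, by simp [Piece.src], by simp [Piece.tgt]⟩)
  have e2 := ((Eqv.zigzag (Q := Q) c).whisker m []).left (a := c :: m) (u := passRight c 0 m)
    (by simpa using runs_passRight c m)
  refine Eqv.trans (v := passRight c 0 m ++ [(m.length + 1, .cup c), (m.length, .cap c)]) ?_ ?_
  · simpa [hook] using e1
  · simpa using e2

lemma Eqv.cup_hook_snoc (c : S.Color) (m : List S.Color) :
    Eqv Q (c :: m) (m ++ [c]) ((m.length + 1, .cup c) :: hook c (m ++ [c])) (passRight c 0 m) := by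
  -- The cup meets the strand with a kink, which is removed.
  have e1 := ((Eqv.kink (Q := Q) c).whisker (c :: m) []).right (v := hook c m) (c := m ++ [c])
    (by simpa using runs_hook' c m [c])
  have e2 := (Eqv.cross_hook_snoc (Q := Q) c c m).symm.cons (s := (m.length + 1, .cup c))
    (a := c :: m) ⟨c :: m, [], by simp, by simp [Piece.src], by simp [Piece.tgt]⟩
  exact e2.trans (Eqv.trans (by simpa using e1) (Eqv.cup_hook c m))

end DrawingKind

/-! ### A normal form for drawings without lower boundary -/

namespace DrawingKind

variable {S : DrawingKind} {Q : S.Word → S.Word → Prop}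

/-- The drawing that joins the strands `a` in pairs without closed curves. The leftmost strand has
`d` strands between itself and its partner, where `d` is the first entry of the list of numbers;
the further entries describe the remaining strands in the same way. -/
def capsWord : List S.Color → List ℕ → S.Word
  | c :: l, d :: ds => hook c (l.take d) ++ capsWord (l.take d ++ l.drop (d + 1)) ds
  | _, _ => []

/-- The list of distances pairs strands of equal colours. -/
inductive Paired : List S.Color → List ℕ → Prop
  | nil : Paired [] []
  | cons {c : S.Color} {m n : List S.Color} {ds : List ℕ} (h : Paired (m ++ n) ds) :
      Paired (c :: (m ++ c :: n)) (m.length :: ds)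

lemma capsWord_cons (c : S.Color) (m n : List S.Color) (ds : List ℕ) :
    capsWord (c :: (m ++ c :: n)) (m.length :: ds) = hook c m ++ capsWord (m ++ n) ds := by
  have : List.drop (m.length + 1) m = [] := by simp
  simp [capsWord, List.drop_append, this]

lemma Paired.runs {a : List S.Color} {ds : List ℕ} (h : Paired a ds) :
    Runs a (capsWord a ds) [] := by
  induction h with
  | nil => rfl
  | cons h ih => rw [capsWord_cons]; exact (runs_hook' _ _ _).append ih

/-- Effect on a pairing of an intersection of the first two strands above it. -/
def crossZero : List ℕ → List ℕ
  | (d + 1) :: d' :: ds =>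
    if d ≤ d' then (d' + 2) :: d :: ds else (d' + 1) :: (d - 1) :: ds
  | ds => ds

/-- Effect on a pairing of an intersection of the strands number `k` and `k + 1` above it. -/
def crossOp (k : ℕ) : List ℕ → List ℕ
  | [] => []
  | d :: ds =>
    match k with
    | 0 => crossZero (d :: ds)
    | j + 1 =>
      if j + 1 < d then d :: crossOp j ds
      else if j = d then (d + 1) :: ds
      else if j + 1 = d then (d - 1) :: ds
      else d :: crossOp (j - 1) ds

/-- Effect on a pairing of a minimum put above it. -/
def capOp (k : ℕ) : List ℕ → List ℕ
  | [] => [0]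
  | d :: ds =>
    match k with
    | 0 => 0 :: d :: ds
    | j + 1 => if j ≤ d then (d + 2) :: capOp j ds else d :: capOp (j - 1) ds

/-- Effect on a pairing of a maximum put above it; undefined if that creates a closed curve. -/
def cupOp (k : ℕ) : List ℕ → Option (List ℕ)
  | [] => none
  | d :: ds =>
    match k with
    | 0 => if d = 0 then none else some ((List.range (d - 1)).reverse.foldr crossOp ds)
    | j + 1 =>
      if j + 1 < d then (cupOp j ds).map ((d - 2) :: ·)
      else if d < j then (cupOp (j - 1) ds).map (d :: ·)
      else some ((List.range j).foldr crossOp ds)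

lemma Paired.inv {c : S.Color} {l : List S.Color} {ds : List ℕ} (h : Paired (c :: l) ds) :
    ∃ m n ds', l = m ++ c :: n ∧ ds = m.length :: ds' ∧ Paired (m ++ n) ds' := by
  cases h with
  | cons h => exact ⟨_, _, _, rfl, rfl, h⟩

/-- The drawing `w` above the pairing `ds` of the strands `b` is equivalent to the pairing `ds'` of
the strands `a`. -/
def Absorbs (Q : S.Word → S.Word → Prop) (a b : List S.Color) (w : S.Word) (ds ds' : List ℕ) : Prop :=
  Paired a ds' ∧ Eqv Q a [] (w ++ capsWord b ds) (capsWord a ds')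

lemma Absorbs.trans {a b c : List S.Color} {u v : S.Word} {ds ds' ds'' : List ℕ}
    (h : Absorbs Q a b u ds' ds'') (h' : Absorbs Q b c v ds ds') (hu : Runs a u b) :
    Absorbs Q a c (u ++ v) ds ds'' :=
  ⟨h.1, Eqv.trans (by simpa using h'.2.left hu) h.2⟩

/-- A drawing inside of the first hook. -/
lemma Absorbs.left {m m' n : List S.Color} {c : S.Color} {w : S.Word} {ds ds' : List ℕ}
    (h : Absorbs Q (m ++ n) (m' ++ n) w ds ds') (hw : Runs m w m') (hp : Paired (m' ++ n) ds) :
    Absorbs Q (c :: (m ++ c :: n)) (c :: (m' ++ c :: n)) (shift 1 w) (m'.length :: ds)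
      (m.length :: ds') := by
  refine ⟨.cons h.1, ?_⟩
  rw [capsWord_cons, capsWord_cons]
  have e1 := (Eqv.hook_left (Q := Q) hw c n).right hp.runs
  have e2 := h.2.left (runs_hook' c m n)
  exact Eqv.trans (by simpa using e1) (by simpa using e2)

/-- A drawing to the right of the first hook. -/
lemma Absorbs.right {m n n' : List S.Color} {c : S.Color} {w : S.Word} {ds ds' : List ℕ}
    (h : Absorbs Q (m ++ n) (m ++ n') (shift m.length w) ds ds') (hw : Runs n w n')
    (hp : Paired (m ++ n') ds) :
    Absorbs Q (c :: (m ++ c :: n)) (c :: (m ++ c :: n')) (shift (m.length + 2) w)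
      (m.length :: ds) (m.length :: ds') := by
  refine ⟨.cons h.1, ?_⟩
  rw [capsWord_cons, capsWord_cons]
  have e1 := (Eqv.hook_right (Q := Q) hw c m).right hp.runs
  have e2 := h.2.left (runs_hook' c m n)
  exact Eqv.trans (by simpa using e1) (by simpa using e2)

lemma runs_cross (e f : S.Color) : Runs [e, f] [(0, .cross e f)] [f, e] := by
  simp [runs_cons, Piece.src, Piece.tgt]

/-- The strands that meet in the intersection may be partners of each other, the leftmost strand and
another one, or neither; outside of the first hook the claim follows by induction. -/
lemma absorbs_cross {ds : List ℕ} {x y : List S.Color} {e f : S.Color}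
    (h : Paired (x ++ f :: e :: y) ds) :
    Absorbs Q (x ++ e :: f :: y) (x ++ f :: e :: y) [(x.length, .cross e f)] ds
      (crossOp x.length ds) := by
  induction ds generalizing x y with
  | nil => generalize hl : x ++ f :: e :: y = l at h; cases h; simp at hl
  | cons d ds ih =>
    cases x with
    | nil =>
      obtain ⟨m, n, ds', h1, h2, h3⟩ := Paired.inv h
      simp only [List.cons.injEq] at h2
      obtain ⟨rfl, rfl⟩ := h2
      cases m with
      | nil =>
        simp only [List.nil_append, List.cons.injEq] at h1
        obtain ⟨rfl, rfl⟩ := h1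
        have hc : crossOp 0 (0 :: ds) = 0 :: ds := by cases ds <;> rfl
        refine ⟨by simpa [hc] using h, ?_⟩
        -- The two strands are joined to each other, and the kink is removed.
        have e1 := ((Eqv.kinkCap (Q := Q) e).whisker [] y).right (Paired.runs h3)
        simp only [List.length_nil, List.nil_append, hc]
        have e2 := capsWord_cons e [] y ds
        simp only [List.length_nil, List.nil_append] at e2
        rw [e2]
        simpa [hook, passRight] using e1
      | cons e' l =>
        simp only [List.cons_append, List.cons.injEq] at h1
        obtain ⟨rfl, rfl⟩ := h1
        have h3' : Paired (e :: (l ++ n)) ds := h3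
        obtain ⟨m', n', ds', h4, rfl, h6⟩ := Paired.inv h3'
        have hc : crossOp 0 ((l.length + 1) :: m'.length :: ds') =
          if l.length ≤ m'.length then (m'.length + 2) :: l.length :: ds'
          else (m'.length + 1) :: (l.length - 1) :: ds' := rfl
        simp only [List.length_nil, List.nil_append, List.length_cons, hc]
        have e0 := capsWord_cons f (e :: l) n (m'.length :: ds')
        have e0' : capsWord (e :: (l ++ n)) (m'.length :: ds') = hook e m' ++ capsWord (m' ++ n') ds' := by
          rw [h4, capsWord_cons]
        have e1 := ((Eqv.cross_hook_cons (Q := Q) e f l).whisker [] n).right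
          (v := hook e m' ++ capsWord (m' ++ n') ds') (c := []) (by
            rw [← e0']; simpa using h3.runs)
        simp only [List.length_cons, List.cons_append] at e0
        rw [e0']at e0
        rw [Absorbs, e0]
        rcases List.append_eq_append_iff.1 h4 with ⟨a, rfl, rfl⟩ | ⟨a, rfl, h5⟩
        · rw [if_pos (by simp)]
          have hp : Paired (e :: f :: (l ++ f :: (a ++ e :: n')))
              (((l ++ a).length + 2) :: l.length :: ds') := by
            have h7 : Paired ((f :: (l ++ f :: a)) ++ n') (l.length :: ds') := by
              have := Paired.cons (c := f) (m := l) (n := a ++ n') (ds := ds') (by simpa using h6)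
              simpa using this
            have := Paired.cons (c := e) h7
            simpa [Nat.add_assoc] using this
          refine ⟨hp, ?_⟩
          have e2 := (Eqv.hook_left (Q := Q) (runs_hook' f l a) e n').right (h6.runs)
          have e3 := capsWord_cons e (f :: (l ++ f :: a)) n' (l.length :: ds')
          have e4 := capsWord_cons f l (a ++ n') ds'
          simp only [List.length_cons, List.length_append, List.cons_append, List.append_assoc] at e3 e4
          rw [e4] at e3
          have e5 : l.length + (a.length + 1) + 1 = (l ++ a).length + 2 := by simp; omega
          rw [e5] at e3
          rw [e3]
          exact Eqv.trans (by simpa using e1) (by simpa using e2)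
        · cases a with
          | nil =>
            simp only [List.nil_append] at h5
            subst h5
            simp only [List.append_nil] at *
            rw [if_pos (by simp)]
            have hp : Paired (e :: f :: (m' ++ f :: e :: n')) ((m'.length + 2) :: m'.length :: ds') := by
              have h7 : Paired ((f :: (m' ++ [f])) ++ n') (m'.length :: ds') := by
                have := Paired.cons (c := f) (m := m') (n := n') (ds := ds') (by simpa using h6)
                simpa using this
              have := Paired.cons (c := e) h7
              simpa [Nat.add_assoc] using this
            refine ⟨hp, ?_⟩
            have e2 := (Eqv.hook_left (Q := Q) (runs_hook f m') e n').right (h6.runs)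
            have e3 := capsWord_cons e (f :: (m' ++ [f])) n' (m'.length :: ds')
            have e4 := capsWord_cons f m' n' ds'
            simp only [List.length_cons, List.length_append, List.cons_append, List.append_assoc,
              List.length_nil, Nat.zero_add, List.nil_append] at e3 e4
            rw [e4] at e3
            rw [e3]
            exact Eqv.trans (by simpa using e1) (by simpa using e2)
          | cons e' a =>
            simp only [List.cons_append, List.cons.injEq] at h5
            obtain ⟨rfl, rfl⟩ := h5
            rw [if_neg (by simp)]
            have h7 : Paired ((m' ++ a) ++ n) ds' := by simpa using h6
            have hp : Paired ((f :: m') ++ (a ++ f :: n)) ((m' ++ a).length :: ds') := by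
              simpa using Paired.cons (c := f) h7
            have hp' := Paired.cons (c := e) hp
            have e2 := ((Eqv.hook_hook (Q := Q) e f m' a).whisker [] n).right (by simpa using h7.runs)
            have e3 := capsWord_cons e (f :: m') (a ++ f :: n) ((m' ++ a).length :: ds')
            have e4 := capsWord_cons f (m' ++ a) n ds'
            have e5 : (m' ++ e :: a).length - 1 = (m' ++ a).length := by simp
            rw [e5]
            simp only [List.cons_append, List.append_assoc] at e3 e4
            rw [e4] at e3
            refine ⟨by simpa using hp', ?_⟩
            simp only [List.length_cons, List.append_assoc, List.cons_append] at e3 ⊢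
            rw [e3]
            exact Eqv.trans (by simpa using e1) (by simpa using e2)
    | cons g x =>
      obtain ⟨m, n, ds', h1, h2, h3⟩ := Paired.inv h
      simp only [List.cons.injEq] at h2
      obtain ⟨rfl, rfl⟩ := h2
      have hc : crossOp (x.length + 1) (m.length :: ds) =
        if x.length + 1 < m.length then m.length :: crossOp x.length ds
        else if x.length = m.length then (m.length + 1) :: ds
        else if x.length + 1 = m.length then (m.length - 1) :: ds
        else m.length :: crossOp (x.length - 1) ds := rfl
      -- The partner of the leftmost strand takes part in the intersection.
      have mid : x = m → f = g → e :: y = n → Absorbs Q (g :: x ++ e :: f :: y) (g :: x ++ f :: e :: y)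
          [((g :: x).length, .cross e f)] (m.length :: ds) (crossOp (x.length + 1) (m.length :: ds)) := by
        rintro rfl rfl rfl
        rw [hc, if_neg (by omega), if_pos rfl]
        refine ⟨by simpa using Paired.cons (c := f) (m := x ++ [e]) (n := y) (by simpa using h3), ?_⟩
        have e0 := capsWord_cons f x (e :: y) ds
        have e0' := capsWord_cons f (x ++ [e]) y ds
        have e1 := ((Eqv.cross_hook_snoc (Q := Q) f e x).whisker [] y).right (by simpa using h3.runs)
        simp only [List.cons_append, List.append_assoc, List.length_append, List.length_cons,
          List.length_nil, List.nil_append, Nat.zero_add] at e0 e0' ⊢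
        rw [e0, e0']
        simpa using e1
      rcases List.append_eq_append_iff.1 h1 with ⟨a, rfl, h5⟩ | ⟨a, rfl, h5⟩
      · rcases a with _ | ⟨f', _ | ⟨e', a⟩⟩
        · simp only [List.nil_append, List.cons.injEq] at h5
          exact mid (by simp) h5.1 h5.2
        · simp only [List.cons_append, List.nil_append, List.cons.injEq] at h5
          obtain ⟨rfl, rfl, rfl⟩ := h5
          simp only [List.length_cons]
          rw [hc, if_neg (by simp), if_neg (by simp), if_pos (by simp)]
          refine ⟨by simpa using Paired.cons (c := e) (m := x) (n := f :: y) (by simpa using h3), ?_⟩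
          have e0 := capsWord_cons e x (f :: y) ds
          have e0' := capsWord_cons e (x ++ [f]) y ds
          have e1 := ((Eqv.cross_hook_snoc' (Q := Q) e f x).whisker [] y).right (by simpa using h3.runs)
          simp only [List.cons_append, List.append_assoc, List.length_append, List.length_cons,
            List.length_nil, List.nil_append, Nat.zero_add, Nat.add_sub_cancel] at e0 e0' ⊢
          rw [e0, e0']
          simpa using e1
        · simp only [List.cons_append, List.cons.injEq] at h5
          obtain ⟨rfl, rfl, rfl⟩ := h5
          simp only [List.length_cons]
          rw [hc, if_pos (by simp)]
          have e1 := ih (x := x) (y := a ++ n) (by simpa using h3)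
          have hw : Runs (x ++ e :: f :: a) [(x.length, .cross e f)] (x ++ f :: e :: a) := by
            simpa using (runs_cross e f).whisker x a
          have e2 := Absorbs.left (Q := Q) (n := n) (c := g) (by simpa using e1) hw h3
          simpa [Nat.add_comm] using e2
      · rcases a with _ | ⟨g', a⟩
        · simp only [List.nil_append, List.cons.injEq] at h5
          exact mid (by simp) h5.1.symm h5.2.symm
        · simp only [List.cons_append, List.cons.injEq] at h5
          obtain ⟨rfl, rfl⟩ := h5
          simp only [List.length_cons]
          rw [hc, if_neg (by simp; omega), if_neg (by simp), if_neg (by simp; omega)]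
          have e1 := ih (x := m ++ a) (y := y) (by simpa using h3)
          have hw : Runs (a ++ e :: f :: y) [(a.length, .cross e f)] (a ++ f :: e :: y) := by
            simpa using (runs_cross e f).whisker a y
          have e2 := Absorbs.right (Q := Q) (m := m) (c := g) (by simpa using e1) hw h3
          have e3 : (m ++ g :: a).length - 1 = (m ++ a).length := by simp
          rw [e3]
          have e4 : (m ++ g :: a).length + 1 = m.length + 2 + a.length := by simp; omega
          rw [e4]
          simpa using e2

lemma absorbs_cap {ds : List ℕ} {x y : List S.Color} {c : S.Color} (h : Paired (x ++ y) ds) :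
    Absorbs Q (x ++ c :: c :: y) (x ++ y) [(x.length, .cap c)] ds (capOp x.length ds) := by
  induction ds generalizing x y with
  | nil =>
    generalize hl : x ++ y = l at h
    cases h
    simp only [List.append_eq_nil_iff] at hl
    obtain ⟨rfl, rfl⟩ := hl
    refine ⟨.cons (m := []) (n := []) .nil, .refl ?_⟩
    simp [capsWord, runs_cons, Piece.src, Piece.tgt]
  | cons d ds ih =>
    cases x with
    | nil =>
      have hp := Paired.cons (c := c) (m := []) (n := y) h
      refine ⟨hp, ?_⟩
      have e := capsWord_cons c [] y (d :: ds)
      simp only [List.nil_append, List.length_nil] at e ⊢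
      change Eqv Q _ _ _ (capsWord (c :: c :: y) (0 :: d :: ds))
      rw [e]
      have hr := hp.runs
      rw [List.nil_append, List.length_nil, e] at hr
      exact .refl hr
    | cons g x =>
      obtain ⟨m, n, ds', h1, h2, h3⟩ := Paired.inv h
      simp only [List.cons.injEq] at h2
      obtain ⟨rfl, rfl⟩ := h2
      have hc : capOp (x.length + 1) (m.length :: ds) =
        if x.length ≤ m.length then (m.length + 2) :: capOp x.length ds
        else m.length :: capOp (x.length - 1) ds := rfl
      have left : ∀ a, m = x ++ a → y = a ++ g :: n →
          Absorbs Q (g :: x ++ c :: c :: y) (g :: x ++ y) [((g :: x).length, .cap c)]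
            (m.length :: ds) (capOp (x.length + 1) (m.length :: ds)) := by
        rintro a rfl rfl
        rw [hc, if_pos (by simp)]
        have e1 := ih (x := x) (y := a ++ n) (by simpa using h3)
        have hw : Runs (x ++ c :: c :: a) [(x.length, .cap c)] (x ++ a) :=
          runs_singleton.2 ⟨x, a, rfl, by simp [Piece.src], by simp [Piece.tgt]⟩
        have e2 := Absorbs.left (Q := Q) (n := n) (c := g) (by simpa using e1) hw h3
        have e3 : (x ++ a).length + 2 = (x ++ c :: c :: a).length := by simp; omega
        rw [e3]
        simpa [Nat.add_comm] using e2
      rcases List.append_eq_append_iff.1 h1 with ⟨a, h4, h5⟩ | ⟨a, rfl, h5⟩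
      · exact left a h4 h5
      · rcases a with _ | ⟨g', a⟩
        · exact left [] (by simp) (by simpa using h5.symm)
        · simp only [List.cons_append, List.cons.injEq] at h5
          obtain ⟨rfl, rfl⟩ := h5
          simp only [List.length_cons]
          rw [hc, if_neg (by simp)]
          have e1 := ih (x := m ++ a) (y := y) (by simpa using h3)
          have hw : Runs (a ++ c :: c :: y) [(a.length, .cap c)] (a ++ y) :=
            runs_singleton.2 ⟨a, y, rfl, by simp [Piece.src], by simp [Piece.tgt]⟩
          have e2 := Absorbs.right (Q := Q) (m := m) (c := g) (by simpa using e1) hw h3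
          have e3 : (m ++ g :: a).length - 1 = (m ++ a).length := by simp
          rw [e3]
          have e4 : (m ++ g :: a).length + 1 = m.length + 2 + a.length := by simp; omega
          rw [e4]
          simpa using e2

lemma absorbs_crosses {a b : List S.Color} {w : S.Word} {ds : List ℕ}
    (hw : ∀ s ∈ w, ∃ e f, s.2 = .cross e f) (h : Runs a w b) (hp : Paired b ds) :
    Absorbs Q a b w ds ((w.map Prod.fst).foldr crossOp ds) := by
  induction w generalizing a with
  | nil => cases h; exact ⟨hp, .refl hp.runs⟩
  | cons s w ih =>
    obtain ⟨a1, h1, h2⟩ := h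
    have e1 := ih (fun s hs => hw s (by simp [hs])) h2
    refine Absorbs.trans (u := [s]) ?_ e1 (runs_singleton.2 h1)
    obtain ⟨e, f, he⟩ := hw s (by simp)
    obtain ⟨k, _⟩ := s
    simp only at he
    subst he
    obtain ⟨x, y, hx, rfl, rfl⟩ := h1
    simp only [Piece.src, Piece.tgt, List.append_assoc, List.cons_append, List.nil_append] at hx e1 ⊢
    subst hx
    exact absorbs_cross e1.1

lemma passRight_fst (c : S.Color) (k : ℕ) (l : List S.Color) :
    (passRight c k l).map Prod.fst = List.range' k l.length := by
  induction l generalizing k with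
  | nil => rfl
  | cons d l ih => simp [passRight, ih, List.range'_succ]

lemma passLeft_fst (c : S.Color) (k : ℕ) (l : List S.Color) :
    (passLeft c k l).map Prod.fst = (List.range' k l.length).reverse := by
  induction l generalizing k with
  | nil => rfl
  | cons d l ih => simp [passLeft, ih, List.range'_succ]

lemma passRight_cross (c : S.Color) (k : ℕ) (l : List S.Color) :
    ∀ s ∈ passRight c k l, ∃ e f, s.2 = .cross e f := by
  induction l generalizing k with
  | nil => simp [passRight]
  | cons d l ih =>
    simp only [passRight, List.mem_cons, forall_eq_or_imp]
    exact ⟨⟨_, _, rfl⟩, ih _⟩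

lemma passLeft_cross (c : S.Color) (k : ℕ) (l : List S.Color) :
    ∀ s ∈ passLeft c k l, ∃ e f, s.2 = .cross e f := by
  induction l generalizing k with
  | nil => simp [passLeft]
  | cons d l ih =>
    simp only [passLeft, List.mem_append, List.mem_singleton]
    rintro s (h | rfl)
    · exact ih _ s h
    · exact ⟨_, _, rfl⟩

lemma absorbs_cup {ds ds₁ : List ℕ} {x y : List S.Color} {c : S.Color}
    (h : Paired (x ++ c :: c :: y) ds) (hds : cupOp x.length ds = some ds₁) :
    Absorbs Q (x ++ y) (x ++ c :: c :: y) [(x.length, .cup c)] ds ds₁ := by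
  induction ds generalizing x y ds₁ with
  | nil => cases hds
  | cons d ds ih =>
    cases x with
    | nil =>
      obtain ⟨m, n, ds', h1, h2, h3⟩ := Paired.inv h
      simp only [List.cons.injEq] at h2
      obtain ⟨rfl, rfl⟩ := h2
      cases m with
      | nil => cases hds
      | cons e l =>
        simp only [List.cons_append, List.cons.injEq] at h1
        obtain ⟨rfl, rfl⟩ := h1
        have hds' : some ((List.range l.length).reverse.foldr crossOp ds) = some ds₁ := by
          rw [← hds]; rfl
        cases hds'
        have hw : Runs (l ++ [c] ++ n) (passLeft c 0 l) (c :: l ++ n) := by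
          simpa using (runs_passLeft c l).whisker [] n
        -- The leftmost strand is an end of the maximum, whose other end runs to the left in its place.
        have e1 := absorbs_crosses (Q := Q) (passLeft_cross c 0 l) hw h3
        rw [passLeft_fst, ← List.range_eq_range'] at e1
        refine ⟨by simpa using e1.1, ?_⟩
        have e0 := capsWord_cons c (c :: l) n ds
        simp only [List.cons_append, List.length_cons] at e0
        simp only [List.nil_append, List.cons_append, List.length_nil, List.length_cons]
        rw [e0]
        have e2 := ((Eqv.cup_hook_cons (Q := Q) c l).whisker [] n).right h3.runs
        exact Eqv.trans (by simpa using e2) (by simpa using e1.2)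
    | cons g x =>
      obtain ⟨m, n, ds', h1, h2, h3⟩ := Paired.inv h
      simp only [List.cons.injEq] at h2
      obtain ⟨rfl, rfl⟩ := h2
      have hc : cupOp (x.length + 1) (m.length :: ds) =
        if x.length + 1 < m.length then (cupOp x.length ds).map ((m.length - 2) :: ·)
        else if m.length < x.length then (cupOp (x.length - 1) ds).map (m.length :: ·)
        else some ((List.range x.length).foldr crossOp ds) := rfl
      simp only [List.length_cons] at hds
      rw [hc] at hds
      -- One end of the maximum is the partner of the leftmost strand: the leftmost strand passes
      -- across the strands to the left of the maximum.
      have mid : ∀ {m' n' : List S.Color}, Paired (m' ++ n') ds → g = c → m' ++ n' = x ++ c :: y →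
          (x ++ c :: c :: y) = (m' ++ g :: n') → (m' = x ∨ m' = x ++ [c]) →
          Absorbs Q (g :: x ++ y) (g :: x ++ c :: c :: y) [((g :: x).length, .cup c)]
            (m'.length :: ds) ((List.range x.length).foldr crossOp ds) := by
        rintro m' n' h3 rfl h4 h5 h6
        have hw : Runs ((g :: x) ++ y) (passRight g 0 x) (x ++ g :: y) := by
          simpa using (runs_passRight g x).whisker [] y
        have h7 : Paired (x ++ g :: y) ds := h4 ▸ h3
        have e1 := absorbs_crosses (Q := Q) (passRight_cross g 0 x) hw h7
        rw [passRight_fst, ← List.range_eq_range'] at e1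
        refine ⟨e1.1, ?_⟩
        have e0 := capsWord_cons g m' n' ds
        rw [← h5, h4] at e0
        simp only [List.cons_append]
        rw [e0]
        have e2 : Eqv Q ((g :: x) ++ y) (x ++ g :: y) ((x.length + 1, .cup g) :: hook g m')
            (passRight g 0 x) := by
          rcases h6 with rfl | rfl
          · simpa using (Eqv.cup_hook (Q := Q) g m').whisker [] y
          · simpa using (Eqv.cup_hook_snoc (Q := Q) g x).whisker [] y
        exact Eqv.trans (by simpa using e2.right h7.runs) (by simpa using e1.2)
      rcases List.append_eq_append_iff.1 h1 with ⟨a, rfl, h5⟩ | ⟨a, rfl, h5⟩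
      · rcases a with _ | ⟨f', _ | ⟨e', a⟩⟩
        · simp only [List.nil_append, List.cons.injEq] at h5
          rw [if_neg (by simp), if_neg (by simp)] at hds
          cases hds
          obtain ⟨rfl, rfl⟩ := h5
          exact mid h3 rfl (by simp) (by simp) (by simp)
        · simp only [List.cons_append, List.nil_append, List.cons.injEq] at h5
          obtain ⟨rfl, rfl, rfl⟩ := h5
          rw [if_neg (by simp), if_neg (by simp)] at hds
          cases hds
          exact mid h3 rfl (by simp) (by simp) (by simp)
        · simp only [List.cons_append, List.cons.injEq] at h5
          obtain ⟨rfl, rfl, rfl⟩ := h5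
          rw [if_pos (by simp)] at hds
          obtain ⟨ds₂, h6, rfl⟩ := Option.map_eq_some_iff.1 hds
          have e1 := ih (x := x) (y := a ++ n) (by simpa using h3) h6
          have hw : Runs (x ++ a) [(x.length, .cup c)] (x ++ c :: c :: a) :=
            runs_singleton.2 ⟨x, a, rfl, by simp [Piece.src], by simp [Piece.tgt]⟩
          have e2 := Absorbs.left (Q := Q) (n := n) (c := g) (by simpa using e1) hw h3
          have e3 : (x ++ c :: c :: a).length - 2 = (x ++ a).length := by simp; omega
          rw [e3]
          simpa [Nat.add_comm] using e2
      · rcases a with _ | ⟨g', a⟩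
        · simp only [List.nil_append, List.cons.injEq] at h5
          obtain ⟨rfl, rfl⟩ := h5
          rw [if_neg (by simp), if_neg (by simp)] at hds
          cases hds
          exact mid h3 rfl (by simp) (by simp) (by simp)
        · simp only [List.cons_append, List.cons.injEq] at h5
          obtain ⟨rfl, rfl⟩ := h5
          rw [if_neg (by simp; omega), if_pos (by simp)] at hds
          obtain ⟨ds₂, h6, rfl⟩ := Option.map_eq_some_iff.1 hds
          have e3 : (m ++ g :: a).length - 1 = (m ++ a).length := by simp
          rw [e3] at h6
          have e1 := ih (x := m ++ a) (y := y) (by simpa using h3) h6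
          have hw : Runs (a ++ y) [(a.length, .cup c)] (a ++ c :: c :: y) :=
            runs_singleton.2 ⟨a, y, rfl, by simp [Piece.src], by simp [Piece.tgt]⟩
          have e2 := Absorbs.right (Q := Q) (m := m) (c := g) (by simpa using e1) hw h3
          have e4 : (g :: (m ++ g :: a)).length = m.length + 2 + a.length := by simp; omega
          rw [e4]
          simpa using e2

/-! ### Vertices are moved to the top -/

/-- All the given vertices, each one drawn to the left of the previous ones. -/
def front (gs : List S.Node) : S.Word := gs.map fun g => (0, .node g)

/-- The strands that leave the vertices `front gs`. -/
def frontLegs : List S.Node → List S.Color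
  | [] => []
  | g :: gs => frontLegs gs ++ S.legs g

lemma runs_front (gs : List S.Node) (a : List S.Color) :
    Runs a (front gs) (frontLegs gs ++ a) := by
  induction gs generalizing a with
  | nil => rfl
  | cons g gs ih =>
    refine ⟨_, ⟨[], a, rfl, rfl, rfl⟩, ?_⟩
    simpa [frontLegs, Piece.tgt, front] using ih (S.legs g ++ a)

/-- The strands `x` run to the left across the strands `l`. -/
def moveLeft (l : List S.Color) : List S.Color → S.Word
  | [] => []
  | c :: x => passLeft c 0 l ++ shift 1 (moveLeft l x)

lemma runs_moveLeft (l x : List S.Color) : Runs (l ++ x) (moveLeft l x) (x ++ l) := by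
  induction x with
  | nil => simp [moveLeft]
  | cons c x ih =>
    have h1 := ((runs_passLeft c l).whisker [] x).append
      (by simpa using (ih.whisker [c] []))
    simpa [moveLeft] using h1

lemma moveLeft_cross (l x : List S.Color) : ∀ s ∈ moveLeft l x, ∃ e f, s.2 = .cross e f := by
  induction x with
  | nil => simp [moveLeft]
  | cons c x ih =>
    simp only [moveLeft, List.mem_append]
    rintro s (h | h)
    · exact passLeft_cross c 0 l s h
    · simp only [shift, List.mem_map] at h
      obtain ⟨t, h, rfl⟩ := h
      exact ih t h

/-- The heights of the intersections in `shift n (moveLeft l x)`, where `l` and `x` have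
lengths `m` and `k`. -/
def movePositions (n m : ℕ) : ℕ → List ℕ
  | 0 => []
  | k + 1 => (List.range' n m).reverse ++ movePositions (n + 1) m k

lemma moveLeft_fst (n : ℕ) (l x : List S.Color) :
    (shift n (moveLeft l x)).map Prod.fst = movePositions n l.length x.length := by
  induction x generalizing n with
  | nil => rfl
  | cons c x ih =>
    simp only [moveLeft, shift_append, List.map_append, shift_shift, ih, movePositions,
      List.length_cons, ← passLeft_shift c n 0, passLeft_fst, Nat.add_zero]

lemma Eqv.node_left (g : S.Node) (x : List S.Color) :
    Eqv Q x (x ++ S.legs g) [(x.length, .node g)] ((0, .node g) :: moveLeft (S.legs g) x) := by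
  induction x with
  | nil => exact .refl (runs_singleton.2 ⟨[], [], rfl, rfl, by simp [Piece.tgt]⟩)
  | cons c x ih =>
    have e1 := ih.whisker [c] []
    have e2 : Eqv Q [c] (c :: S.legs g) [(1, .node g)] ((0, .node g) :: passLeft c 0 (S.legs g)) := by
      refine .move (.inr (.inl (.pass c g [] (S.legs g) (by simp)))) ?_ ?_
      · exact runs_singleton.2 ⟨[c], [], rfl, rfl, by simp [Piece.tgt]⟩
      · exact ⟨_, ⟨[], [c], rfl, rfl, rfl⟩, by simpa [Piece.tgt] using runs_passLeft c (S.legs g)⟩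
    have e3 := (e2.whisker [] x).right (v := shift 1 (moveLeft (S.legs g) x))
      (c := c :: (x ++ S.legs g)) (by simpa using (runs_moveLeft (S.legs g) x).whisker [c] [])
    simp only [List.length_cons, moveLeft, List.cons_append]
    exact Eqv.trans (by simpa [Nat.add_comm] using e1) (by simpa using e3)

/-- The normal form of a drawing without lower boundary: its vertices in the order of their
heights, and the pairing of the legs of the vertices and of the upper boundary. It is not defined
if a closed curve without vertices occurs. -/
def nf : S.Word → Option (List S.Node × List ℕ)
  | [] => some ([], [])
  | (k, e) :: w =>
    (nf w).bind fun r =>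
      let n := (frontLegs r.1).length
      match e with
      | .cup _ => (cupOp (n + k) r.2).map fun ds => (r.1, ds)
      | .cap _ => some (r.1, capOp (n + k) r.2)
      | .cross _ _ => some (r.1, crossOp (n + k) r.2)
      | .node g => some (g :: r.1, (movePositions n (S.legs g).length k).foldr crossOp r.2)

/-- A drawing without lower boundary is equivalent to its normal form. -/
theorem Eqv.nf {a : List S.Color} {w : S.Word} {gs : List S.Node} {ds : List ℕ}
    (h : Runs a w []) (hn : nf w = some (gs, ds)) :
    Paired (frontLegs gs ++ a) ds ∧
      Eqv Q a [] w (front gs ++ capsWord (frontLegs gs ++ a) ds) := by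
  induction w generalizing a gs ds with
  | nil =>
    cases hn
    cases h
    exact ⟨.nil, .refl rfl⟩
  | cons s w ih =>
    obtain ⟨k, e⟩ := s
    obtain ⟨a1, h1, h2⟩ := h
    rw [DrawingKind.nf] at hn
    obtain ⟨⟨gs1, ds1⟩, h3, h4⟩ := Option.bind_eq_some_iff.1 hn
    obtain ⟨i1, i2⟩ := ih h2 h3
    -- A piece that is not a vertex is moved below the vertices and is absorbed by the pairing.
    have key : ∀ {v : S.Word} {ds' : List ℕ}, Runs a v a1 →
        Absorbs Q (frontLegs gs1 ++ a) (frontLegs gs1 ++ a1) (shift (frontLegs gs1).length v) ds1 ds' →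
        Paired (frontLegs gs1 ++ a) ds' ∧ Eqv Q a [] (v ++ w)
          (front gs1 ++ capsWord (frontLegs gs1 ++ a) ds') := by
      intro v ds' hv hab
      have e1 := i2.left hv
      have e2 := (Eqv.interchange (Q := Q) (by simpa using runs_front gs1 []) hv).symm.right
        (v := capsWord (frontLegs gs1 ++ a1) ds1) i1.runs
      have e3 := hab.2.left (runs_front gs1 a)
      exact ⟨hab.1, e1.trans (Eqv.trans (by simpa using e2) (by simpa using e3))⟩
    have h1' := h1
    obtain ⟨x, y, hx, rfl, rfl⟩ := h1
    simp only at hx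
    subst hx
    have hlen : (frontLegs gs1).length + x.length = (frontLegs gs1 ++ x).length := by simp
    cases e with
    | cup c =>
      obtain ⟨ds2, h5, h6⟩ := Option.map_eq_some_iff.1 h4
      cases h6
      refine key (runs_singleton.2 h1') ?_
      have := absorbs_cup (Q := Q) (x := frontLegs gs1 ++ x) (y := y) (c := c)
        (by simpa [Piece.tgt] using i1) (by simpa using h5)
      simpa [Piece.src, Piece.tgt] using this
    | cap c =>
      cases h4
      refine key (runs_singleton.2 h1') ?_
      have := absorbs_cap (Q := Q) (x := frontLegs gs1 ++ x) (y := y) (c := c)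
        (by simpa [Piece.tgt] using i1)
      simpa [Piece.src, Piece.tgt] using this
    | cross c d =>
      cases h4
      refine key (runs_singleton.2 h1') ?_
      have := absorbs_cross (Q := Q) (x := frontLegs gs1 ++ x) (y := y) (e := c) (f := d)
        (by simpa [Piece.tgt] using i1)
      simpa [Piece.src, Piece.tgt] using this
    | node g =>
      cases h4
      -- A vertex is drawn on the far left, and its legs run across the strands `x` to its place.
      have hm : Runs (frontLegs gs1 ++ (S.legs g ++ x ++ y))
          (shift (frontLegs gs1).length (moveLeft (S.legs g) x)) (frontLegs gs1 ++ (x ++ S.legs g ++ y)) := by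
        simpa using (runs_moveLeft (S.legs g) x).whisker (frontLegs gs1) y
      have hm' : Runs (S.legs g ++ x ++ y) (moveLeft (S.legs g) x) (x ++ S.legs g ++ y) := by
        simpa using (runs_moveLeft (S.legs g) x).whisker [] y
      have e1 := absorbs_crosses (Q := Q) (ds := ds1) (by
        intro s hs
        simp only [shift, List.mem_map] at hs
        obtain ⟨t, h, rfl⟩ := hs
        exact moveLeft_cross _ _ t h) hm i1
      rw [moveLeft_fst] at e1
      have e2 := i2.left hm'
      have e3 := (Eqv.interchange (Q := Q) (by simpa using runs_front gs1 []) hm').symm.right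
        (v := capsWord (frontLegs gs1 ++ (x ++ S.legs g ++ y)) ds1) i1.runs
      have e4 := e1.2.left (runs_front gs1 (S.legs g ++ x ++ y))
      have e5 : Eqv Q (S.legs g ++ x ++ y) [] (moveLeft (S.legs g) x ++ w) _ :=
        e2.trans (Eqv.trans (by simpa [Piece.tgt] using e3) (by simpa using e4))
      have e6 := ((Eqv.node_left (Q := Q) g x).whisker [] y).right (v := w) (by simpa [Piece.tgt] using h2)
      have e7 := e5.cons (s := (0, .node g)) (a := x ++ y)
        ⟨[], x ++ y, rfl, rfl, by simp [Piece.tgt]⟩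
      refine ⟨by simpa [frontLegs, Piece.src] using e1.1, ?_⟩
      have e8 := Eqv.trans (by simpa using e6) e7
      simpa [front, frontLegs, Piece.src] using e8

/-- The strands `r.reverse ++ r` are joined in pairs by nested minima. -/
def closeWord : List S.Color → S.Word
  | [] => []
  | c :: r => (r.length, .cap c) :: closeWord r

lemma Eqv.of_cap {a b : List S.Color} {c : S.Color} {w w' : S.Word} (hw : Runs a w (b ++ [c]))
    (hw' : Runs a w' (b ++ [c]))
    (h : Eqv Q (a ++ [c]) b (w ++ [(b.length, .cap c)]) (w' ++ [(b.length, .cap c)])) :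
    Eqv Q a (b ++ [c]) w w' := by
  have key : ∀ {w}, Runs a w (b ++ [c]) → Eqv Q a (b ++ [c]) w
      ((a.length, .cup c) :: (w ++ [(b.length, .cap c)])) := by
    intro w hw
    have e1 := (Eqv.interchange (Q := Q) hw (b := []) (b' := [c, c]) (v := [(0, .cup c)])
      (by simp [runs_cons, Piece.src, Piece.tgt])).right (v := [(b.length, .cap c)])
      (c := b ++ [c]) (runs_singleton.2 ⟨b, [c], rfl, by simp [Piece.src], by simp [Piece.tgt]⟩)
    have e2 := ((Eqv.zigzag (Q := Q) c).whisker b []).left (u := w) (a := a) (by simpa using hw)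
    refine Eqv.symm (Eqv.trans (v := w ++ [(b.length + 1, .cup c), (b.length, .cap c)]) ?_ ?_)
    · simpa using e1.symm
    · simpa using e2
  have e3 := (h.whisker [] [c]).cons (s := (a.length, .cup c)) (a := a)
    ⟨a, [], rfl, by simp [Piece.src], by simp [Piece.tgt]⟩
  exact (key hw).trans (Eqv.trans (by simpa using e3) (key hw').symm)

lemma Eqv.of_closeWord {a : List S.Color} (r : List S.Color) {w w' : S.Word}
    (hw : Runs a w r.reverse) (hw' : Runs a w' r.reverse)
    (h : Eqv Q (a ++ r) [] (w ++ closeWord r) (w' ++ closeWord r)) : Eqv Q a r.reverse w w' := by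
  induction r generalizing a w w' with
  | nil => simpa [closeWord] using h
  | cons c r ih =>
    rw [List.reverse_cons] at hw hw' ⊢
    have hcap : ∀ {w}, Runs a w (r.reverse ++ [c]) →
        Runs (a ++ [c]) (w ++ [(r.length, .cap c)]) r.reverse := by
      intro w hw
      have h1 := (hw.whisker [] [c]).append (v := [(r.length, .cap c)]) (c := r.reverse)
        (runs_singleton.2 ⟨r.reverse, [], by simp, by simp [Piece.src], by simp [Piece.tgt]⟩)
      simpa using h1
    refine Eqv.of_cap hw hw' ?_
    rw [List.length_reverse]
    exact ih (hcap hw) (hcap hw') (by simpa [closeWord] using h)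

lemma runs_closeWord (r : List S.Color) : Runs (r.reverse ++ r) (closeWord r) [] := by
  induction r with
  | nil => rfl
  | cons c r ih =>
    exact ⟨_, ⟨r.reverse, r, by simp, by simp [Piece.src], rfl⟩, by simpa [Piece.tgt] using ih⟩

/-- Two drawings are equivalent if they have the same boundaries and the same normal forms. This
can be checked by computation. -/
theorem Eqv.of_nf [DecidableEq S.Color] {a b : List S.Color} {w w' : S.Word}
    (h : runList a w = some b ∧ runList a w' = some b ∧
      (DrawingKind.nf (w ++ closeWord b.reverse)).isSome ∧
      DrawingKind.nf (w ++ closeWord b.reverse) = DrawingKind.nf (w' ++ closeWord b.reverse)) :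
    Eqv Q a b w w' := by
  obtain ⟨h1, h2, h3, h4⟩ := h
  obtain ⟨⟨gs, ds⟩, h5⟩ := Option.isSome_iff_exists.1 h3
  have r1 := runs_of_runList h1
  have r2 := runs_of_runList h2
  have hc : ∀ {w}, Runs a w b → Runs (a ++ b.reverse) (w ++ closeWord b.reverse) [] := by
    intro w hw
    refine Runs.append (by simpa using hw.whisker [] b.reverse) ?_
    simpa using runs_closeWord b.reverse
  have e1 := (Eqv.nf (Q := Q) (hc r1) h5).2
  have e2 := (Eqv.nf (Q := Q) (hc r2) (h4 ▸ h5)).2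
  have := Eqv.of_closeWord (Q := Q) b.reverse (by simpa using r1) (by simpa using r2)
    (e1.trans e2.symm)
  simpa using this

end DrawingKind

/-! ### Labelled drawings -/

instance : DecidableEq EdgeColor
  | .unmatched, .unmatched => isTrue rfl
  | .unmatched, .matched _ => isFalse (by simp)
  | .matched _, .unmatched => isFalse (by simp)
  | .matched a, .matched b =>
    if h : a = b then isTrue (by rw [h]) else isFalse (by simpa using h)

instance : DecidableEq MatchedVertex := fun a b =>
  decidable_of_iff (a.solid = b.solid ∧ a.sign = b.sign ∧ a.pos = b.pos) (by
    cases a; cases b; simp)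

instance : DecidableEq linkKind.Color := inferInstanceAs (DecidableEq Unit)
instance : DecidableEq linkKind.Node := inferInstanceAs (DecidableEq Bool)
instance : DecidableEq matchedKind.Color := inferInstanceAs (DecidableEq EdgeColor)
instance : DecidableEq matchedKind.Node := inferInstanceAs (DecidableEq MatchedVertex)

/-- Labels carried by the points of a matched edge. The labels `dn` and `up` mark the two outer
sections of the edge: `dn` is a strand on which one moves away from the vertex by going down, `up`
a strand on which one does so by going up. The labels `inn i` are used in the inner section. -/
inductive Label (I : Type) where
  | dn
  | up
  | inn (i : I)

/-- The colour of a strand of a labelled drawing. -/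
inductive XColor (I : Type) where
  | plain
  | edge (sign : Bool) (l : Label I)

/-- How the labels of inner sections are changed if the strand is traversed backwards. -/
class Reversal (I : Type) where
  rev : I → I
  rev_rev : ∀ i, rev (rev i) = i

variable {I : Type}

/-- The same point with the label read off in the other direction. -/
def Label.rev [Reversal I] : Label I → Label I
  | .dn => .up
  | .up => .dn
  | .inn i => .inn (Reversal.rev i)

namespace XColor

/-- The same strand, traversed backwards. -/
def rev [Reversal I] : XColor I → XColor I
  | .plain => .plain
  | .edge ε l => .edge ε l.rev

/-- The colour of a leg of a vertex: a matched edge begins there with an outer section. -/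
def leg : EdgeColor → XColor I
  | .unmatched => .plain
  | .matched ε => .edge ε .dn

/-- The number of strands of inner sections. -/
def weight : XColor I → ℕ
  | .edge _ (.inn _) => 1
  | _ => 0

end XColor

/-- Pieces of labelled drawings. Besides the pieces of matched drawings there are points on matched
edges where the label changes: `enter` and `leave` bound the inner section of an edge, and `mark`
stands for an inner section that has shrunk to a point. -/
inductive XPiece (I : Type) where
  | cup (c : XColor I)
  | cap (c : XColor I)
  | cross (c d : XColor I)
  | node (g : MatchedVertex)
  | mark (ε : Bool)
  | enter (ε : Bool) (i : I)
  | leave (ε : Bool) (i : I)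

/-- A labelled drawing; each piece is preceded by the list of the strands to its left. -/
abbrev XWord (I : Type) := List (List (XColor I) × XPiece I)

namespace XPiece

/-- The piece begins or ends an inner section. -/
def IsSlider : XPiece I → Prop
  | enter _ _ => True
  | leave _ _ => True
  | _ => False

/-- The size of the inner sections, counted in the pieces that they meet. -/
def weight : XPiece I → ℕ
  | cup c => c.weight
  | cap c => c.weight
  | cross c d => c.weight + d.weight
  | node _ => 0
  | mark _ => 0
  | enter _ _ => 1
  | leave _ _ => 1

variable [Reversal I]

/-- The strands that enter the piece from above. -/
def src : XPiece I → List (XColor I)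
  | cup _ => []
  | cap c => [c, c.rev]
  | cross c d => [c, d]
  | node _ => []
  | mark ε => [.edge ε .dn]
  | enter ε _ => [.edge ε .dn]
  | leave ε i => [.edge ε (.inn i)]

/-- The strands that leave the piece below. -/
def tgt : XPiece I → List (XColor I)
  | cup c => [c, c.rev]
  | cap _ => []
  | cross c d => [d, c]
  | node g => (matchedKind.legs g).map XColor.leg
  | mark ε => [.edge ε .up]
  | enter ε i => [.edge ε (.inn i)]
  | leave ε _ => [.edge ε .up]

@[simp] lemma src_cup (c : XColor I) : (cup c).src = [] := rfl
@[simp] lemma src_cap (c : XColor I) : (cap c).src = [c, c.rev] := rfl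
@[simp] lemma src_cross (c d : XColor I) : (cross c d).src = [c, d] := rfl
@[simp] lemma src_node (g : MatchedVertex) : (node g : XPiece I).src = [] := rfl
@[simp] lemma src_mark (ε : Bool) : (mark ε : XPiece I).src = [.edge ε .dn] := rfl
@[simp] lemma src_enter (ε : Bool) (i : I) : (enter ε i).src = [.edge ε .dn] := rfl
@[simp] lemma src_leave (ε : Bool) (i : I) : (leave ε i).src = [.edge ε (.inn i)] := rfl
@[simp] lemma tgt_cup (c : XColor I) : (cup c).tgt = [c, c.rev] := rfl
@[simp] lemma tgt_cap (c : XColor I) : (cap c).tgt = [] := rfl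
@[simp] lemma tgt_cross (c d : XColor I) : (cross c d).tgt = [d, c] := rfl
lemma tgt_node (g : MatchedVertex) :
    (node g : XPiece I).tgt = (matchedKind.legs g).map XColor.leg := rfl
@[simp] lemma tgt_mark (ε : Bool) : (mark ε : XPiece I).tgt = [.edge ε .up] := rfl
@[simp] lemma tgt_enter (ε : Bool) (i : I) : (enter ε i).tgt = [.edge ε (.inn i)] := rfl
@[simp] lemma tgt_leave (ε : Bool) (i : I) : (leave ε i).tgt = [.edge ε .up] := rfl

end XPiece

section Slide

variable [Reversal I]

/-- The labelled drawing is well-formed, with upper boundary `a` and lower boundary `b`. -/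
def XRuns : List (XColor I) → XWord I → List (XColor I) → Prop
  | a, [], b => a = b
  | a, s :: W, b => ∃ y, a = s.1 ++ s.2.src ++ y ∧ XRuns (s.1 ++ s.2.tgt ++ y) W b

lemma xruns_append {a c : List (XColor I)} {U V : XWord I} :
    XRuns a (U ++ V) c ↔ ∃ b, XRuns a U b ∧ XRuns b V c := by
  induction U generalizing a with
  | nil => simp [XRuns]
  | cons s U ih =>
    simp only [List.cons_append, XRuns, ih]
    constructor
    · rintro ⟨y, h, b, h1, h2⟩; exact ⟨b, ⟨y, h, h1⟩, h2⟩
    · rintro ⟨b, ⟨y, h, h1⟩, h2⟩; exact ⟨y, h, b, h1, h2⟩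

lemma XRuns.append {a b c : List (XColor I)} {U V : XWord I} (h : XRuns a U b) (h' : XRuns b V c) :
    XRuns a (U ++ V) c := xruns_append.2 ⟨b, h, h'⟩

/-- A point where the label changes from `c` to `c'`, and which can be moved along the strand. -/
inductive SliderOf : XPiece I → XColor I → XColor I → Prop
  | enter (ε : Bool) (i : I) : SliderOf (.enter ε i) (.edge ε .dn) (.edge ε (.inn i))
  | leave (ε : Bool) (i : I) : SliderOf (.leave ε i) (.edge ε (.inn i)) (.edge ε .up)

/-- Elementary changes of labelled drawings with upper boundary `a` and lower boundary `b`: the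
ends of inner sections are moved along the edges, and past pieces that lie beside them. -/
inductive Slide : List (XColor I) → List (XColor I) → XWord I → XWord I → Prop
  | exch (z : List (XColor I)) (e e' : XPiece I) (h : e.IsSlider ∨ e'.IsSlider) :
      Slide (e.src ++ z ++ e'.src) (e.tgt ++ z ++ e'.tgt)
        [([], e), (e.tgt ++ z, e')] [(e.src ++ z, e'), ([], e)]
  | crossL {e : XPiece I} {c c' : XColor I} (d : XColor I) (h : SliderOf e c c') :
      Slide [c, d] [d, c'] [([], e), ([], .cross c' d)] [([], .cross c d), ([d], e)]
  | crossR {e : XPiece I} {c c' : XColor I} (d : XColor I) (h : SliderOf e c c') :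
      Slide [d, c] [c', d] [([d], e), ([], .cross d c')] [([], .cross d c), ([], e)]
  | capL (ε : Bool) (i : I) :
      Slide [.edge ε .dn, .edge ε (.inn (Reversal.rev i))] []
        [([], .enter ε i), ([], .cap (.edge ε (.inn i)))]
        [([.edge ε .dn], .leave ε (Reversal.rev i)), ([], .cap (.edge ε .dn))]
  | capR (ε : Bool) (i : I) :
      Slide [.edge ε (.inn i), .edge ε .dn] []
        [([.edge ε (.inn i)], .enter ε (Reversal.rev i)), ([], .cap (.edge ε (.inn i)))]
        [([], .leave ε i), ([], .cap (.edge ε .up))]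
  | cupL (ε : Bool) (i : I) :
      Slide [] [.edge ε .up, .edge ε (.inn (Reversal.rev i))]
        [([], .cup (.edge ε (.inn i))), ([], .leave ε i)]
        [([], .cup (.edge ε .up)), ([.edge ε .up], .enter ε (Reversal.rev i))]
  | cupR (ε : Bool) (i : I) :
      Slide [] [.edge ε (.inn i), .edge ε .up]
        [([], .cup (.edge ε (.inn i))), ([.edge ε (.inn i)], .leave ε (Reversal.rev i))]
        [([], .cup (.edge ε .dn)), ([], .enter ε i)]
  | merge (ε : Bool) (i : I) :
      Slide [.edge ε .dn] [.edge ε .up] [([], .enter ε i), ([], .leave ε i)] [([], .mark ε)]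

lemma SliderOf.src_tgt {e : XPiece I} {c c' : XColor I} (h : SliderOf e c c') :
    e.src = [c] ∧ e.tgt = [c'] := by
  cases h <;> exact ⟨rfl, rfl⟩

/-- Put more strands to the left of a labelled drawing. -/
def XWord.lift (x : List (XColor I)) (W : XWord I) : XWord I := W.map fun s => (x ++ s.1, s.2)

lemma XRuns.lift {a b : List (XColor I)} {W : XWord I} (h : XRuns a W b) (x y : List (XColor I)) :
    XRuns (x ++ a ++ y) (W.lift x) (x ++ b ++ y) := by
  induction W generalizing a with
  | nil => cases h; rfl
  | cons s W ih =>
    obtain ⟨z, rfl, h2⟩ := h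
    refine ⟨z ++ y, by simp, ?_⟩
    have := ih h2
    simp only [List.append_assoc] at this ⊢
    exact this

lemma Slide.runs {a b : List (XColor I)} {l r : XWord I} (h : Slide a b l r) :
    XRuns a l b ∧ XRuns a r b := by
  cases h with
  | exch z e e' _ => exact ⟨⟨z ++ e'.src, by simp, [], by simp, by simp [XRuns]⟩,
      ⟨[], by simp, z ++ e'.tgt, by simp, by simp [XRuns]⟩⟩
  | crossL d h =>
    obtain ⟨h1, h2⟩ := h.src_tgt
    simp [XRuns, h1, h2]
  | crossR d h =>
    obtain ⟨h1, h2⟩ := h.src_tgt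
    simp [XRuns, h1, h2]
  | _ => simp [XRuns, XColor.rev, Label.rev]

/-- The size of the inner sections of a drawing. -/
def XWord.weight (W : XWord I) : ℕ := (W.map fun s => s.2.weight).sum

lemma exists_last {α : Type*} {p : α → Prop} {l : List α} (h : ∃ s ∈ l, p s) :
    ∃ u s v, l = u ++ s :: v ∧ p s ∧ ∀ t ∈ v, ¬ p t := by
  induction l with
  | nil => simp at h
  | cons t l ih =>
    by_cases hl : ∃ s ∈ l, p s
    · obtain ⟨u, s, v, rfl, h1, h2⟩ := ih hl
      exact ⟨t :: u, s, v, rfl, h1, h2⟩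
    · push Not at hl
      obtain ⟨s, hs, h1⟩ := h
      rcases List.mem_cons.1 hs with rfl | hs
      · exact ⟨[], s, l, rfl, h1, hl⟩
      · exact absurd h1 (hl s hs)

lemma exists_first {α : Type*} {p : α → Prop} {l : List α} (h : ∃ s ∈ l, p s) :
    ∃ u s v, l = u ++ s :: v ∧ p s ∧ ∀ t ∈ u, ¬ p t := by
  obtain ⟨u, s, v, h1, h2, h3⟩ := exists_last (l := l.reverse) (by simpa using h)
  refine ⟨v.reverse, s, u.reverse, ?_, h2, by simpa using h3⟩
  have := congrArg List.reverse h1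
  simpa using this

/-- A strand lies to the left of a block of strands, to its right, or inside of it. -/
lemma locate {α : Type*} {x y u s v : List α} {c : α} (h : x ++ c :: y = u ++ s ++ v) :
    (∃ z, u = x ++ c :: z ∧ y = z ++ s ++ v) ∨ (∃ z, x = u ++ s ++ z ∧ v = z ++ c :: y) ∨
      ∃ s₁ s₂, s = s₁ ++ c :: s₂ ∧ x = u ++ s₁ ∧ y = s₂ ++ v := by
  rw [List.append_assoc] at h
  rcases List.append_eq_append_iff.1 h with ⟨z, rfl, h1⟩ | ⟨z, rfl, h1⟩
  · rcases z with _ | ⟨c', z⟩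
    · simp only [List.nil_append] at h1
      rcases s with _ | ⟨c', s⟩
      · exact .inr (.inl ⟨[], by simp, by simpa using h1.symm⟩)
      · simp only [List.cons_append, List.cons.injEq] at h1
        exact .inr (.inr ⟨[], s, by simp [h1.1], by simp, h1.2⟩)
    · simp only [List.cons_append, List.cons.injEq] at h1
      exact .inl ⟨z, by simp [h1.1], by simp [h1.2]⟩
  · rcases List.append_eq_append_iff.1 h1 with ⟨w, rfl, h2⟩ | ⟨w, rfl, h2⟩
    · exact .inr (.inl ⟨w, by simp, h2⟩)
    · rcases w with _ | ⟨c', w⟩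
      · exact .inr (.inl ⟨[], by simp, by simpa using h2.symm⟩)
      · simp only [List.cons_append, List.cons.injEq] at h2
        exact .inr (.inr ⟨z, w, by simp [h2.1], rfl, h2.2⟩)

/-- A property of labelled drawings without boundary holds if it can be checked after any slide,
and if it holds for the drawings without inner sections ending in points `enter` or `leave`.
Indeed, the ends of inner sections can be moved along the edges, so that the inner sections become
shorter, until they shrink to marks. -/
theorem slide_induction {P : XWord I → Prop}
    (step : ∀ (p q l r : XWord I) (x y a b : List (XColor I)), Slide a b l r ∨ Slide a b r l →
      XRuns [] p (x ++ a ++ y) → XRuns (x ++ b ++ y) q [] →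
      P (p ++ (XWord.lift x r ++ q)) → P (p ++ (XWord.lift x l ++ q)))
    (base : ∀ W, XRuns [] W [] → (∀ s ∈ W, ¬ s.2.IsSlider) → P W) :
    ∀ W, XRuns [] W [] → P W := by
  have main : ∀ n, ∀ W : XWord I, W.weight = n → XRuns [] W [] → P W := by
    intro n
    induction n using Nat.strong_induction_on with
    | _ n IH =>
    -- A slide that either lowers the weight or else is covered by a further induction.
    have step' : ∀ (p q l r : XWord I) (x y a b : List (XColor I)), Slide a b l r ∨ Slide a b r l →
        XRuns [] p (x ++ a ++ y) → XRuns (x ++ b ++ y) q [] →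
        (p ++ (XWord.lift x l ++ q)).weight = n →
        (r.weight < l.weight ∨ (r.weight = l.weight ∧ ((p ++ (XWord.lift x r ++ q)).weight = n →
          XRuns [] (p ++ (XWord.lift x r ++ q)) [] → P (p ++ (XWord.lift x r ++ q))))) →
        P (p ++ (XWord.lift x l ++ q)) := by
      intro p q l r x y a b hs hp hq hn hw
      have hr : XRuns a r b := by rcases hs with hs | hs; exacts [hs.runs.2, hs.runs.1]
      have hrun : XRuns [] (p ++ (XWord.lift x r ++ q)) [] := hp.append ((hr.lift x y).append hq)
      refine step p q l r x y a b hs hp hq ?_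
      have hl : ∀ (x : List (XColor I)) (W : XWord I), (XWord.lift x W).weight = W.weight := by
        intro x W; simp [XWord.weight, XWord.lift, Function.comp_def]
      have ha : ∀ (U V : XWord I), XWord.weight (U ++ V) = U.weight + V.weight := by
        intro U V; simp [XWord.weight]
      rw [ha, ha, hl] at hn
      rcases hw with hw | ⟨hw, h⟩
      · exact IH _ (by rw [ha, ha, hl]; omega) _ rfl hrun
      · exact h (by rw [ha, ha, hl]; omega) hrun
    -- The last point of the form `enter` is moved down. Each exchange with a piece that lies beside
    -- it shortens the drawing `q` below it; all other slides lower the weight.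
    have enter : ∀ (q p : XWord I) (x : List (XColor I)) (ε : Bool) (i : I),
        (p ++ (x, .enter ε i) :: q).weight = n → XRuns [] (p ++ (x, .enter ε i) :: q) [] →
        (∀ s ∈ q, ∀ ε' i', s.2 ≠ .enter ε' i') → P (p ++ (x, .enter ε i) :: q) := by
      intro q
      induction q with
      | nil =>
        intro p x ε i _ h _
        obtain ⟨b, _, y, _, h⟩ := xruns_append.1 h
        simp [XRuns] at h
      | cons s q ihq =>
        intro p x ε i hn h hq
        obtain ⟨u, e⟩ := s
        obtain ⟨b, hp, y, rfl, v, h1, h2⟩ := xruns_append.1 h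
        simp only [XPiece.tgt_enter, XPiece.src_enter, List.append_assoc, List.cons_append,
          List.nil_append] at hp h1 h2
        rw [← List.append_assoc u] at h1 h2
        rcases locate h1 with ⟨z, rfl, rfl⟩ | ⟨z, rfl, rfl⟩ | ⟨s₁, s₂, hs, rfl, rfl⟩
        · have := step' p q _ _ x v _ _ (.inl (.exch z (.enter ε i) e (.inl trivial))) (by simpa using hp)
            (by simpa using h2) (by simpa [XWord.lift] using hn)
            (.inr ⟨by simp [XWord.weight, Nat.add_comm], fun h3 h4 => by
              have := ihq (p ++ [(x ++ XColor.edge ε .dn :: z, e)]) x ε i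
                (by simpa [XWord.lift] using h3)
                (by simpa [XWord.lift] using h4) (fun s hs => hq s (by simp [hs]))
              simpa [XWord.lift] using this⟩)
          simpa [XWord.lift] using this
        · have := step' p q _ _ u y _ _ (.inr (.exch z e (.enter ε i) (.inr trivial))) (by simpa using hp)
            (by simpa using h2) (by simpa [XWord.lift] using hn)
            (.inr ⟨by simp [XWord.weight, Nat.add_comm], fun h3 h4 => by
              have := ihq (p ++ [(u, e)]) (u ++ e.tgt ++ z) ε i
                (by simpa [XWord.lift] using h3)
                (by simpa [XWord.lift] using h4) (fun s hs => hq s (by simp [hs]))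
              simpa [XWord.lift] using this⟩)
          simpa [XWord.lift] using this
        · cases e with
          | cup c => simp at hs
          | node g => simp at hs
          | mark ε' =>
            rcases s₁ with _ | ⟨_, _ | _⟩ <;> simp at hs
          | enter ε' i' => exact absurd rfl (hq (u, .enter ε' i') (by simp) ε' i')
          | leave ε' i' =>
            rcases s₁ with _ | ⟨_, _ | _⟩ <;> simp at hs
            obtain ⟨⟨rfl, rfl⟩, rfl⟩ := hs
            have := step' p q _ _ u v _ _ (.inl (.merge ε' i')) (by simpa using hp)
              (by simpa using h2) (by simpa [XWord.lift] using hn)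
              (.inl (by simp [XWord.weight, XPiece.weight]))
            simpa [XWord.lift] using this
          | cap c =>
            rcases s₁ with _ | ⟨c', _ | ⟨_, s₁⟩⟩ <;> simp at hs
            · obtain ⟨rfl, rfl⟩ := hs
              have := step' p q _ _ u v _ _ (.inl (.capL ε i))
                (by simpa [XColor.rev, Label.rev] using hp)
                (by simpa using h2) (by simpa [XWord.lift] using hn)
                (.inl (by simp [XWord.weight, XPiece.weight, XColor.weight]))
              simpa [XWord.lift] using this
            · obtain ⟨rfl, hc, rfl⟩ := hs
              have hc' : ∃ j, c = .edge ε (.inn j) ∧ i = Reversal.rev j := by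
                cases c with
                | plain => simp [XColor.rev] at hc
                | edge ε' l => cases l <;> simp [XColor.rev, Label.rev] at hc ⊢; simp [hc]
              obtain ⟨j, rfl, rfl⟩ := hc'
              have := step' p q _ _ u v _ _ (.inl (.capR ε j))
                (by simpa [XColor.rev, Label.rev] using hp)
                (by simpa using h2) (by simpa [XWord.lift] using hn)
                (.inl (by simp [XWord.weight, XPiece.weight, XColor.weight]))
              simpa [XWord.lift] using this
          | cross c d =>
            rcases s₁ with _ | ⟨c', _ | ⟨_, s₁⟩⟩ <;> simp at hs
            · obtain ⟨rfl, rfl⟩ := hs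
              have := step' p q _ _ u v _ _ (.inl (.crossL d (.enter ε i)))
                (by simpa using hp)
                (by simpa using h2) (by simpa [XWord.lift] using hn)
                (.inl (by simp [XWord.weight, XPiece.weight, XColor.weight]; omega))
              simpa [XWord.lift] using this
            · obtain ⟨rfl, rfl, rfl⟩ := hs
              have := step' p q _ _ u v _ _ (.inl (.crossR c (.enter ε i)))
                (by simpa using hp)
                (by simpa using h2) (by simpa [XWord.lift] using hn)
                (.inl (by simp [XWord.weight, XPiece.weight, XColor.weight]))
              simpa [XWord.lift] using this
    -- Likewise the first point of the form `leave` is moved up.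
    have leave : ∀ (p q : XWord I) (x : List (XColor I)) (ε : Bool) (i : I),
        (p ++ (x, .leave ε i) :: q).weight = n → XRuns [] (p ++ (x, .leave ε i) :: q) [] →
        (∀ s ∈ p, ∀ ε' i', s.2 ≠ .leave ε' i') → P (p ++ (x, .leave ε i) :: q) := by
      intro p
      induction p using List.reverseRecOn with
      | nil =>
        intro q x ε i _ h _
        obtain ⟨y, h, _⟩ := h
        simp at h
      | append_singleton p s ihp =>
        intro q x ε i hn h hp'
        obtain ⟨u, e⟩ := s
        obtain ⟨b, h0, y, rfl, h2⟩ := xruns_append.1 h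
        obtain ⟨a, hp, v, rfl, h1⟩ := xruns_append.1 h0
        simp only [XPiece.tgt_leave, XPiece.src_leave, List.append_assoc, List.cons_append,
          List.nil_append, XRuns] at hp h1 h2
        rw [← List.append_assoc u] at h1
        rcases locate h1.symm with ⟨z, rfl, rfl⟩ | ⟨z, rfl, rfl⟩ | ⟨s₁, s₂, hs, rfl, rfl⟩
        · have := step' p q _ _ x v _ _ (.inr (.exch z (.leave ε i) e (.inl trivial))) (by simpa using hp)
            (by simpa using h2) (by simpa [XWord.lift] using hn)
            (.inr ⟨by simp [XWord.weight, Nat.add_comm], fun h3 h4 => by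
              have := ihp ((x ++ XColor.edge ε .up :: z, e) :: q) x ε i
                (by simpa [XWord.lift] using h3)
                (by simpa [XWord.lift] using h4) (fun s hs => hp' s (by simp [hs]))
              simpa [XWord.lift] using this⟩)
          simpa [XWord.lift] using this
        · have := step' p q _ _ u y _ _ (.inl (.exch z e (.leave ε i) (.inr trivial))) (by simpa using hp)
            (by simpa using h2) (by simpa [XWord.lift] using hn)
            (.inr ⟨by simp [XWord.weight, Nat.add_comm], fun h3 h4 => by
              have := ihp ((u, e) :: q) (u ++ e.src ++ z) ε i
                (by simpa [XWord.lift] using h3)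
                (by simpa [XWord.lift] using h4) (fun s hs => hp' s (by simp [hs]))
              simpa [XWord.lift] using this⟩)
          simpa [XWord.lift] using this
        · cases e with
          | cap c => simp at hs
          | node g =>
            have h3 : XColor.edge ε (.inn i) ∈ (XPiece.node g : XPiece I).tgt := by rw [hs]; simp
            rw [XPiece.tgt_node] at h3
            simp only [List.mem_map] at h3
            obtain ⟨c, _, h3⟩ := h3
            cases c <;> simp [XColor.leg] at h3
          | mark ε' =>
            rcases s₁ with _ | ⟨_, _ | _⟩ <;> simp at hs
          | leave ε' i' => exact absurd rfl (hp' (u, .leave ε' i') (by simp) ε' i')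
          | enter ε' i' =>
            rcases s₁ with _ | ⟨_, _ | _⟩ <;> simp at hs
            obtain ⟨⟨rfl, rfl⟩, rfl⟩ := hs
            have := step' p q _ _ u v _ _ (.inl (.merge ε' i')) (by simpa using hp)
              (by simpa using h2) (by simpa [XWord.lift] using hn)
              (.inl (by simp [XWord.weight, XPiece.weight]))
            simpa [XWord.lift] using this
          | cup c =>
            rcases s₁ with _ | ⟨c', _ | ⟨_, s₁⟩⟩ <;> simp at hs
            · obtain ⟨rfl, rfl⟩ := hs
              have := step' p q _ _ u v _ _ (.inl (.cupL ε i))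
                (by simpa using hp)
                (by simpa [XColor.rev, Label.rev] using h2) (by simpa [XWord.lift] using hn)
                (.inl (by simp [XWord.weight, XPiece.weight, XColor.weight]))
              simpa [XWord.lift] using this
            · obtain ⟨rfl, hc, rfl⟩ := hs
              have hc' : ∃ j, c = .edge ε (.inn j) ∧ i = Reversal.rev j := by
                cases c with
                | plain => simp [XColor.rev] at hc
                | edge ε' l => cases l <;> simp [XColor.rev, Label.rev] at hc ⊢; simp [hc]
              obtain ⟨j, rfl, rfl⟩ := hc'
              have := step' p q _ _ u v _ _ (.inl (.cupR ε j))
                (by simpa using hp)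
                (by simpa using h2) (by simpa [XWord.lift] using hn)
                (.inl (by simp [XWord.weight, XPiece.weight, XColor.weight]))
              simpa [XWord.lift] using this
          | cross c d =>
            rcases s₁ with _ | ⟨c', _ | ⟨_, s₁⟩⟩ <;> simp at hs
            · obtain ⟨rfl, rfl⟩ := hs
              have := step' p q _ _ u v _ _ (.inr (.crossR c (.leave ε i)))
                (by simpa using hp)
                (by simpa using h2) (by simpa [XWord.lift] using hn)
                (.inl (by simp [XWord.weight, XPiece.weight, XColor.weight]; omega))
              simpa [XWord.lift] using this
            · obtain ⟨rfl, rfl, rfl⟩ := hs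
              have := step' p q _ _ u v _ _ (.inr (.crossL d (.leave ε i)))
                (by simpa using hp)
                (by simpa using h2) (by simpa [XWord.lift] using hn)
                (.inl (by simp [XWord.weight, XPiece.weight, XColor.weight]))
              simpa [XWord.lift] using this
    intro W hn hW
    by_cases h1 : ∃ s ∈ W, ∃ ε i, s.2 = .enter ε i
    · obtain ⟨u, ⟨x, e⟩, v, rfl, ⟨ε, i, h⟩, h3⟩ := exists_last h1
      simp only at h
      subst h
      push Not at h3
      exact enter v u x ε i hn hW h3
    by_cases h2 : ∃ s ∈ W, ∃ ε i, s.2 = .leave ε i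
    · obtain ⟨u, ⟨x, e⟩, v, rfl, ⟨ε, i, h⟩, h3⟩ := exists_first h2
      simp only at h
      subst h
      push Not at h3
      exact leave u v x ε i hn hW h3
    · refine base W hW fun s hs h3 => ?_
      obtain ⟨x, e⟩ := s
      cases e <;> simp only [XPiece.IsSlider] at h3
      · exact h1 ⟨_, hs, _, _, rfl⟩
      · exact h2 ⟨_, hs, _, _, rfl⟩
  intro W hW
  exact main _ W rfl hW

end Slide

/-! ### Interpretations of labelled drawings -/

/-- A way to draw labelled drawings as drawings of the kind `S`: every strand is replaced by some
parallel strands, and every piece by a drawing. -/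
structure Interp (I : Type) [Reversal I] (S : DrawingKind) where
  col : XColor I → List S.Color
  word : XPiece I → S.Word
  runs : ∀ e, Runs (e.src.flatMap col) (word e) (e.tgt.flatMap col)

namespace Interp

variable {I : Type} [Reversal I] {S : DrawingKind} {Q : S.Word → S.Word → Prop} (F : Interp I S)

/-- The number of strands that replace the strands `x`. -/
def width (x : List (XColor I)) : ℕ := (x.flatMap F.col).length

/-- The drawing that an interpretation associates with a labelled drawing. -/
def map (W : XWord I) : S.Word := W.flatMap fun s => shift (F.width s.1) (F.word s.2)

@[simp] lemma map_nil : F.map [] = [] := rfl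

@[simp] lemma map_cons (s : List (XColor I) × XPiece I) (W : XWord I) :
    F.map (s :: W) = shift (F.width s.1) (F.word s.2) ++ F.map W := rfl

@[simp] lemma map_append (U V : XWord I) : F.map (U ++ V) = F.map U ++ F.map V := by
  simp [map]

lemma map_lift (x : List (XColor I)) (W : XWord I) :
    F.map (XWord.lift x W) = shift (F.width x) (F.map W) := by
  induction W with
  | nil => rfl
  | cons s W ih =>
    change shift (F.width (x ++ s.1)) (F.word s.2) ++ F.map (XWord.lift x W) = _
    rw [ih]
    simp [width, shift_shift]

lemma runs_map {a b : List (XColor I)} {W : XWord I} (h : XRuns a W b) :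
    Runs (a.flatMap F.col) (F.map W) (b.flatMap F.col) := by
  induction W generalizing a with
  | nil => cases h; rfl
  | cons s W ih =>
    obtain ⟨y, rfl, h⟩ := h
    have h1 := (F.runs s.2).whisker (s.1.flatMap F.col) (y.flatMap F.col)
    rw [map_cons]
    refine Runs.append (by simpa [width] using h1) (by simpa using ih h)

/-- The ends of inner sections can be moved along the edges in the interpretation. -/
structure Lawful (Q : S.Word → S.Word → Prop) : Prop where
  crossL : ∀ {e : XPiece I} {c c' : XColor I} (d : XColor I), SliderOf e c c' →
    Eqv Q (([c, d] : List (XColor I)).flatMap F.col) (([d, c'] : List (XColor I)).flatMap F.col)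
      (F.map [([], e), ([], .cross c' d)]) (F.map [([], .cross c d), ([d], e)])
  crossR : ∀ {e : XPiece I} {c c' : XColor I} (d : XColor I), SliderOf e c c' →
    Eqv Q (([d, c] : List (XColor I)).flatMap F.col) (([c', d] : List (XColor I)).flatMap F.col)
      (F.map [([d], e), ([], .cross d c')]) (F.map [([], .cross d c), ([], e)])
  capL : ∀ (ε : Bool) (i : I),
    Eqv Q (([.edge ε .dn, .edge ε (.inn (Reversal.rev i))] : List (XColor I)).flatMap F.col) []
      (F.map [([], .enter ε i), ([], .cap (.edge ε (.inn i)))])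
      (F.map [([.edge ε .dn], .leave ε (Reversal.rev i)), ([], .cap (.edge ε .dn))])
  capR : ∀ (ε : Bool) (i : I),
    Eqv Q (([.edge ε (.inn i), .edge ε .dn] : List (XColor I)).flatMap F.col) []
      (F.map [([.edge ε (.inn i)], .enter ε (Reversal.rev i)), ([], .cap (.edge ε (.inn i)))])
      (F.map [([], .leave ε i), ([], .cap (.edge ε .up))])
  cupL : ∀ (ε : Bool) (i : I),
    Eqv Q [] (([.edge ε .up, .edge ε (.inn (Reversal.rev i))] : List (XColor I)).flatMap F.col)
      (F.map [([], .cup (.edge ε (.inn i))), ([], .leave ε i)])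
      (F.map [([], .cup (.edge ε .up)), ([.edge ε .up], .enter ε (Reversal.rev i))])
  cupR : ∀ (ε : Bool) (i : I),
    Eqv Q [] (([.edge ε (.inn i), .edge ε .up] : List (XColor I)).flatMap F.col)
      (F.map [([], .cup (.edge ε (.inn i))), ([.edge ε (.inn i)], .leave ε (Reversal.rev i))])
      (F.map [([], .cup (.edge ε .dn)), ([], .enter ε i)])
  merge : ∀ (ε : Bool) (i : I),
    Eqv Q (([.edge ε .dn] : List (XColor I)).flatMap F.col)
      (([.edge ε .up] : List (XColor I)).flatMap F.col)
      (F.map [([], .enter ε i), ([], .leave ε i)]) (F.map [([], .mark ε)])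

variable {F}

lemma Lawful.eqv (hF : F.Lawful Q) {a b : List (XColor I)} {l r : XWord I} (h : Slide a b l r) :
    Eqv Q (a.flatMap F.col) (b.flatMap F.col) (F.map l) (F.map r) := by
  cases h with
  | exch z e e' _ =>
    have h1 := (F.runs e').whisker (z.flatMap F.col) []
    have := Eqv.interchange (Q := Q) (F.runs e) h1
    simpa [width, shift_shift] using this
  | crossL d h => exact hF.crossL d h
  | crossR d h => exact hF.crossR d h
  | capL ε i => exact hF.capL ε i
  | capR ε i => exact hF.capR ε i
  | cupL ε i => exact hF.cupL ε i
  | cupR ε i => exact hF.cupR ε i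
  | merge ε i => exact hF.merge ε i

lemma Lawful.step (hF : F.Lawful Q) {p q l r : XWord I} {x y a b : List (XColor I)}
    (h : Slide a b l r ∨ Slide a b r l) (hp : XRuns [] p (x ++ a ++ y))
    (hq : XRuns (x ++ b ++ y) q []) :
    Eqv Q [] [] (F.map (p ++ (XWord.lift x l ++ q))) (F.map (p ++ (XWord.lift x r ++ q))) := by
  have h' : Eqv Q (a.flatMap F.col) (b.flatMap F.col) (F.map l) (F.map r) := by
    rcases h with h | h
    exacts [hF.eqv h, (hF.eqv h).symm]
  have := h'.replace (x.flatMap F.col) (y.flatMap F.col) rfl (F.runs_map hp) (F.runs_map hq)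
    (by simp) (by simp)
  simpa [map_lift, width] using this

end Interp

instance {S : DrawingKind} [DecidableEq S.Color] [DecidableEq S.Node] : DecidableEq S.Piece
  | .cup c, .cup d => decidable_of_iff (c = d) (by simp)
  | .cap c, .cap d => decidable_of_iff (c = d) (by simp)
  | .cross c d, .cross c' d' => decidable_of_iff (c = c' ∧ d = d') (by simp)
  | .node g, .node h => decidable_of_iff (g = h) (by simp)
  | .cup _, .cap _ | .cup _, .cross _ _ | .cup _, .node _ | .cap _, .cup _ | .cap _, .cross _ _
  | .cap _, .node _ | .cross _ _, .cup _ | .cross _ _, .cap _ | .cross _ _, .node _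
  | .node _, .cup _ | .node _, .cap _ | .node _, .cross _ _ => isFalse (by simp)

/-- Some contexts for the replacement of a part of a drawing, checked by computation. -/
lemma DrawingKind.Eqv.replace_of_eq {S : DrawingKind} {Q : S.Word → S.Word → Prop}
    [DecidableEq S.Color] {a b A B : List S.Color} {u v : S.Word} (h : Eqv Q a b u v)
    (p q : S.Word) (x y : List S.Color) {w w' : S.Word}
    (hw : w = p ++ shift x.length u ++ q ∧ w' = p ++ shift x.length v ++ q ∧
      runList A p = some (x ++ a ++ y) ∧ runList (x ++ b ++ y) q = some B) : Eqv Q A B w w' := by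
  obtain ⟨rfl, rfl, h1, h2⟩ := hw
  exact h.replace x y rfl (runs_of_runList h1) (runs_of_runList h2) rfl rfl

namespace DrawingKind

variable {S : DrawingKind} {Q : S.Word → S.Word → Prop}

/-- Replace the vertices of a drawing, in the order of their heights, by the drawings that the
functions in the list assign to them. -/
def substNodes : List (S.Node → S.Word) → S.Word → S.Word
  | [], w => w
  | _, [] => []
  | f :: fs, (k, .node g) :: w => shift k (f g) ++ substNodes fs w
  | f :: fs, s :: w => s :: substNodes (f :: fs) w

lemma Eqv.substNodes {fs : List (S.Node → S.Word)}
    (h : ∀ f ∈ fs, ∀ g, Eqv Q [] (S.legs g) [(0, .node g)] (f g)) {a b : List S.Color} {w : S.Word}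
    (hw : Runs a w b) : Eqv Q a b w (DrawingKind.substNodes fs w) := by
  induction w generalizing fs a with
  | nil => cases fs <;> exact .refl hw
  | cons s w ih =>
    rcases fs with _ | ⟨f, fs⟩
    · exact .refl hw
    obtain ⟨k, e⟩ := s
    obtain ⟨c, h1, h2⟩ := hw
    cases e with
    | node g =>
      obtain ⟨x, y, hx, rfl, rfl⟩ := h1
      have h3 := (h f (by simp) g).whisker' x y hx (A := x ++ (Piece.node g).src ++ y)
        (B := x ++ (Piece.node g).tgt ++ y) rfl rfl
      exact h3.comp (ih (fun f' hf' => h f' (by simp [hf'])) h2)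
    | _ => exact (ih h h2).cons h1

lemma Eqv.of_nf_subst [DecidableEq S.Color] [DecidableEq S.Node] {a b : List S.Color}
    {w w' : S.Word} (fs : List (S.Node → S.Word))
    (h : ∀ f ∈ fs, ∀ g, Eqv Q [] (S.legs g) [(0, .node g)] (f g))
    (hw : runList a w = some b ∧
      runList a (DrawingKind.substNodes fs w) = some b ∧ runList a w' = some b ∧
      (DrawingKind.nf (DrawingKind.substNodes fs w ++ closeWord b.reverse)).isSome ∧
      DrawingKind.nf (DrawingKind.substNodes fs w ++ closeWord b.reverse) =
        DrawingKind.nf (w' ++ closeWord b.reverse)) :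
    Eqv Q a b w w' :=
  (Eqv.substNodes h (runs_of_runList hw.1)).trans (.of_nf hw.2)

/-- The pairing computed by the normal form of a drawing. -/
def pairing (w : S.Word) : List ℕ := (nf w).elim [] Prod.snd

/-- The two drawings are equivalent if they become equal after the vertices have been moved to the
top, and the drawing `front gs` of the vertices has been replaced by `F`. -/
lemma Eqv.of_nf_front [DecidableEq S.Color] {gs : List S.Node} {L : List S.Color} {F : S.Word}
    (h : Eqv Q [] L (front gs) F) {a b : List S.Color} {w w' : S.Word}
    (hw : runList a w = some b ∧ runList a w' = some b ∧
      DrawingKind.nf (w ++ closeWord b.reverse) = some (gs, pairing (w ++ closeWord b.reverse)) ∧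
      (DrawingKind.nf (F ++ capsWord (L ++ (a ++ b.reverse))
        (pairing (w ++ closeWord b.reverse)))).isSome ∧
      DrawingKind.nf (F ++ capsWord (L ++ (a ++ b.reverse))
          (pairing (w ++ closeWord b.reverse))) =
        DrawingKind.nf (w' ++ closeWord b.reverse)) :
    Eqv Q a b w w' := by
  obtain ⟨h1, h2, h3, h4, h5⟩ := hw
  obtain ⟨⟨gs', ds'⟩, h6⟩ := Option.isSome_iff_exists.1 h4
  have r1 := runs_of_runList h1
  have r2 := runs_of_runList h2
  have hc : ∀ {w}, Runs a w b → Runs (a ++ b.reverse) (w ++ closeWord b.reverse) [] := by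
    intro w hw
    refine Runs.append (by simpa using hw.whisker [] b.reverse) ?_
    simpa using runs_closeWord b.reverse
  have e1 := (Eqv.nf (Q := Q) (hc r1) h3).2
  have e2 := (Eqv.nf (Q := Q) (hc r2) (h5 ▸ h6)).2
  have hL : frontLegs gs ++ [] = L := (runs_front gs []).det h.runs.1
  rw [List.append_nil] at hL
  subst hL
  obtain ⟨c, h7, h8⟩ := runs_append.1 e1.runs.2
  cases h7.det (runs_front gs _)
  have e3 : Eqv Q (a ++ b.reverse) [] (front gs ++ _) (F ++ _) :=
    Eqv.right (by simpa using h.whisker [] (a ++ b.reverse)) h8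
  have e4 := (Eqv.nf (Q := Q) e3.runs.2 h6).2
  have := Eqv.of_closeWord (Q := Q) b.reverse (by simpa using r1) (by simpa using r2)
    (e1.trans (e3.trans (e4.trans e2.symm)))
  simpa using this

/-- Two vertices are drawn in either order. -/
lemma Eqv.swapNodes (g g' : S.Node) : Eqv Q [] (S.legs g' ++ S.legs g) (front [g, g'])
    [(0, .node g'), ((S.legs g').length, .node g)] := by
  have h : ∀ g, Runs [] [(0, .node g)] (S.legs g) := fun g => by simpa [frontLegs, front] using runs_front [g] []
  simpa [front] using (Eqv.interchange (Q := Q) (h g') (h g)).symm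

end DrawingKind

/-! ### Moves together with their boundaries -/

namespace DrawingKind

variable {S : DrawingKind} {Q : S.Word → S.Word → Prop}
  {T : List S.Color → List S.Color → S.Word → S.Word → Prop}

/-- The planar isotopies, the moves on intersections, and the moves `T`, together with the strands
that bound the part of the drawing which is changed. -/
inductive LocalMove (T : List S.Color → List S.Color → S.Word → S.Word → Prop) :
    List S.Color → List S.Color → S.Word → S.Word → Prop
  | exchange (e e' : S.Piece) (z : List S.Color) :
      LocalMove T (e.src ++ z ++ e'.src) (e.tgt ++ z ++ e'.tgt)
        [(0, e), (e.tgt.length + z.length, e')] [(e.src.length + z.length, e'), (0, e)]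
  | zigzag (c : S.Color) : LocalMove T [c] [c] [(1, .cup c), (0, .cap c)] []
  | zagzig (c : S.Color) : LocalMove T [c] [c] [(0, .cup c), (1, .cap c)] []
  | slideCup (c d : S.Color) : LocalMove T [d] [c, d, c]
      [(1, .cup c), (0, .cross d c)] [(0, .cup c), (1, .cross c d)]
  | slideCap (c d : S.Color) : LocalMove T [c, d, c] [d]
      [(0, .cross c d), (1, .cap c)] [(1, .cross d c), (0, .cap c)]
  | rotate (g : S.Node) (c : S.Color) (l : List S.Color) (h : S.legs g = c :: l) :
      LocalMove T [] (l ++ [c]) [(0, .node (S.rot g))] [(0, .cup c), (1, .node g), (0, .cap c)]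
  | kink (c : S.Color) : LocalMove T [] [c, c] [(0, .cup c), (0, .cross c c)] [(0, .cup c)]
  | bigon (c d : S.Color) : LocalMove T [c, d] [c, d] [(0, .cross c d), (0, .cross d c)] []
  | triangle (c d e : S.Color) : LocalMove T [c, d, e] [e, d, c]
        [(0, .cross c d), (1, .cross c e), (0, .cross d e)]
        [(1, .cross d e), (0, .cross c e), (1, .cross c d)]
  | pass (c : S.Color) (g : S.Node) (l₁ l₂ : List S.Color) (h : S.legs g = l₁ ++ l₂) :
      LocalMove T [c] (l₁ ++ c :: l₂) ((1, .node g) :: passRight c 0 l₁)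
        ((0, .node g) :: passLeft c l₁.length l₂)
  | special {a b : List S.Color} {u v : S.Word} (h : T a b u v) :
      LocalMove T a b u v

/-- The moves `T` are the moves `Q` together with the strands that bound the part of the drawing
which is changed. -/
structure IsBoundary (Q : S.Word → S.Word → Prop)
    (T : List S.Color → List S.Color → S.Word → S.Word → Prop) : Prop where
  runs : ∀ {a b u v}, T a b u v → Runs a u b ∧ Runs a v b
  exists_boundary : ∀ {u v A B}, Q u v → Runs A u B → ∃ a b y, A = a ++ y ∧ T a b u v
  ne_nil : ∀ {u v}, Q u v → u ≠ []

lemma LocalMove.runs (hT : IsBoundary Q T) {a b : List S.Color} {u v : S.Word} (h : LocalMove T a b u v) :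
    Runs a u b ∧ Runs a v b := by
  cases h with
  | exchange e e' z =>
    have := (Eqv.interchange (Q := fun _ _ => False) (u := [(0, e)]) (v := [(z.length, e')])
      (a := e.src) (a' := e.tgt) (b := z ++ e'.src) (b' := z ++ e'.tgt)
      (runs_singleton.2 ⟨[], [], rfl, by simp, by simp⟩)
      (runs_singleton.2 ⟨z, [], rfl, by simp, by simp⟩)).runs
    simpa using this
  | rotate g c l h =>
    have h1 : S.legs (S.rot g) = l ++ [c] := by rw [S.legs_rot, h]; simp
    exact ⟨runs_singleton.2 ⟨[], [], rfl, by simp [Piece.src], by simp [Piece.tgt, h1]⟩,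
      by simp [runs_cons, Piece.src, Piece.tgt, h]⟩
  | pass c g l₁ l₂ h =>
    constructor
    · refine ⟨[c] ++ S.legs g, ⟨[c], [], rfl, by simp [Piece.src], by simp [Piece.tgt]⟩, ?_⟩
      rw [h]
      simpa using (runs_passRight c l₁).whisker [] l₂
    · refine ⟨S.legs g ++ [c], ⟨[], [c], rfl, by simp [Piece.src], by simp [Piece.tgt]⟩, ?_⟩
      rw [h, ← Nat.add_zero l₁.length, passLeft_shift]
      simpa using (runs_passLeft c l₂).whisker l₁ []
  | special h => exact hT.runs h
  | _ => simp [runs_cons, Piece.src, Piece.tgt]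

/-- The boundaries of a move are determined by the move. -/
lemma Moves.exists_localMove
    (hT : IsBoundary Q T) {u v : S.Word} {A B : List S.Color} (h : Moves Q u v) (hu : Runs A u B) (hv : Runs A v B) :
    ∃ a b y, A = a ++ y ∧ B = b ++ y ∧ LocalMove T a b u v := by
  suffices ∃ a b y, A = a ++ y ∧ LocalMove T a b u v by
    obtain ⟨a, b, y, rfl, h⟩ := this
    have h1 := (h.runs hT).1.whisker [] y
    rw [List.length_nil, shift_zero] at h1
    exact ⟨a, b, y, rfl, hu.det h1, h⟩
  rcases h with h | h | h
  · cases h with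
    | exchange e e' j =>
      obtain ⟨_, ⟨x, y, hx, rfl, rfl⟩, _, ⟨x', y', hx', h1, rfl⟩, rfl⟩ := hu
      cases List.length_eq_zero_iff.1 hx
      simp only [List.nil_append, List.append_assoc] at h1
      obtain ⟨z, rfl, rfl⟩ | ⟨z, h3, h2⟩ := List.append_eq_append_iff.1 h1
      · simp only [List.length_append, Nat.add_left_cancel_iff] at hx'
        subst hx'
        exact ⟨_, _, y', by simp, .exchange e e' z⟩
      · have hz : z = [] := by
          rw [h3] at hx'
          simp only [List.length_append] at hx'
          exact List.length_eq_zero_iff.1 (by omega)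
        subst hz
        simp only [List.append_nil, List.nil_append] at h3 h2
        rw [← h3] at hx'
        have : j = 0 := by simp at hx'; omega
        subst this h2
        exact ⟨_, _, y', by simp, .exchange e e' []⟩
    | zigzag c =>
      rcases A with _ | ⟨c', y⟩
      · simp [runs_cons] at hu
      · simp [runs_cons, Piece.src, Piece.tgt] at hu
        obtain ⟨rfl, rfl⟩ := hu
        exact ⟨_, _, y, rfl, .zigzag _⟩
    | zagzig c =>
      rcases A with _ | ⟨c', y⟩
      · simp [runs_cons, Piece.src, Piece.tgt] at hu
      · simp [runs_cons, Piece.src, Piece.tgt] at hu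
        obtain ⟨rfl, rfl⟩ := hu
        exact ⟨_, _, y, rfl, .zagzig _⟩
    | slideCup c d =>
      rcases A with _ | ⟨c', y⟩
      · simp [runs_cons] at hu
      · simp [runs_cons, Piece.src, Piece.tgt] at hu
        obtain ⟨rfl, rfl⟩ := hu
        exact ⟨_, _, y, rfl, .slideCup c _⟩
    | slideCap c d =>
      rcases A with _ | ⟨c₁, _ | ⟨c₂, _ | ⟨c₃, y⟩⟩⟩ <;>
        simp [runs_cons, Piece.src, Piece.tgt] at hu
      obtain ⟨⟨rfl, rfl⟩, rfl, rfl⟩ := hu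
      exact ⟨_, _, y, rfl, .slideCap _ _⟩
    | rotate g c l h => exact ⟨_, _, A, rfl, .rotate g c l h⟩
  · cases h with
    | kink c => exact ⟨_, _, A, rfl, .kink c⟩
    | bigon c d =>
      rcases A with _ | ⟨c₁, _ | ⟨c₂, y⟩⟩ <;> simp [runs_cons, Piece.src, Piece.tgt] at hu
      obtain ⟨⟨rfl, rfl⟩, rfl⟩ := hu
      exact ⟨_, _, y, rfl, .bigon _ _⟩
    | triangle c d e =>
      rcases A with _ | ⟨c₁, _ | ⟨c₂, _ | ⟨c₃, y⟩⟩⟩ <;>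
        simp [runs_cons, Piece.src, Piece.tgt] at hu
      obtain ⟨⟨rfl, rfl⟩, rfl, rfl⟩ := hu
      exact ⟨_, _, y, rfl, .triangle _ _ _⟩
    | pass c g l₁ l₂ h =>
      rcases A with _ | ⟨c', y⟩
      · simp [runs_cons] at hu
      -- If the vertex has no legs then the colour of the strand does not matter.
      have hc : c' = c ∨ (l₁ = [] ∧ l₂ = []) := by
        rcases l₁ with _ | ⟨d, l₁⟩
        · rcases l₂.eq_nil_or_concat with rfl | ⟨l, d, rfl⟩
          · exact .inr ⟨rfl, rfl⟩
          · rw [List.concat_eq_append] at h hv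
            simp [runs_cons, passLeft_append, passLeft, Piece.src, Piece.tgt, h] at hv
            exact .inl hv.1
        · simp [runs_cons, passRight, Piece.src, Piece.tgt, h] at hu
          exact .inl hu.1
      rcases hc with rfl | ⟨rfl, rfl⟩
      · exact ⟨_, _, y, rfl, .pass _ g l₁ l₂ h⟩
      · exact ⟨_, _, y, rfl, .pass c' g [] [] h⟩
  · obtain ⟨a, b, y, rfl, h1⟩ := hT.exists_boundary h hu
    exact ⟨a, b, y, rfl, .special h1⟩

lemma Fits.codet {a a' b : List S.Color} {s : ℕ × S.Piece} (h : Fits a s b) (h' : Fits a' s b) :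
    a = a' := by
  obtain ⟨x, y, hx, rfl, rfl⟩ := h
  obtain ⟨x', y', hx', rfl, h⟩ := h'
  simp only [List.append_assoc] at h
  obtain ⟨rfl, h⟩ := List.append_inj h (hx.trans hx'.symm)
  rw [List.append_cancel_left (List.append_cancel_left h)]

lemma Runs.codet {a a' b : List S.Color} {w : S.Word} (h : Runs a w b) (h' : Runs a' w b) :
    a = a' := by
  induction w generalizing a a' with
  | nil => exact h.trans h'.symm
  | cons s w ih =>
    obtain ⟨c, h1, h2⟩ := h
    obtain ⟨c', h3, h4⟩ := h'
    cases ih h2 h4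
    exact h1.codet h3

/-- A move on a drawing takes place in a context. -/
lemma Rewrite.exists_context
    (hT : IsBoundary Q T) {w w' : S.Word} {A B : List S.Color} (h : Rewrite (Moves Q) w w') (hw : Runs A w B)
    (hw' : Runs A w' B) :
    ∃ (p q u v : S.Word) (x y a b : List S.Color), LocalMove T a b u v ∧
      Runs A p (x ++ a ++ y) ∧ Runs (x ++ b ++ y) q B ∧
      w = p ++ (shift x.length u ++ q) ∧ w' = p ++ (shift x.length v ++ q) := by
  obtain ⟨p, q, u, v, k, h, rfl, rfl⟩ := h
  rw [List.append_assoc] at hw hw'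
  obtain ⟨A₁, h1, h2⟩ := runs_append.1 hw
  obtain ⟨B₁, h3, h4⟩ := runs_append.1 h2
  obtain ⟨A₁', h1', h2'⟩ := runs_append.1 hw'
  obtain ⟨B₁', h3', h4'⟩ := runs_append.1 h2'
  cases h1.det h1'
  cases h4.codet h4'
  have hu : u ≠ [] := by
    rcases h with h | h | h
    · cases h <;> simp
    · cases h <;> simp
    · exact hT.ne_nil h
  obtain ⟨x, a, b, rfl, rfl, rfl, h5⟩ := h3.strip (.inl hu)
  obtain ⟨x', a', b', h6, h7, h8, h9⟩ := h3'.strip (.inr (by simp))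
  obtain ⟨rfl, rfl⟩ := List.append_inj h7 h6.symm
  cases List.append_cancel_left h8
  obtain ⟨a, b, y, rfl, rfl, h⟩ := Moves.exists_localMove hT h h5 h9
  exact ⟨p, q, u, v, x, y, a, b, h, by simpa using h1, by simpa using h4, by simp, by simp⟩

end DrawingKind

/-! ### Labelled drawings as link diagrams -/

/-- The moves of `Z`-virtual links, apart from planar isotopy and the moves on virtual crossings. -/
abbrev LinkMove (u v : linkKind.Word) : Prop := ReidemeisterMove u v ∨ ZMove u v

/-- Some parallel strands of a link diagram. -/
abbrev XColor.strands {I : Type} : XColor I → List linkKind.Color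
  | .plain => [()]
  | .edge _ _ => [(), ()]

/-- The drawing of a vertex as a junction, in which the first one of the two parallel strands which
replace the matched edge is joined to one of the unmatched edges, and the second one to the other.
The two parallel strands cross each other if the vertex is hollow. -/
def junction (solid : Bool) (pos : Fin 3) : linkKind.Word :=
  match pos with
  | 0 => [(0, .cup ()), (1, .cup ())] ++ if solid then [] else [(0, .cross () ())]
  | 1 => [(0, .cup ()), (2, .cup ())] ++ if solid then [] else [(1, .cross () ())]
  | 2 => [(0, .cup ()), (1, .cup ())] ++ if solid then [] else [(2, .cross () ())]

/-- The crossing of the two parallel strands that replaces a matched edge. It consists of a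
classical and a virtual crossing, turned sideways. -/
def tee (ε : Bool) : linkKind.Word :=
  (2, .cup ()) :: (shift 1 (classicalCrossing ε ++ virtualCrossing) ++ [(0, .cap ())])

variable {I : Type}

/-- The link diagrams drawn by `linkInterp`, piece by piece. -/
def linkWord (f : I → Bool) : XPiece I → linkKind.Word
  | .cup .plain => [(0, .cup ())]
  | .cup (.edge _ _) => [(0, .cup ()), (1, .cup ())]
  | .cap .plain => [(0, .cap ())]
  | .cap (.edge _ _) => [(1, .cap ()), (0, .cap ())]
  | .cross c d => moveLeft c.strands d.strands
  | .node g => junction g.solid g.pos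
  | .mark ε => tee ε
  | .enter ε i => if f i then tee ε else []
  | .leave ε i => if f i then [] else tee ε

lemma runs_tee (ε : Bool) : Runs [(), ()] (tee ε) [(), ()] :=
  runs_of_runList (by cases ε <;> decide +kernel)

/-- Labelled drawings as link diagrams: matched edges are replaced by two parallel
strands, which meet in a classical and a virtual crossing once. The function `f` decides, for each
label of an inner section, whether this is done at its beginning or at its end. -/
def linkInterp [Reversal I] (f : I → Bool) : Interp I linkKind where
  col := XColor.strands
  word := linkWord f
  runs := by
    rintro (c | c | ⟨c, d⟩ | ⟨a, ε, i⟩ | ε | ⟨ε, i⟩ | ⟨ε, i⟩)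
    · cases c <;> exact runs_of_runList rfl
    · cases c <;> exact runs_of_runList rfl
    · simpa [linkWord] using runs_moveLeft c.strands d.strands
    · fin_cases i <;> cases a <;> exact runs_of_runList rfl
    · exact runs_tee ε
    · simp only [linkWord]
      split
      exacts [runs_tee ε, rfl]
    · simp only [linkWord]
      split
      exacts [rfl, runs_tee ε]

lemma Eqv.linkRotate (b : Bool) : Eqv LinkMove [] [(), (), (), ()] [(0, .node (!b))]
    [(0, .cup ()), (1, .node b), (0, .cap ())] :=
  .move (.inl (.rotate (S := linkKind) b () [(), (), ()] rfl))
    (runs_of_runList (by cases b <;> decide +kernel))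
    (runs_of_runList (by cases b <;> decide +kernel))

/-- A classical crossing looks the same after a half turn. -/
lemma Eqv.linkHalfTurn (b : Bool) : Eqv LinkMove [] [(), (), (), ()] [(0, .node b)]
    [(0, .cup ()), (1, .cup ()), (2, .node b), (1, .cap ()), (0, .cap ())] := by
  have h1 := Eqv.linkRotate (!b)
  rw [Bool.not_not] at h1
  exact h1.trans (.replace_of_eq (Eqv.linkRotate b) [(0, .cup ())] [(0, .cap ())] [()] [()]
    (by cases b <;> decide +kernel))

lemma runs_crossing (b : Bool) : Runs [(), ()] (classicalCrossing b) [(), ()] :=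
  runs_of_runList (by cases b <;> decide +kernel)

lemma Eqv.zMove (b : Bool) : Eqv LinkMove [(), ()] [(), ()]
    (classicalCrossing b ++ virtualCrossing) (virtualCrossing ++ classicalCrossing b) :=
  .move (.inr (.inr (.inr (.z b)))) ((runs_crossing b).append (runs_of_runList rfl))
    ((runs_of_runList rfl : Runs [(), ()] virtualCrossing [(), ()]).append (runs_crossing b))

/-- The `Z`-move as a symmetry of a classical crossing: it is turned about an axis in the
plane without change of the crossing information. -/
lemma Eqv.linkFlip (b : Bool) : Eqv LinkMove [] [(), (), (), ()] [(0, .node b)]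
    [(0, .node b), (0, .cross () ()), (2, .cross () ())] := by
  have h1 : Eqv LinkMove [] [(), (), (), ()] [(0, .node b), (2, .cross () ())]
      ([(0, .cup ()), (1, .cup ())] ++ shift 2 (classicalCrossing b ++ virtualCrossing)) := by
    cases b <;> exact .of_nf (by decide +kernel)
  have h2 : Eqv LinkMove [] [(), (), (), ()]
      ([(0, .cup ()), (1, .cup ())] ++ shift 2 (virtualCrossing ++ classicalCrossing b))
      [(0, .node b), (0, .cross () ())] := by
    cases b <;> exact .of_nf (by decide +kernel)
  have h3 : Eqv LinkMove [] [(), (), (), ()] [(0, .node b)]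
      [(0, .node b), (2, .cross () ()), (2, .cross () ())] := by
    cases b <;> exact .of_nf (by decide +kernel)
  have h' := (Eqv.zMove b).replace (p := [(0, .cup ()), (1, .cup ())]) (q := []) (k := 2)
    (A' := []) (B' := [(), (), (), ()]) [(), ()] [] rfl (runs_of_runList rfl) (.nil _) rfl rfl
  have h4 := (h1.trans (Eqv.trans (by simpa using h') h2)).right
    (v := [(2, .cross () ())]) (c := [(), (), (), ()]) (runs_of_runList rfl)
  exact h3.trans h4

/-- `Eqv.linkFlip` combined with a half turn. -/
lemma Eqv.linkReverse (b : Bool) : Eqv LinkMove [] [(), (), (), ()] [(0, .node b)]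
    [(0, .node b), (0, .cross () ()), (1, .cross () ()), (2, .cross () ()), (0, .cross () ()),
      (1, .cross () ()), (0, .cross () ())] := by
  refine (Eqv.linkFlip b).trans ?_
  cases b <;> exact .of_nf_subst [_] (List.forall_mem_singleton.2 Eqv.linkHalfTurn) (by decide +kernel)

lemma Eqv.tee_cap (ε : Bool) : Eqv LinkMove [(), (), (), ()] []
    (tee ε ++ [(1, .cap ()), (0, .cap ())]) (shift 2 (tee ε) ++ [(1, .cap ()), (0, .cap ())]) := by
  cases ε <;> exact .of_nf_subst [_] (List.forall_mem_singleton.2 Eqv.linkReverse) (by decide +kernel)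

lemma Eqv.tee_cup (ε : Bool) : Eqv LinkMove [] [(), (), (), ()]
    ([(0, .cup ()), (1, .cup ())] ++ tee ε) ([(0, .cup ()), (1, .cup ())] ++ shift 2 (tee ε)) := by
  cases ε <;> exact .of_nf_subst [_] (List.forall_mem_singleton.2 Eqv.linkReverse) (by decide +kernel)

lemma XColor.strands_eq (d : XColor I) : d.strands = [()] ∨ d.strands = [(), ()] := by
  cases d <;> simp

lemma Eqv.tee_crossL (ε : Bool) (d : XColor I) :
    Eqv LinkMove ([(), ()] ++ d.strands) (d.strands ++ [(), ()])
      (tee ε ++ moveLeft [(), ()] d.strands)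
      (moveLeft [(), ()] d.strands ++ shift d.strands.length (tee ε)) := by
  rcases d.strands_eq with h | h <;> rw [h] <;> cases ε <;> exact .of_nf (by decide +kernel)

lemma Eqv.tee_crossR (ε : Bool) (d : XColor I) :
    Eqv LinkMove (d.strands ++ [(), ()]) ([(), ()] ++ d.strands)
      (shift d.strands.length (tee ε) ++ moveLeft d.strands [(), ()])
      (moveLeft d.strands [(), ()] ++ tee ε) := by
  rcases d.strands_eq with h | h <;> rw [h] <;> cases ε <;> exact .of_nf (by decide +kernel)

/-- If the crossing is at the end of an inner section that is moved, then it moves along, and otherwise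
there is nothing to be done. A crossing that moves over a maximum or a minimum changes from the
beginning of its inner section to the end of the reversed one, whence the assumption on `f`. -/
theorem linkInterp_lawful [Reversal I] {f : I → Bool} (hf : ∀ i, f (Reversal.rev i) = !f i) :
    (linkInterp f).Lawful LinkMove where
  crossL d h := by
    cases h with
    | _ ε i =>
      have h1 := Eqv.tee_crossL ε d
      have h2 := Eqv.refl (Q := LinkMove) (runs_moveLeft [(), ()] d.strands)
      cases hi : f i <;> simpa [Interp.width, linkInterp, linkWord, hi] using by assumption
  crossR d h := by
    cases h with
    | _ ε i =>
      have h1 := Eqv.tee_crossR ε d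
      have h2 := Eqv.refl (Q := LinkMove) (runs_moveLeft d.strands [(), ()])
      cases hi : f i <;> simpa [Interp.width, linkInterp, linkWord, hi] using by assumption
  capL ε i := by
    have h1 := Eqv.tee_cap ε
    have h2 : Eqv LinkMove [(), (), (), ()] [] [(1, .cap ()), (0, .cap ())] _ :=
      Eqv.refl (runs_of_runList rfl)
    cases hi : f i <;> simpa [Interp.width, linkInterp, linkWord, hi, hf] using by assumption
  capR ε i := by
    have h1 := (Eqv.tee_cap ε).symm
    have h2 : Eqv LinkMove [(), (), (), ()] [] [(1, .cap ()), (0, .cap ())] _ :=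
      Eqv.refl (runs_of_runList rfl)
    cases hi : f i <;> simpa [Interp.width, linkInterp, linkWord, hi, hf] using by assumption
  cupL ε i := by
    have h1 := Eqv.tee_cup ε
    have h2 : Eqv LinkMove [] [(), (), (), ()] [(0, .cup ()), (1, .cup ())] _ :=
      Eqv.refl (runs_of_runList rfl)
    cases hi : f i <;> simpa [Interp.width, linkInterp, linkWord, hi, hf] using by assumption
  cupR ε i := by
    have h1 := (Eqv.tee_cup ε).symm
    have h2 : Eqv LinkMove [] [(), (), (), ()] [(0, .cup ()), (1, .cup ())] _ :=
      Eqv.refl (runs_of_runList rfl)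
    cases hi : f i <;> simpa [Interp.width, linkInterp, linkWord, hi, hf] using by assumption
  merge ε i := by
    have h1 := Eqv.refl (Q := LinkMove) (runs_tee ε)
    cases hi : f i <;> simpa [Interp.width, linkInterp, linkWord, hi] using h1

/-! ### Link diagrams as matched diagrams -/

/-- The moves of `Z`-graphenes, apart from planar isotopy and the moves on intersections. -/
abbrev GrapheneMove (u v : matchedKind.Word) : Prop := TwistMove u v ∨ NonRibbonMove u v

/-- Put `k` more strands to the left of a ladder. -/
def Ladder.shift (k : ℕ) (L : Ladder) : Ladder := L.map fun s => (k + s.1, s.2)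

lemma Ladder.toMatched_append (L M : Ladder) :
    Ladder.toMatched (L ++ M) = L.toMatched ++ M.toMatched := by
  simp [Ladder.toMatched]

lemma Ladder.toLink_append (L M : Ladder) : Ladder.toLink (L ++ M) = L.toLink ++ M.toLink := by
  simp [Ladder.toLink]

lemma Ladder.toMatched_shift (k : ℕ) (L : Ladder) :
    (Ladder.shift k L).toMatched = DrawingKind.shift k L.toMatched := by
  induction L with
  | nil => rfl
  | cons s L ih =>
    change DrawingKind.shift (k + s.1) _ ++ Ladder.toMatched (Ladder.shift k L) = _
    rw [ih, ← shift_shift, ← shift_append]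
    rfl

lemma Ladder.toLink_shift (k : ℕ) (L : Ladder) :
    (Ladder.shift k L).toLink = DrawingKind.shift k L.toLink := by
  induction L with
  | nil => rfl
  | cons s L ih =>
    change DrawingKind.shift (k + s.1) _ ++ Ladder.toLink (Ladder.shift k L) = _
    rw [ih, ← shift_shift, ← shift_append]
    rfl

/-- A piece of a link diagram as a matched diagram: a classical crossing is a
matched edge followed by an intersection, since two virtual crossings cancel each other. -/
def resolvePiece : linkKind.Piece → Ladder
  | .cup _ => [(0, .cup)]
  | .cap _ => [(0, .cap)]
  | .cross _ _ => [(0, .cross)]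
  | .node b => [(0, .cup), (1, .cup), (2, .rung b true), (2, .cross)]

/-- The matched diagram of a link diagram. -/
def resolve (w : linkKind.Word) : Ladder := w.flatMap fun s => (resolvePiece s.2).shift s.1

/-- The underlying undirected drawing of the matched diagram of a link diagram. -/
def toGraphene (w : linkKind.Word) : matchedKind.Word := (resolve w).toMatched

lemma toGraphene_cons (s : ℕ × linkKind.Piece) (w : linkKind.Word) :
    toGraphene (s :: w) = shift s.1 (resolvePiece s.2).toMatched ++ toGraphene w := by
  change Ladder.toMatched (_ ++ resolve w) = _
  rw [Ladder.toMatched_append, Ladder.toMatched_shift]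
  rfl

lemma toGraphene_append (u v : linkKind.Word) :
    toGraphene (u ++ v) = toGraphene u ++ toGraphene v := by
  rw [toGraphene, resolve, List.flatMap_append, Ladder.toMatched_append]
  rfl

lemma toGraphene_shift (k : ℕ) (w : linkKind.Word) :
    toGraphene (shift k w) = shift k (toGraphene w) := by
  induction w with
  | nil => rfl
  | cons s w ih =>
    rw [shift_cons, toGraphene_cons, toGraphene_cons, ih, shift_append, shift_shift]

/-- Unmatched strands in the place of the strands of a link diagram. -/
abbrev unmatched (a : List linkKind.Color) : List matchedKind.Color :=
  a.map fun _ => EdgeColor.unmatched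

lemma runs_resolvePiece (e : linkKind.Piece) :
    Runs (unmatched e.src) (resolvePiece e).toMatched (unmatched e.tgt) := by
  rcases e with c | c | ⟨c, d⟩ | b
  · exact runs_of_runList (by cases c; decide +kernel)
  · exact runs_of_runList (by cases c; decide +kernel)
  · exact runs_of_runList (by cases c; cases d; decide +kernel)
  · refine runs_of_runList ?_
    revert b
    decide +kernel

lemma runs_node {S : DrawingKind} (g : S.Node) : Runs [] [(0, .node g)] (S.legs g) := by
  simpa [front, frontLegs] using runs_front [g] []

lemma runs_toGraphene {a b : List linkKind.Color} {w : linkKind.Word} (h : Runs a w b) :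
    Runs (unmatched a) (toGraphene w) (unmatched b) := by
  induction w generalizing a with
  | nil => cases h; rfl
  | cons s w ih =>
    obtain ⟨_, ⟨x, y, hx, rfl, rfl⟩, h⟩ := h
    rw [toGraphene_cons]
    refine Runs.append (b := unmatched (x ++ s.2.tgt ++ y)) ?_ (ih h)
    have h1 := runs_resolvePiece s.2
    simpa [hx, Nat.add_assoc] using h1.whisker (unmatched x) (unmatched y)

/-- A quarter turn of a trivalent vertex, expressed by the vertex whose legs are counted from the
last one. -/
def turnVertex (g : MatchedVertex) : matchedKind.Word :=
  [(0, .cup (MatchedVertex.leg { g with pos := g.pos + 1 } 0)), (1, .node { g with pos := g.pos + 1 }),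
    (0, .cap (MatchedVertex.leg { g with pos := g.pos + 1 } 0))]

lemma Eqv.turnVertex (g : MatchedVertex) :
    Eqv GrapheneMove [] (matchedKind.legs g) [(0, .node g)] (_root_.turnVertex g) := by
  obtain ⟨a, ε, i⟩ := g
  have h := PlanarIsotopy.rotate (S := matchedKind) ⟨a, ε, i + 1⟩ _ _ rfl
  have h1 : matchedKind.rot ⟨a, ε, i + 1⟩ = ⟨a, ε, i⟩ := by simp [matchedKind]
  rw [h1] at h
  refine .move (.inl h) (runs_node (S := matchedKind) _) (runs_of_runList ?_)
  clear h h1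
  revert a ε i
  decide +kernel

/-- A hollow vertex expressed by a solid one. -/
def untwistVertex (g : MatchedVertex) : matchedKind.Word :=
  if g.solid then [(0, .node g)] else
    [(0, .node ⟨true, g.sign, Equiv.swap 0 1 g.pos⟩),
         (0, .cross (MatchedVertex.leg ⟨true, g.sign, Equiv.swap 0 1 g.pos⟩ 0)
           (MatchedVertex.leg ⟨true, g.sign, Equiv.swap 0 1 g.pos⟩ 1))]

lemma Eqv.untwistVertex (g : MatchedVertex) :
    Eqv GrapheneMove [] (matchedKind.legs g) [(0, .node g)] (_root_.untwistVertex g) := by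
  obtain ⟨a, ε, i⟩ := g
  have h := runs_node (S := matchedKind) ⟨a, ε, i⟩
  cases a
  · refine .move (.inr (.inr (.inl (.m5 ε i)))) h (runs_of_runList ?_)
    clear h
    revert ε i
    decide +kernel
  · exact .refl h

/-- Unmatched strands. -/
abbrev uu : List matchedKind.Color := [.unmatched, .unmatched]

lemma runs_rung (ε a b : Bool) : Runs uu (rung ε a b) uu :=
  runs_of_runList (by revert ε a b; decide +kernel)

/-- The vertices of a matched edge, drawn from right to left. -/
lemma Eqv.swapRung (ε a b : Bool) :
    Eqv GrapheneMove [] (matchedKind.legs ⟨b, ε, 1⟩ ++ matchedKind.legs ⟨a, ε, 2⟩)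
      (front [⟨a, ε, 2⟩, ⟨b, ε, 1⟩]) [(0, .node ⟨b, ε, 1⟩), (3, .node ⟨a, ε, 2⟩)] :=
  Eqv.swapNodes (S := matchedKind) ⟨a, ε, 2⟩ ⟨b, ε, 1⟩

lemma forall_turnVertex (n : ℕ) : ∀ f ∈ List.replicate n turnVertex, ∀ g : matchedKind.Node,
    Eqv GrapheneMove [] (matchedKind.legs g) [(0, .node g)] (f g) := by
  intro f hf g
  rw [(List.mem_replicate.1 hf).2]
  exact Eqv.turnVertex g

lemma forall_untwistVertex (n : ℕ) : ∀ f ∈ List.replicate n untwistVertex, ∀ g : matchedKind.Node,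
    Eqv GrapheneMove [] (matchedKind.legs g) [(0, .node g)] (f g) := by
  intro f hf g
  rw [(List.mem_replicate.1 hf).2]
  exact Eqv.untwistVertex g

/-- A matched edge can be slid along an intersection of its two strands. -/
lemma Eqv.rung_cross (ε : Bool) :
    Eqv GrapheneMove uu uu (rung ε true true ++ [(0, .cross .unmatched .unmatched)])
      ((0, .cross .unmatched .unmatched) :: rung ε true true) := by
  have hX : Runs uu [(0, .cross .unmatched .unmatched)] uu := runs_of_runList rfl
  -- Both vertices become hollow by `G4`, and twisting them back turns the matched edge over.
  have h1 : Eqv GrapheneMove uu uu (rung ε true true) (rung ε false false) :=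
    .move (.inr (.inr (.inr (.g4 ε true true)))) (runs_rung _ _ _) (runs_rung _ _ _)
  refine (h1.right hX).trans ?_
  have h2 := (Eqv.swapRung ε false false)
  have h3 := h2.trans (Eqv.substNodes (forall_untwistVertex 2) h2.runs.2)
  have h4 := h3.trans (Eqv.substNodes (forall_turnVertex 2) h3.runs.2)
  have h5 := h4.trans (Eqv.substNodes (forall_turnVertex 2) h4.runs.2)
  refine .of_nf_front h5 ?_
  clear h1 h2 h3 h4 h5 hX
  revert ε
  decide +kernel

/-! ### The moves of link diagrams on matched diagrams -/

/-- An intersection of two unmatched strands. -/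
abbrev crossU : matchedKind.Word := [(0, .cross .unmatched .unmatched)]

abbrev uuu : List matchedKind.Color := [.unmatched, .unmatched, .unmatched]
abbrev uuuu : List matchedKind.Color := [.unmatched, .unmatched, .unmatched, .unmatched]

lemma runs_crossU : Runs uu crossU uu := runs_of_runList rfl

lemma Eqv.toGraphene_crossing (b : Bool) :
    Eqv GrapheneMove uu uu (toGraphene (classicalCrossing b)) (rung b true true ++ crossU) :=
  .of_nf (by revert b; decide +kernel)

/-- A quarter turn exchanges the crossings `b` and `!b`. It does not change the sign of the matched
edge, but it twists one of its vertices; this is the effect of the move `G5`. -/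
lemma Eqv.toGraphene_rotate (b : Bool) :
    Eqv GrapheneMove [] uuuu (toGraphene [(0, .node (!b))])
      (toGraphene [(0, .cup ()), (1, .node b), (0, .cap ())]) := by
  have h : Eqv GrapheneMove uu uu (rung b true false) (rung (!b) true true) :=
    .move (.inr (.inr (.inr (.g5 b)))) (runs_rung _ _ _) (runs_rung _ _ _)
  have h1 := h.replace (p := [(0, .cup .unmatched), (1, .cup .unmatched)])
    (q := [(2, .cross .unmatched .unmatched)]) (k := 2) (A' := []) (B' := uuuu) uu [] rfl
    (runs_of_runList rfl) (runs_of_runList rfl) rfl rfl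
  refine h1.symm.trans ?_
  have h2 := (Eqv.swapRung b true false)
  have h3 := h2.trans (Eqv.substNodes (forall_untwistVertex 2) h2.runs.2)
  have h4 := h3.trans (Eqv.substNodes (forall_turnVertex 2) h3.runs.2)
  have h5 := h4.trans (Eqv.substNodes (forall_turnVertex 2) h4.runs.2)
  refine .of_nf_front h5 ?_
  clear h h1 h2 h3 h4 h5
  revert b
  decide +kernel

lemma Eqv.toGraphene_r1 (b : Bool) :
    Eqv GrapheneMove [] uu (toGraphene ((0, .cup ()) :: classicalCrossing b))
      (toGraphene [(0, .cup ())]) := by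
  have h1 : Eqv GrapheneMove [] uu ((0, .cup .unmatched) :: rung b true true) [(0, .cup .unmatched)] :=
    .move (.inr (.inr (.inr (.g1 b)))) (runs_of_runList (by revert b; decide +kernel))
      (runs_of_runList rfl)
  refine Eqv.trans ?_ ((h1.right runs_crossU).trans (Eqv.kink (S := matchedKind) EdgeColor.unmatched))
  clear h1
  exact .of_nf (by revert b; decide +kernel)

lemma Eqv.crossU_crossU : Eqv GrapheneMove uu uu (crossU ++ crossU) [] := Eqv.bigon _ _

lemma Eqv.toGraphene_r2 (b : Bool) :
    Eqv GrapheneMove uu uu (toGraphene (classicalCrossing b ++ classicalCrossing (!b))) [] := by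
  have hr : ∀ ε, Runs uu (rung ε true true) uu := fun ε => runs_rung _ _ _
  have h1 := (Eqv.toGraphene_crossing b).comp (Eqv.toGraphene_crossing !b)
  have h2 := (((Eqv.rung_cross (!b)).symm.right runs_crossU).left (hr b))
  have h3 := Eqv.crossU_crossU.left ((hr b).append (hr !b))
  have h4 : Eqv GrapheneMove uu uu (rung b true true ++ rung (!b) true true) [] :=
    .move (.inr (.inr (.inr (.g2 b)))) ((hr b).append (hr !b)) rfl
  rw [toGraphene_append]
  refine h1.trans (Eqv.trans (by simpa using h2) (Eqv.trans (by simpa using h3) h4))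

lemma Eqv.toGraphene_z (b : Bool) :
    Eqv GrapheneMove uu uu (toGraphene (classicalCrossing b ++ virtualCrossing))
      (toGraphene (virtualCrossing ++ classicalCrossing b)) := by
  rw [toGraphene_append, toGraphene_append]
  refine ((Eqv.toGraphene_crossing b).right runs_crossU).trans
    (Eqv.trans ?_ ((Eqv.toGraphene_crossing b).left runs_crossU).symm)
  simpa using (Eqv.rung_cross b).right runs_crossU

lemma Eqv.toGraphene_r3 (b : Bool) :
    Eqv GrapheneMove uuu uuu
      (toGraphene (classicalCrossing b ++ shift 1 (classicalCrossing b) ++ classicalCrossing b))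
      (toGraphene (shift 1 (classicalCrossing b) ++ classicalCrossing b ++
        shift 1 (classicalCrossing b))) := by
  have h1 : Eqv GrapheneMove uuu uuu _ _ := .move (.inr (.inr (.inr (.g3 b))))
    (runs_of_runList (by revert b; decide +kernel)) (runs_of_runList (by revert b; decide +kernel))
  -- The intersections which follow the matched edges are collected below the hexagon.
  have h2 := h1.right (v := crossU ++ shift 1 crossU ++ crossU) (c := uuu) (runs_of_runList rfl)
  refine Eqv.trans ?_ (h2.trans ?_)
  · clear h1 h2
    exact .of_nf (by revert b; decide +kernel)
  · clear h1 h2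
    exact .of_nf (by revert b; decide +kernel)

lemma Eqv.toGraphene_pass (b : Bool) (n : Fin 5) :
    Eqv GrapheneMove [.unmatched] (uuuu ++ [.unmatched])
      (toGraphene ((1, .node b) :: passRight () 0 (List.replicate n ())))
      (toGraphene ((0, .node b) :: passLeft () n (List.replicate (4 - n) ()))) :=
  .of_nf (by revert b n; decide +kernel)

/-- The moves `LinkMove` together with their boundaries. -/
inductive LinkLocalMove :
    List linkKind.Color → List linkKind.Color → linkKind.Word → linkKind.Word → Prop
  | r1 (b : Bool) : LinkLocalMove [] [(), ()] ((0, .cup ()) :: classicalCrossing b) [(0, .cup ())]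
  | r2 (b : Bool) : LinkLocalMove [(), ()] [(), ()]
      (classicalCrossing b ++ classicalCrossing (!b)) []
  | r3 (b : Bool) : LinkLocalMove [(), (), ()] [(), (), ()]
        (classicalCrossing b ++ shift 1 (classicalCrossing b) ++ classicalCrossing b)
        (shift 1 (classicalCrossing b) ++ classicalCrossing b ++ shift 1 (classicalCrossing b))
  | z (b : Bool) : LinkLocalMove [(), ()] [(), ()] (classicalCrossing b ++ virtualCrossing)
      (virtualCrossing ++ classicalCrossing b)

lemma linkLocalMove_isBoundary : IsBoundary LinkMove LinkLocalMove where
  runs h := by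
    cases h with | _ b => exact ⟨runs_of_runList (by cases b <;> decide +kernel),
      runs_of_runList (by cases b <;> decide +kernel)⟩
  exists_boundary {u v A B} h hu := by
    have key : ∀ n, n ≤ A.length → ∃ y, A = List.replicate n () ++ y := fun n hn =>
      ⟨A.drop n, List.ext_getElem (by simp; omega) (fun _ _ _ => rfl)⟩
    have hlen : ∀ {b : Bool} {w : linkKind.Word} {A : List linkKind.Color},
        Runs A (classicalCrossing b ++ w) B → 2 ≤ A.length := by
      intro b w A h
      rcases A with _ | ⟨c₁, _ | ⟨c₂, A⟩⟩
      · simp [classicalCrossing, runs_cons] at h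
      · simp [classicalCrossing, runs_cons] at h
      · simp
    rcases h with h | h
    · cases h with
      | r1 b => exact ⟨_, _, A, rfl, .r1 b⟩
      | r2 b =>
        obtain ⟨y, rfl⟩ := key 2 (hlen hu)
        exact ⟨_, _, y, rfl, .r2 b⟩
      | r3 b =>
        have : 3 ≤ A.length := by
          rw [List.append_assoc] at hu
          have := hlen hu
          rcases A with _ | ⟨c₁, _ | ⟨c₂, _ | ⟨c₃, A⟩⟩⟩
          · simp at this
          · simp at this
          · simp [classicalCrossing, runs_cons, Piece.src, Piece.tgt] at hu
          · simp
        obtain ⟨y, rfl⟩ := key 3 this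
        exact ⟨_, _, y, rfl, .r3 b⟩
    · cases h with
      | z b =>
        obtain ⟨y, rfl⟩ := key 2 (hlen hu)
        exact ⟨_, _, y, rfl, .z b⟩
  ne_nil h := by
    rcases h with h | h <;> cases h <;> simp [classicalCrossing]

/-- The moves of `Z`-virtual links, applied to the matched diagrams of link diagrams, are
consequences of the moves of `Z`-graphenes. -/
lemma LocalMove.toGraphene {a b : List linkKind.Color} {u v : linkKind.Word}
    (h : LocalMove LinkLocalMove a b u v) :
    Eqv GrapheneMove (unmatched a) (unmatched b) (toGraphene u) (toGraphene v) := by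
  have cast : ∀ {a b a' b'} {u v : matchedKind.Word}, Eqv GrapheneMove a b u v →
      Runs a' u b' → a = a' → Eqv GrapheneMove a' b' u v := by
    intro a b a' b' u v h h1 h2
    subst h2
    cases h.runs.1.det h1
    exact h
  have hr := runs_toGraphene (h.runs linkLocalMove_isBoundary).1
  cases h with
  | exchange e e' z =>
    have h1 : ∀ e : linkKind.Piece, Runs (unmatched e.src) (_root_.toGraphene [(0, e)]) (unmatched e.tgt) :=
      fun e => runs_toGraphene (runs_singleton.2 ⟨[], [], rfl, by simp, by simp⟩)
    have h2 := (h1 e').whisker (unmatched z) []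
    have h3 := Eqv.interchange (Q := GrapheneMove) (h1 e) h2
    have h4 : ∀ k e, _root_.toGraphene [(k, e)] = shift k (_root_.toGraphene [(0, e)]) := by
      intro k e
      rw [← toGraphene_shift]; rfl
    have h5 : _root_.toGraphene [(0, e), (e.tgt.length + z.length, e')] = _root_.toGraphene [(0, e)] ++
        shift (unmatched e.tgt).length (shift (unmatched z).length (_root_.toGraphene [(0, e')])) := by
      rw [shift_shift, ← List.singleton_append, toGraphene_append, h4 (_ + _)]
      simp
    have h6 : _root_.toGraphene [(e.src.length + z.length, e'), (0, e)] =
        shift (unmatched e.src).length (shift (unmatched z).length (_root_.toGraphene [(0, e')])) ++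
        _root_.toGraphene [(0, e)] := by
      rw [shift_shift, ← List.singleton_append, toGraphene_append, h4 (_ + _)]
      simp
    rw [h5, h6]
    rw [h5] at hr
    exact cast h3 hr (by simp)
  | zigzag c => exact Eqv.zigzag _
  | zagzig c => exact Eqv.zagzig _
  | slideCup c d => exact Eqv.slideCup _ _
  | slideCap c d => exact Eqv.slideCap _ _
  | rotate b c l h => exact cast (Eqv.toGraphene_rotate b) hr rfl
  | kink c => exact Eqv.kink _
  | bigon c d => exact Eqv.bigon _ _
  | triangle c d e => exact Eqv.triangle _ _ _
  | pass c b l₁ l₂ h =>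
    have hn : l₁.length + l₂.length = 4 := by simpa using (congrArg List.length h).symm
    have h1 : l₁ = List.replicate l₁.length () := List.ext_getElem (by simp) (fun _ _ _ => rfl)
    have h2 : l₂ = List.replicate (4 - l₁.length) () :=
      List.ext_getElem (by simp; omega) (fun _ _ _ => rfl)
    have := Eqv.toGraphene_pass b ⟨l₁.length, by omega⟩
    simp only [← h1, ← h2] at this
    exact cast this hr rfl
  | special h =>
    cases h with
    | r1 b => exact Eqv.toGraphene_r1 b
    | r2 b => exact Eqv.toGraphene_r2 b
    | r3 b => exact Eqv.toGraphene_r3 b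
    | z b => exact Eqv.toGraphene_z b

/-- Equivalent link diagrams have equivalent matched diagrams. -/
theorem Eqv.toGraphene {a b : List linkKind.Color} {u v : linkKind.Word}
    (h : Eqv LinkMove a b u v) :
    Eqv GrapheneMove (unmatched a) (unmatched b) (_root_.toGraphene u) (_root_.toGraphene v) := by
  induction h with
  | refl h => exact .refl (runs_toGraphene h)
  | step h hu hv =>
    obtain ⟨p, q, u, v, x, y, a', b', h1, hp, hq, rfl, rfl⟩ :=
      Rewrite.exists_context linkLocalMove_isBoundary h hu hv
    have h2 := (LocalMove.toGraphene h1).replace (unmatched x) (unmatched y) (k := x.length)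
      (by simp) (runs_toGraphene hp) (runs_toGraphene hq)
      (by simp [Nat.add_assoc]) (by simp [Nat.add_assoc])
    simpa only [toGraphene_append, toGraphene_shift, List.append_assoc] using h2
  | symm _ ih => exact ih.symm
  | trans _ _ ih ih' => exact ih.trans ih'

/-- A link diagram is recovered from its matched diagram by the replacement, since the additional
virtual crossings cancel each other. -/
lemma Eqv.toLink_resolve {a b : List linkKind.Color} {w : linkKind.Word} (h : Runs a w b) :
    Eqv LinkMove a b (resolve w).toLink w := by
  induction w generalizing a with
  | nil => exact .refl h
  | cons s w ih =>
    obtain ⟨_, ⟨x, y, hx, rfl, rfl⟩, h⟩ := h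
    have h1 : Eqv LinkMove s.2.src s.2.tgt (resolvePiece s.2).toLink [(0, s.2)] := by
      obtain ⟨k, e⟩ := s
      clear hx h ih
      change Eqv _ e.src e.tgt (resolvePiece e).toLink [(0, e)]
      rcases e with c | c | ⟨c, d⟩ | b
      · exact .refl (runs_of_runList (by cases c; decide +kernel))
      · exact .refl (runs_of_runList (by cases c; decide +kernel))
      · exact .refl (runs_of_runList (by cases c; cases d; decide +kernel))
      · refine .of_nf ?_
        revert b
        decide +kernel
    have h2 := (h1.whisker' x y hx (A := x ++ s.2.src ++ y) rfl rfl).comp (ih h)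
    change Eqv _ _ _ (Ladder.toLink ((resolvePiece s.2).shift s.1 ++ resolve w)) _
    rw [Ladder.toLink_append, Ladder.toLink_shift]
    simpa using h2

/-! ### Labelled drawings as matched diagrams -/

variable {I : Type}

/-- The strands of a matched diagram that replace a strand of a labelled drawing. -/
abbrev XColor.matchedStrands : XColor I → List matchedKind.Color
  | .plain => [.unmatched]
  | .edge _ .dn => uu
  | .edge _ .up => uu
  | .edge ε (.inn _) => [.matched ε]

/-- Two parallel unmatched strands merge into a matched edge. -/
def mergeWord (ε : Bool) : matchedKind.Word :=
  [(2, .node ⟨true, ε, 2⟩), (1, .cap .unmatched), (0, .cap .unmatched)]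

/-- A matched edge splits into two parallel unmatched strands. -/
def splitWord (ε : Bool) : matchedKind.Word := [(1, .node ⟨true, ε, 0⟩), (0, .cap (.matched ε))]

/-- The matched diagrams drawn by `matchedInterp`, piece by piece. -/
def matchedWord : XPiece I → matchedKind.Word
  | .cup .plain => [(0, .cup .unmatched)]
  | .cup (.edge ε (.inn _)) => [(0, .cup (.matched ε))]
  | .cup (.edge _ _) => [(0, .cup .unmatched), (1, .cup .unmatched)]
  | .cap .plain => [(0, .cap .unmatched)]
  | .cap (.edge ε (.inn _)) => [(0, .cap (.matched ε))]
  | .cap (.edge _ _) => [(1, .cap .unmatched), (0, .cap .unmatched)]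
  | .cross c d => moveLeft c.matchedStrands d.matchedStrands
  | .node g => toGraphene (junction g.solid g.pos)
  | .mark ε => mergeWord ε ++ splitWord ε
  | .enter ε _ => mergeWord ε
  | .leave ε _ => splitWord ε

lemma runs_mergeWord (ε : Bool) : Runs uu (mergeWord ε) [EdgeColor.matched ε] :=
  runs_of_runList (by cases ε <;> decide +kernel)

lemma runs_splitWord (ε : Bool) : Runs [EdgeColor.matched ε] (splitWord ε) uu :=
  runs_of_runList (by cases ε <;> decide +kernel)

/-- Labelled drawings as matched diagrams: only the inner sections of matched edges are
drawn as matched edges, and the outer sections are replaced by two parallel unmatched strands. -/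
def matchedInterp [Reversal I] : Interp I matchedKind where
  col := XColor.matchedStrands
  word := matchedWord
  runs := by
    rintro (c | c | ⟨c, d⟩ | ⟨a, ε, i⟩ | ε | ⟨ε, i⟩ | ⟨ε, i⟩)
    · rcases c with _ | ⟨ε, _ | _ | i⟩ <;> exact runs_of_runList (by simp [matchedWord, runList, Piece.src, Piece.tgt, XColor.rev, Label.rev])
    · rcases c with _ | ⟨ε, _ | _ | i⟩ <;> exact runs_of_runList (by simp [matchedWord, runList, Piece.src, Piece.tgt, XColor.rev, Label.rev])
    · simpa [matchedWord] using runs_moveLeft c.matchedStrands d.matchedStrands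
    · have h := runs_toGraphene ((linkInterp fun _ : I => true).runs (.node ⟨a, ε, i⟩))
      fin_cases i <;> exact h
    · exact (runs_mergeWord ε).append (runs_splitWord ε)
    · exact runs_mergeWord ε
    · exact runs_splitWord ε

lemma XColor.matchedStrands_eq (d : XColor I) :
    d.matchedStrands = [.unmatched] ∨ d.matchedStrands = uu ∨
      ∃ ε, d.matchedStrands = [EdgeColor.matched ε] := by
  rcases d with _ | ⟨ε, _ | _ | i⟩ <;> simp

lemma Eqv.merge_crossL (ε : Bool) (d : XColor I) :
    Eqv GrapheneMove (uu ++ d.matchedStrands) (d.matchedStrands ++ [EdgeColor.matched ε])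
      (mergeWord ε ++ moveLeft [EdgeColor.matched ε] d.matchedStrands)
      (moveLeft uu d.matchedStrands ++ shift d.matchedStrands.length (mergeWord ε)) := by
  rcases d.matchedStrands_eq with h | h | ⟨ε', h⟩ <;> rw [h]
  · exact .of_nf (by cases ε <;> decide +kernel)
  · exact .of_nf (by cases ε <;> decide +kernel)
  · exact .of_nf (by cases ε <;> cases ε' <;> decide +kernel)

lemma Eqv.merge_crossR (ε : Bool) (d : XColor I) :
    Eqv GrapheneMove (d.matchedStrands ++ uu) ([EdgeColor.matched ε] ++ d.matchedStrands)
      (shift d.matchedStrands.length (mergeWord ε) ++ moveLeft d.matchedStrands [EdgeColor.matched ε])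
      (moveLeft d.matchedStrands uu ++ mergeWord ε) := by
  rcases d.matchedStrands_eq with h | h | ⟨ε', h⟩ <;> rw [h]
  · exact .of_nf (by cases ε <;> decide +kernel)
  · exact .of_nf (by cases ε <;> decide +kernel)
  · exact .of_nf (by cases ε <;> cases ε' <;> decide +kernel)

lemma Eqv.split_crossL (ε : Bool) (d : XColor I) :
    Eqv GrapheneMove ([EdgeColor.matched ε] ++ d.matchedStrands) (d.matchedStrands ++ uu)
      (splitWord ε ++ moveLeft uu d.matchedStrands)
      (moveLeft [EdgeColor.matched ε] d.matchedStrands ++ shift d.matchedStrands.length (splitWord ε)) := by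
  rcases d.matchedStrands_eq with h | h | ⟨ε', h⟩ <;> rw [h]
  · exact .of_nf (by cases ε <;> decide +kernel)
  · exact .of_nf (by cases ε <;> decide +kernel)
  · exact .of_nf (by cases ε <;> cases ε' <;> decide +kernel)

lemma Eqv.split_crossR (ε : Bool) (d : XColor I) :
    Eqv GrapheneMove (d.matchedStrands ++ [EdgeColor.matched ε]) (uu ++ d.matchedStrands)
      (shift d.matchedStrands.length (splitWord ε) ++ moveLeft d.matchedStrands uu)
      (moveLeft d.matchedStrands [EdgeColor.matched ε] ++ splitWord ε) := by
  rcases d.matchedStrands_eq with h | h | ⟨ε', h⟩ <;> rw [h]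
  · exact .of_nf (by cases ε <;> decide +kernel)
  · exact .of_nf (by cases ε <;> decide +kernel)
  · exact .of_nf (by cases ε <;> cases ε' <;> decide +kernel)

lemma Eqv.merge_cap_left (ε : Bool) :
    Eqv GrapheneMove (uu ++ [EdgeColor.matched ε]) [] (mergeWord ε ++ [(0, .cap (.matched ε))])
      (shift 2 (splitWord ε) ++ [(1, .cap .unmatched), (0, .cap .unmatched)]) := by
  cases ε <;> exact .of_nf_subst _ (forall_turnVertex 1) (by decide +kernel)

lemma Eqv.merge_cap_right (ε : Bool) :
    Eqv GrapheneMove ([EdgeColor.matched ε] ++ uu) [] (shift 1 (mergeWord ε) ++ [(0, .cap (.matched ε))])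
      (splitWord ε ++ [(1, .cap .unmatched), (0, .cap .unmatched)]) := by
  cases ε <;> exact .of_nf_subst _ (forall_turnVertex 1) (by decide +kernel)

lemma Eqv.cup_split_left (ε : Bool) :
    Eqv GrapheneMove [] (uu ++ [EdgeColor.matched ε]) ((0, .cup (.matched ε)) :: splitWord ε)
      ([(0, .cup .unmatched), (1, .cup .unmatched)] ++ shift 2 (mergeWord ε)) := by
  cases ε <;> exact (Eqv.of_nf_subst _ (forall_turnVertex 1) (by decide +kernel)).symm

lemma Eqv.cup_split_right (ε : Bool) :
    Eqv GrapheneMove [] ([EdgeColor.matched ε] ++ uu) ((0, .cup (.matched ε)) :: shift 1 (splitWord ε))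
      ([(0, .cup .unmatched), (1, .cup .unmatched)] ++ mergeWord ε) := by
  cases ε <;> exact (Eqv.of_nf_subst _ (forall_turnVertex 1) (by decide +kernel)).symm

theorem matchedInterp_lawful [Reversal I] : (matchedInterp (I := I)).Lawful GrapheneMove where
  crossL d h := by
    cases h with
    | enter ε i => simpa [Interp.width, matchedInterp, matchedWord] using Eqv.merge_crossL ε d
    | leave ε i => simpa [Interp.width, matchedInterp, matchedWord] using Eqv.split_crossL ε d
  crossR d h := by
    cases h with
    | enter ε i => simpa [Interp.width, matchedInterp, matchedWord] using Eqv.merge_crossR ε d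
    | leave ε i => simpa [Interp.width, matchedInterp, matchedWord] using Eqv.split_crossR ε d
  capL ε i := by simpa [Interp.width, matchedInterp, matchedWord] using Eqv.merge_cap_left ε
  capR ε i := by simpa [Interp.width, matchedInterp, matchedWord] using Eqv.merge_cap_right ε
  cupL ε i := by simpa [Interp.width, matchedInterp, matchedWord] using Eqv.cup_split_left ε
  cupR ε i := by simpa [Interp.width, matchedInterp, matchedWord] using Eqv.cup_split_right ε
  merge ε i := by
    simpa [Interp.width, matchedInterp, matchedWord] using
      Eqv.refl (Q := GrapheneMove) ((runs_mergeWord ε).append (runs_splitWord ε))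

lemma Eqv.toGraphene_tee (ε : Bool) :
    Eqv GrapheneMove uu uu (_root_.toGraphene (tee ε)) (mergeWord ε ++ splitWord ε) := by
  have h : ∀ f ∈ [(fun g => [(0, .node g)]), _root_.turnVertex], ∀ g : matchedKind.Node,
      Eqv GrapheneMove [] (matchedKind.legs g) [(0, .node g)] (f g) := by
    intro f hf g
    rcases List.mem_cons.1 hf with rfl | hf
    · exact .refl (runs_node g)
    · cases List.mem_singleton.1 hf
      exact Eqv.turnVertex g
  refine (Eqv.of_nf_subst _ h ?_).symm
  clear h
  cases ε <;> decide +kernel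

/-! ### Markings -/

instance : Reversal Empty where
  rev i := i
  rev_rev _ := rfl

/-- A marking of a matched drawing: every strand of a matched edge gets a label `dn` or
`up`, and the label changes from `dn` to `up` at a mark. -/
abbrev Marking := XWord Empty

/-- The link diagram of a marking: each matched edge is replaced by two parallel strands
which meet in a classical and a virtual crossing at the mark. -/
abbrev markedLink : Interp Empty linkKind := linkInterp Empty.elim

lemma matchedStrands_eq_unmatched (c : XColor Empty) : c.matchedStrands = unmatched c.strands := by
  rcases c with _ | ⟨ε, _ | _ | i⟩
  · rfl
  · rfl
  · rfl
  · exact i.elim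

lemma toGraphene_passLeft (k : ℕ) (l : List linkKind.Color) :
    toGraphene (passLeft () k l) = passLeft EdgeColor.unmatched k (unmatched l) := by
  induction l generalizing k with
  | nil => rfl
  | cons c l ih =>
    simp only [passLeft, toGraphene_append, ih]
    rfl

lemma toGraphene_moveLeft (l x : List linkKind.Color) :
    toGraphene (moveLeft l x) = moveLeft (unmatched l) (unmatched x) := by
  induction x with
  | nil => rfl
  | cons c x ih =>
    cases c
    simp only [moveLeft, toGraphene_append, toGraphene_shift, ih, toGraphene_passLeft, unmatched,
      List.map_cons]

lemma Eqv.toGraphene_linkWord (e : XPiece Empty) :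
    Eqv GrapheneMove (unmatched (e.src.flatMap XColor.strands))
      (unmatched (e.tgt.flatMap XColor.strands))
      (_root_.toGraphene (linkWord Empty.elim e)) (matchedWord e) := by
  have hr := runs_toGraphene (markedLink.runs e)
  rcases e with (_ | ⟨ε, _ | _ | i⟩) | (_ | ⟨ε, _ | _ | i⟩) | ⟨c, d⟩ | ⟨a, ε, i⟩ | ε | ⟨ε, i⟩ | ⟨ε, i⟩
  · exact .refl hr
  · exact .refl hr
  · exact .refl hr
  · exact i.elim
  · exact .refl hr
  · exact .refl hr
  · exact .refl hr
  · exact i.elim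
  · simp only [linkWord, matchedWord, toGraphene_moveLeft, matchedStrands_eq_unmatched]
    refine .refl ?_
    rw [← toGraphene_moveLeft]
    exact hr
  · exact .refl hr
  · exact Eqv.toGraphene_tee ε
  · exact i.elim
  · exact i.elim

lemma flatMap_matchedStrands (x : List (XColor Empty)) :
    x.flatMap XColor.matchedStrands = unmatched (x.flatMap XColor.strands) := by
  simp only [unmatched, List.map_flatMap]
  congr 1
  funext c
  exact matchedStrands_eq_unmatched c

/-- The matched diagram of the link diagram of a marking is the one where the matched edges have
shrunk to the marks. -/
lemma Eqv.toGraphene_markedLink {a b : List (XColor Empty)} {W : Marking} (h : XRuns a W b) :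
    Eqv GrapheneMove (a.flatMap XColor.matchedStrands) (b.flatMap XColor.matchedStrands)
      (_root_.toGraphene (markedLink.map W)) (matchedInterp.map W) := by
  induction W generalizing a with
  | nil =>
    cases h
    exact .refl rfl
  | cons s W ih =>
    obtain ⟨y, rfl, h⟩ := h
    have h1 := (Eqv.toGraphene_linkWord s.2).whisker' (s.1.flatMap XColor.matchedStrands)
      (y.flatMap XColor.matchedStrands) (k := matchedInterp.width s.1) rfl
      (A := (s.1 ++ s.2.src ++ y).flatMap XColor.matchedStrands)
      (B := (s.1 ++ s.2.tgt ++ y).flatMap XColor.matchedStrands)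
      (by rw [← flatMap_matchedStrands]; simp) (by rw [← flatMap_matchedStrands]; simp)
    have h2 : markedLink.width s.1 = matchedInterp.width s.1 := by
      change (s.1.flatMap XColor.strands).length = (s.1.flatMap XColor.matchedStrands).length
      rw [flatMap_matchedStrands, List.length_map]
    rw [Interp.map_cons, toGraphene_append, toGraphene_shift, h2]
    exact h1.comp (ih h)

variable {I : Type}

/-- The underlying edge of a strand of a labelled drawing. -/
def XColor.forget : XColor I → matchedKind.Color
  | .plain => .unmatched
  | .edge ε _ => .matched ε

@[simp] lemma XColor.forget_plain : (plain : XColor I).forget = .unmatched := rfl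

@[simp] lemma XColor.forget_edge (ε : Bool) (l : Label I) : (edge ε l).forget = .matched ε := rfl

/-- The underlying matched drawing of a piece. -/
def XPiece.forget : XPiece I → matchedKind.Word
  | .cup c => [(0, .cup c.forget)]
  | .cap c => [(0, .cap c.forget)]
  | .cross c d => [(0, .cross c.forget d.forget)]
  | .node g => [(0, .node g)]
  | _ => []

/-- The underlying matched drawing of a labelled drawing. -/
def forgetInterp [Reversal I] : Interp I matchedKind where
  col c := [c.forget]
  word := XPiece.forget
  runs e := by
    have h : ∀ c : XColor I, c.rev.forget = c.forget := by rintro (_ | _) <;> rfl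
    have h' : ∀ c : EdgeColor, (XColor.leg c : XColor I).forget = c := by rintro (_ | _) <;> rfl
    cases e with
    | node g => simp [XPiece.forget, XPiece.tgt_node, runs_cons, Piece.src, Piece.tgt, h']
    | _ => simp [XPiece.forget, runs_cons, Piece.src, Piece.tgt, h]

lemma forgetInterp_width [Reversal I] (x : List (XColor I)) : forgetInterp.width x = x.length := by
  simp [Interp.width, forgetInterp]

lemma Slide.forget [Reversal I] {a b : List (XColor I)} {l r : XWord I} (h : Slide a b l r) :
    forgetInterp.map l = forgetInterp.map r := by
  have hs : ∀ e : XPiece I, e.IsSlider →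
      forgetInterp.word e = [] ∧ e.src.length = 1 ∧ e.tgt.length = 1 := by
    intro e he
    cases e <;> simp only [XPiece.IsSlider] at he <;> exact ⟨rfl, rfl, rfl⟩
  cases h with
  | exch z e e' h =>
    rcases h with h | h <;> obtain ⟨h1, h2, h3⟩ := hs _ h <;>
      simp [forgetInterp_width, h1, h2, h3]
  | crossL d h => cases h <;> rfl
  | crossR d h => cases h <;> rfl
  | _ => rfl

/-- The inner section of a matched edge. -/
def innerColor : EdgeColor → XColor Unit
  | .unmatched => .plain
  | .matched ε => .edge ε (.inn ())

instance : Reversal Unit where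
  rev i := i
  rev_rev _ := rfl

/-- Close to a vertex, a matched edge that begins there may be drawn as an edge whose inner section
begins after a short outer section. -/
lemma Eqv.merge_node (g : MatchedVertex) :
    Eqv GrapheneMove [] (matchedKind.legs g)
      (_root_.toGraphene (junction g.solid g.pos) ++ shift g.pos (mergeWord g.sign))
      [(0, .node g)] := by
  obtain ⟨a, ε, i⟩ := g
  have h1 := Eqv.untwistVertex ⟨a, ε, i⟩
  have h2 := h1.trans (Eqv.substNodes (forall_turnVertex 1) h1.runs.2)
  have h3 := h2.trans (Eqv.substNodes (forall_turnVertex 1) h2.runs.2)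
  fin_cases i <;> cases a
  · exact Eqv.symm (h2.trans (.of_nf (by clear h1 h2 h3; cases ε <;> decide +kernel)))
  · exact Eqv.symm (h3.trans (.of_nf (by clear h1 h2 h3; cases ε <;> decide +kernel)))
  · exact Eqv.symm (h3.trans (.of_nf (by clear h1 h2 h3; cases ε <;> decide +kernel)))
  · exact Eqv.symm (h2.trans (.of_nf (by clear h1 h2 h3; cases ε <;> decide +kernel)))
  · exact Eqv.symm (h1.trans (.of_nf (by clear h1 h2 h3; cases ε <;> decide +kernel)))
  · exact Eqv.symm (h1.trans (.of_nf (by clear h1 h2 h3; cases ε <;> decide +kernel)))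

lemma exists_inner_piece (e : matchedKind.Piece) :
    ∃ X : XWord Unit, XRuns (e.src.map innerColor) X (e.tgt.map innerColor) ∧
      forgetInterp.map X = [(0, e)] ∧ Eqv GrapheneMove e.src e.tgt (matchedInterp.map X) [(0, e)] := by
  have hr : Runs e.src [(0, e)] e.tgt := runs_singleton.2 ⟨[], [], rfl, by simp, by simp⟩
  have hrev : ∀ c : EdgeColor, (innerColor c).rev = innerColor c := by rintro (_ | _) <;> rfl
  have hf : ∀ c : EdgeColor, (innerColor c).forget = c := by rintro (_ | _) <;> rfl
  cases e with
  | cup c =>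
    refine ⟨[([], .cup (innerColor c))], ?_, ?_, ?_⟩
    · simp [XRuns, hrev, Piece.src, Piece.tgt]
    · simp [Interp.width, forgetInterp, XPiece.forget, hf]
    · cases c <;> exact .refl hr
  | cap c =>
    refine ⟨[([], .cap (innerColor c))], ?_, ?_, ?_⟩
    · simp [XRuns, hrev, Piece.src, Piece.tgt]
    · simp [Interp.width, forgetInterp, XPiece.forget, hf]
    · cases c <;> exact .refl hr
  | cross c d =>
    refine ⟨[([], .cross (innerColor c) (innerColor d))], ?_, ?_, ?_⟩
    · simp [XRuns, Piece.src, Piece.tgt]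
    · simp [Interp.width, forgetInterp, XPiece.forget, hf]
    · cases c <;> cases d <;> exact .refl hr
  | node g =>
    obtain ⟨a, ε, i⟩ := g
    refine ⟨[([], .node ⟨a, ε, i⟩),
      (((matchedKind.legs ⟨a, ε, i⟩).take i).map innerColor, .enter ε ())], ?_, ?_, ?_⟩
    · fin_cases i <;>
        exact ⟨[], rfl, _, rfl, rfl⟩
    · rfl
    · have := Eqv.merge_node ⟨a, ε, i⟩
      fin_cases i <;>
        simpa [Interp.width, matchedInterp, matchedWord, innerColor, MatchedVertex.leg, Piece.src,
          Piece.tgt] using this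

/-- Every matched drawing can be labelled with an inner section on each matched edge which
ends close to the vertices at the upper ends of the edge. -/
lemma exists_inner {a b : List matchedKind.Color} {w : matchedKind.Word} (h : Runs a w b) :
    ∃ X : XWord Unit, XRuns (a.map innerColor) X (b.map innerColor) ∧
      forgetInterp.map X = w ∧ Eqv GrapheneMove a b (matchedInterp.map X) w := by
  induction w generalizing a with
  | nil =>
    cases h
    exact ⟨[], rfl, rfl, .refl rfl⟩
  | cons s w ih =>
    obtain ⟨_, ⟨x, y, hx, rfl, rfl⟩, h⟩ := h
    obtain ⟨X, h1, h2, h3⟩ := ih h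
    obtain ⟨X₀, h4, h5, h6⟩ := exists_inner_piece s.2
    have hw : ∀ x : List matchedKind.Color, (x.map innerColor).flatMap XColor.matchedStrands = x := by
      intro x
      induction x with
      | nil => rfl
      | cons c x ih => cases c <;> simp [innerColor, ih]
    refine ⟨XWord.lift (x.map innerColor) X₀ ++ X, ?_, ?_, ?_⟩
    · exact XRuns.append (by simpa using h4.lift (x.map innerColor) (y.map innerColor)) (by simpa using h1)
    · rw [Interp.map_append, Interp.map_lift, h2, h5, forgetInterp_width]
      simp [hx]
    · rw [Interp.map_append, Interp.map_lift]
      have h7 : matchedInterp.width (x.map innerColor) = s.1 := by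
        simp only [Interp.width, matchedInterp, hw, hx]
      rw [h7]
      have h8 := (h6.whisker' x y hx (A := x ++ s.2.src ++ y) rfl rfl).comp h3
      simpa using h8

/-! ### Closed matched curves -/

/-- A strand of a shaded matched drawing: matched edges may be shaded. -/
inductive Shade where
  | plain
  | edge (sign shaded : Bool)

instance : DecidableEq Shade
  | .plain, .plain => isTrue rfl
  | .plain, .edge _ _ => isFalse (by simp)
  | .edge _ _, .plain => isFalse (by simp)
  | .edge a b, .edge c d => decidable_of_iff (a = c ∧ b = d) (by simp)

namespace Shade

/-- The strand without the shading. -/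
def forget : Shade → EdgeColor
  | plain => .unmatched
  | edge ε _ => .matched ε

/-- A strand that is not shaded. -/
def clear : EdgeColor → Shade
  | .unmatched => plain
  | .matched ε => edge ε false

/-- All shadings of a strand. -/
def all : EdgeColor → List Shade
  | .unmatched => [plain]
  | .matched ε => [edge ε false, edge ε true]

/-- Whether the strand is shaded. -/
def isShaded : Shade → Bool
  | plain => false
  | edge _ b => b

lemma mem_all {s : Shade} {c : EdgeColor} : s ∈ all c ↔ s.forget = c := by
  rcases s with _ | ⟨ε, _ | _⟩ <;> cases c <;> simp [all, forget, eq_comm]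

/-- All shadings of some strands. -/
def allList : List EdgeColor → List (List Shade)
  | [] => [[]]
  | c :: l => (all c).flatMap fun s => (allList l).map fun t => s :: t

lemma mem_allList {a : List Shade} {l : List EdgeColor} : a ∈ allList l ↔ a.map forget = l := by
  induction l generalizing a with
  | nil => simp [allList]
  | cons c l ih => cases a <;> simp [allList, ih, mem_all]

/-- Whether some strand is shaded. -/
def any (a : List Shade) : Bool := a.any isShaded

@[simp] lemma any_append (a b : List Shade) : any (a ++ b) = (any a || any b) := by simp [any]

/-- The shadings below a piece that are compatible with a shading above it. The shading is constant
along the edges, and edges which end at vertices are not shaded. -/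
def next : matchedKind.Piece → List Shade → List (List Shade)
  | .cup c, [] => (all c).map fun s => [s, s]
  | .cap c, [s, t] => if s = t ∧ s.forget = c then [[]] else []
  | .cross c d, [s, t] => if s.forget = c ∧ t.forget = d then [[t, s]] else []
  | .node g, [] => [(matchedKind.legs g).map clear]
  | _, _ => []

/-- The shadings below a drawing that are compatible with a shading `a` above it, together with
the information whether some strand is shaded. -/
def outcomes : List Shade → matchedKind.Word → List (List Shade × Bool)
  | a, [] => [(a, any a)]
  | a, (k, e) :: w =>
    (next e ((a.drop k).take e.src.length)).flatMap fun t =>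
      (outcomes (a.take k ++ t ++ a.drop (k + e.src.length)) w).map fun r => (r.1, any a || r.2)

lemma mem_outcomes_cons {x s y b : List Shade} {e : matchedKind.Piece} {w : matchedKind.Word}
    {f : Bool} (hs : s.length = e.src.length) :
    (b, f) ∈ outcomes (x ++ s ++ y) ((x.length, e) :: w) ↔
      ∃ t ∈ next e s, ∃ f', (b, f') ∈ outcomes (x ++ t ++ y) w ∧
        f = (any x || any s || any y || f') := by
  have h1 : ((x ++ s ++ y).drop x.length).take e.src.length = s := by simp [← hs]
  have h2 : (x ++ s ++ y).take x.length = x := by simp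
  have h3 : (x ++ s ++ y).drop (x.length + e.src.length) = y := by
    rw [← hs, ← List.length_append, List.drop_left]
  simp only [outcomes, h1, h2, h3, List.mem_flatMap, List.mem_map, Prod.mk.injEq, Prod.exists]
  constructor
  · rintro ⟨t, ht, b', f', h, rfl, rfl⟩
    exact ⟨t, ht, f', h, by simp [Bool.or_assoc]⟩
  · rintro ⟨t, ht, f', h, rfl⟩
    exact ⟨t, ht, b, f', h, rfl, by simp [Bool.or_assoc]⟩

lemma mem_outcomes_append {a c : List Shade} {u v : matchedKind.Word} {f : Bool} :
    (c, f) ∈ outcomes a (u ++ v) ↔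
      ∃ b f₁ f₂, (b, f₁) ∈ outcomes a u ∧ (c, f₂) ∈ outcomes b v ∧ f = (f₁ || f₂) := by
  induction u generalizing a f with
  | nil =>
    have : ∀ (a c : List Shade) (w : matchedKind.Word) (f : Bool), (c, f) ∈ outcomes a w → (any a || f) = f := by
      intro a c w f h
      rcases w with _ | ⟨⟨k, e⟩, w⟩
      · simp only [outcomes, List.mem_singleton, Prod.mk.injEq] at h
        simp [h.2]
      · simp only [outcomes, List.mem_flatMap, List.mem_map, Prod.mk.injEq] at h
        obtain ⟨_, _, _, _, _, rfl⟩ := h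
        simp
    simp only [List.nil_append, outcomes, List.mem_singleton, Prod.mk.injEq]
    constructor
    · intro h
      exact ⟨a, any a, f, ⟨rfl, rfl⟩, h, (this _ _ _ _ h).symm⟩
    · rintro ⟨b, f₁, f₂, ⟨rfl, rfl⟩, h, rfl⟩
      rwa [this _ _ _ _ h]
  | cons s u ih =>
    obtain ⟨k, e⟩ := s
    simp only [List.cons_append, outcomes, List.mem_flatMap, List.mem_map, Prod.mk.injEq,
      Prod.exists]
    constructor
    · rintro ⟨t, ht, c', f, h, rfl, rfl⟩
      obtain ⟨b, f₁, f₂, h1, h2, rfl⟩ := ih.1 h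
      exact ⟨b, _, f₂, ⟨t, ht, b, f₁, h1, rfl, rfl⟩, h2, by simp [Bool.or_assoc]⟩
    · rintro ⟨b, f₁, f₂, ⟨t, ht, b', f₃, h1, rfl, rfl⟩, h2, rfl⟩
      exact ⟨t, ht, c, _, ih.2 ⟨b', f₃, f₂, h1, h2, rfl⟩, rfl, by simp [Bool.or_assoc]⟩

lemma length_of_mem_next {e : matchedKind.Piece} {s t : List Shade} (h : t ∈ next e s) :
    t.map forget = e.tgt ∧ s.map forget = e.src := by
  have hc : ∀ c, (clear c).forget = c := by rintro (_ | _) <;> rfl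
  rcases e with c | c | ⟨c, d⟩ | g <;> rcases s with _ | ⟨s₁, _ | ⟨s₂, _ | ⟨s₃, s⟩⟩⟩ <;>
    simp [next] at h
  · obtain ⟨s, h, rfl⟩ := h
    simp [Piece.src, Piece.tgt, mem_all.1 h]
  · obtain ⟨⟨rfl, rfl⟩, rfl⟩ := h
    simp [Piece.src, Piece.tgt]
  · obtain ⟨⟨rfl, rfl⟩, rfl⟩ := h
    simp [Piece.src, Piece.tgt]
  · subst h
    simp [Piece.src, Piece.tgt, hc]

lemma mem_outcomes_shift {α β : List EdgeColor} {w : matchedKind.Word} (h : Runs (S := matchedKind) α w β)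
    {x a y B : List Shade} {f : Bool} (ha : a.map forget = α) :
    (B, f) ∈ outcomes (x ++ a ++ y) (shift x.length w) ↔
      ∃ b f', (b, f') ∈ outcomes a w ∧ B = x ++ b ++ y ∧ f = (any x || any y || f') := by
  induction w generalizing α a f with
  | nil =>
    simp only [shift_nil, outcomes, List.mem_singleton, Prod.mk.injEq]
    constructor
    · rintro ⟨rfl, rfl⟩
      exact ⟨a, any a, ⟨rfl, rfl⟩, rfl, by simp; cases any x <;> cases any a <;> cases any y <;> rfl⟩
    · rintro ⟨b, f', ⟨rfl, rfl⟩, rfl, rfl⟩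
      exact ⟨rfl, by simp; cases any x <;> cases any b <;> cases any y <;> rfl⟩
  | cons s w ih =>
    obtain ⟨k, e⟩ := s
    obtain ⟨_, ⟨u, v, hu, h1, rfl⟩, h⟩ := h
    subst h1
    simp only at hu
    obtain ⟨a', v', rfl, h3, hv⟩ := List.map_eq_append_iff.1 ha
    obtain ⟨u', s, rfl, hu', hs⟩ := List.map_eq_append_iff.1 h3
    have hl : s.length = e.src.length := by simpa using congrArg List.length hs
    have hk : u'.length = k := by rw [← hu, ← hu', List.length_map]
    subst hk
    have e1 : x ++ (u' ++ s ++ v') ++ y = (x ++ u') ++ s ++ (v' ++ y) := by simp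
    rw [shift_cons, e1, ← List.length_append, mem_outcomes_cons hl]
    have key : ∀ t ∈ next e s, ∀ f, ((B, f) ∈ outcomes (x ++ u' ++ t ++ (v' ++ y)) (shift x.length w) ↔
        ∃ b f', (b, f') ∈ outcomes (u' ++ t ++ v') w ∧ B = x ++ b ++ y ∧ f = (any x || any y || f')) := by
      intro t ht f
      have := ih h (a := u' ++ t ++ v') (f := f) (by simp [hu', hv, (length_of_mem_next ht).1])
      simpa using this
    constructor
    · rintro ⟨t, ht, f', h', rfl⟩
      obtain ⟨b, f'', h5, h6, rfl⟩ := (key t ht f').1 h'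
      refine ⟨b, _, (mem_outcomes_cons hl).2 ⟨t, ht, f'', h5, rfl⟩, h6, ?_⟩
      simp only [any_append]
      cases any x <;> cases any u' <;> cases any s <;> cases any v' <;> cases any y <;> simp
    · rintro ⟨b, f', h', h6, rfl⟩
      obtain ⟨t, ht, f'', h5, rfl⟩ := (mem_outcomes_cons hl).1 h'
      refine ⟨t, ht, _, (key t ht _).2 ⟨b, f'', h5, h6, rfl⟩, ?_⟩
      simp only [any_append]
      cases any x <;> cases any u' <;> cases any s <;> cases any v' <;> cases any y <;> simp

end Shade

/-- The moves `GrapheneMove` together with their boundaries. -/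
inductive GrapheneLocalMove :
    List matchedKind.Color → List matchedKind.Color → matchedKind.Word → matchedKind.Word → Prop
  | m5 (ε : Bool) (i : Fin 3) :
      GrapheneLocalMove [] (matchedKind.legs ⟨false, ε, i⟩) [(0, .node ⟨false, ε, i⟩)]
        [(0, .node ⟨true, ε, Equiv.swap 0 1 i⟩),
         (0, .cross (MatchedVertex.leg ⟨true, ε, Equiv.swap 0 1 i⟩ 0)
           (MatchedVertex.leg ⟨true, ε, Equiv.swap 0 1 i⟩ 1))]
  | g1 (ε : Bool) : GrapheneLocalMove [] uu ((0, .cup .unmatched) :: rung ε true true)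
      [(0, .cup .unmatched)]
  | g2 (ε : Bool) : GrapheneLocalMove uu uu (rung ε true true ++ rung (!ε) true true) []
  | g3 (ε : Bool) : GrapheneLocalMove uuu uuu
        (rung ε true true ++ (crossU ++ shift 1 (rung ε true true) ++ crossU) ++
          shift 1 (rung ε true true))
        (shift 1 (rung ε true true) ++ (crossU ++ shift 1 (rung ε true true) ++ crossU) ++
          rung ε true true)
  | g4 (ε a b : Bool) : GrapheneLocalMove uu uu (rung ε a b) (rung ε (!a) (!b))
  | g5 (ε : Bool) : GrapheneLocalMove uu uu (rung ε true false) (rung (!ε) true true)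

lemma exists_of_runs_rung {ε a b : Bool} {A B : List matchedKind.Color} {w : matchedKind.Word}
    (h : Runs A (rung ε a b ++ w) B) : ∃ y, A = uu ++ y := by
  rcases A with _ | ⟨c, _ | ⟨d, A⟩⟩
  · simp [rung, runs_cons] at h
  · simp [rung, runs_cons, Piece.src, Piece.tgt, MatchedVertex.leg] at h
  · simp [rung, runs_cons, Piece.src, Piece.tgt, MatchedVertex.leg] at h
    obtain ⟨rfl, rfl, -⟩ := h
    exact ⟨A, rfl⟩

lemma grapheneLocalMove_isBoundary : IsBoundary GrapheneMove GrapheneLocalMove where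
  runs h := by
    cases h with
    | m5 ε i => exact (Eqv.untwistVertex ⟨false, ε, i⟩).runs
    | g1 ε => exact ⟨runs_of_runList (by cases ε <;> decide +kernel), runs_of_runList rfl⟩
    | g2 ε => exact ⟨(runs_rung _ _ _).append (runs_rung _ _ _), rfl⟩
    | g3 ε => exact ⟨runs_of_runList (by cases ε <;> decide +kernel),
        runs_of_runList (by cases ε <;> decide +kernel)⟩
    | g4 ε a b => exact ⟨runs_rung _ _ _, runs_rung _ _ _⟩
    | g5 ε => exact ⟨runs_rung _ _ _, runs_rung _ _ _⟩
  exists_boundary {u v A B} h hu := by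
    rcases h with h | h
    · cases h with
      | m5 ε i => exact ⟨_, _, A, rfl, .m5 ε i⟩
    · cases h with
      | g1 ε => exact ⟨_, _, A, rfl, .g1 ε⟩
      | g2 ε =>
        obtain ⟨y, rfl⟩ := exists_of_runs_rung hu
        exact ⟨_, _, y, rfl, .g2 ε⟩
      | g3 ε =>
        rw [List.append_assoc] at hu
        obtain ⟨y, rfl⟩ := exists_of_runs_rung hu
        obtain ⟨c, h1, h2⟩ := runs_append.1 hu
        have h3 := (runs_rung ε true true).whisker [] y
        rw [List.length_nil, shift_zero] at h3
        cases h1.det h3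
        rcases y with _ | ⟨d, y⟩
        · simp [rung, runs_cons, Piece.src, Piece.tgt] at h2
        · simp [rung, runs_cons, Piece.src, Piece.tgt, MatchedVertex.leg] at h2
          obtain ⟨rfl, -⟩ := h2
          exact ⟨_, _, y, rfl, .g3 ε⟩
      | g4 ε a b =>
        obtain ⟨y, rfl⟩ := exists_of_runs_rung (w := []) (by simpa using hu)
        exact ⟨_, _, y, rfl, .g4 ε a b⟩
      | g5 ε =>
        obtain ⟨y, rfl⟩ := exists_of_runs_rung (w := []) (by simpa using hu)
        exact ⟨_, _, y, rfl, .g5 ε⟩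
  ne_nil h := by
    rcases h with h | h <;> cases h <;> simp [rung]

namespace Shade

/-- The drawings have the same outcomes for all shadings of the upper boundary `α`. -/
def SameOutcomes (α : List EdgeColor) (u v : matchedKind.Word) : Prop :=
  ∀ a ∈ allList α, (∀ r ∈ outcomes a u, r ∈ outcomes a v) ∧ ∀ r ∈ outcomes a v, r ∈ outcomes a u

instance (α : List EdgeColor) (u v : matchedKind.Word) : Decidable (SameOutcomes α u v) :=
  inferInstanceAs (Decidable (∀ a ∈ allList α, _ ∧ _))

lemma sameOutcomes_rotate (a ε : Bool) (i : Fin 3) :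
    SameOutcomes [] [(0, .node (matchedKind.rot ⟨a, ε, i⟩))]
      [(0, .cup (MatchedVertex.leg ⟨a, ε, i⟩ 0)), (1, .node ⟨a, ε, i⟩),
        (0, .cap (MatchedVertex.leg ⟨a, ε, i⟩ 0))] := by
  revert a ε i
  decide +kernel

lemma sameOutcomes_pass (c : EdgeColor) (a ε : Bool) (i : Fin 3) (n : Fin 4) :
    SameOutcomes [c]
      ((1, .node ⟨a, ε, i⟩) :: passRight c 0 ((matchedKind.legs ⟨a, ε, i⟩).take n))
      ((0, .node ⟨a, ε, i⟩) :: passLeft c n ((matchedKind.legs ⟨a, ε, i⟩).drop n)) := by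
  cases c with
  | unmatched => revert a ε i n; decide +kernel
  | matched δ => revert δ a ε i n; decide +kernel

/-- In either order of the two pieces, the shadings below them are chosen independently. -/
lemma sameOutcomes_exchange (e e' : matchedKind.Piece) (z : List EdgeColor) :
    SameOutcomes (e.src ++ z ++ e'.src) [(0, e), (e.tgt.length + z.length, e')]
      [(e.src.length + z.length, e'), (0, e)] := by
  intro a ha
  rw [mem_allList] at ha
  obtain ⟨a', s', rfl, h3, hs'⟩ := List.map_eq_append_iff.1 ha
  obtain ⟨s, z', rfl, hs, hz⟩ := List.map_eq_append_iff.1 h3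
  have hl : s.length = e.src.length := by simpa using congrArg List.length hs
  have hl' : s'.length = e'.src.length := by simpa using congrArg List.length hs'
  have hz' : z'.length = z.length := by simpa using congrArg List.length hz
  have e1 : ∀ r, r ∈ outcomes (s ++ z' ++ s') [(0, e), (e.tgt.length + z.length, e')] ↔
      ∃ t ∈ next e s, ∃ t' ∈ next e' s', r = (t ++ z' ++ t',
        (any s || any t || any z' || any s' || any t')) := by
    rintro ⟨b, f⟩
    have h1 := mem_outcomes_cons (x := []) (s := s) (y := z' ++ s') (b := b) (e := e)
      (w := [(e.tgt.length + z.length, e')]) (f := f) hl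
    simp only [List.nil_append, List.length_nil, ← List.append_assoc] at h1
    rw [h1]
    have h2 : ∀ t ∈ next e s, ∀ f, ((b, f) ∈ outcomes (t ++ z' ++ s') [(e.tgt.length + z.length, e')] ↔
        ∃ t' ∈ next e' s', b = t ++ z' ++ t' ∧ f = (any t || any z' || any s' || any t')) := by
      intro t ht f
      have ht' : e.tgt.length = t.length := by
        simpa using (congrArg List.length (length_of_mem_next ht).1).symm
      have := mem_outcomes_cons (x := t ++ z') (s := s') (y := []) (b := b) (e := e')
        (w := []) (f := f) hl'
      rw [List.append_nil, List.length_append, ← ht', hz'] at this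
      rw [this]
      constructor
      · rintro ⟨t', h3, f', h4, rfl⟩
        simp only [outcomes, List.mem_singleton, Prod.mk.injEq, List.append_nil] at h4
        obtain ⟨rfl, rfl⟩ := h4
        refine ⟨t', h3, rfl, ?_⟩
        simp only [any, List.any_nil]
        grind
      · rintro ⟨t', h3, rfl, rfl⟩
        refine ⟨t', h3, any (t ++ z' ++ t'), by simp [outcomes], ?_⟩
        simp only [any, List.any_nil]
        grind
    constructor
    · rintro ⟨t, ht, f', h3, rfl⟩
      obtain ⟨t', ht', rfl, rfl⟩ := (h2 t ht _).1 h3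
      refine ⟨t, ht, t', ht', Prod.ext rfl ?_⟩
      simp only [any, List.any_nil]
      grind
    · rintro ⟨t, ht, t', ht', h3⟩
      obtain ⟨rfl, rfl⟩ := Prod.mk.injEq .. ▸ h3
      refine ⟨t, ht, _, (h2 t ht _).2 ⟨t', ht', rfl, rfl⟩, ?_⟩
      simp only [any, List.any_nil]
      grind
  have e2 : ∀ r, r ∈ outcomes (s ++ z' ++ s') [(e.src.length + z.length, e'), (0, e)] ↔
      ∃ t ∈ next e s, ∃ t' ∈ next e' s', r = (t ++ z' ++ t',
        (any s || any t || any z' || any s' || any t')) := by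
    rintro ⟨b, f⟩
    have h1 := mem_outcomes_cons (x := s ++ z') (s := s') (y := []) (b := b) (e := e')
        (w := [(0, e)]) (f := f) hl'
    simp only [List.append_nil, List.length_append, hl, hz'] at h1
    rw [h1]
    have h2 : ∀ t', ∀ f, ((b, f) ∈ outcomes (s ++ z' ++ t') [(0, e)] ↔
        ∃ t ∈ next e s, b = t ++ z' ++ t' ∧ f = (any s || any t || any z' || any t')) := by
      intro t' f
      have := mem_outcomes_cons (x := []) (s := s) (y := z' ++ t') (b := b) (e := e)
        (w := []) (f := f) hl
      simp only [List.nil_append, List.length_nil, ← List.append_assoc] at this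
      rw [this]
      constructor
      · rintro ⟨t, h3, f', h4, rfl⟩
        simp only [outcomes, List.mem_singleton, Prod.mk.injEq] at h4
        obtain ⟨rfl, rfl⟩ := h4
        refine ⟨t, h3, rfl, ?_⟩
        simp only [any, List.any_nil]
        grind
      · rintro ⟨t, h3, rfl, rfl⟩
        refine ⟨t, h3, any (t ++ z' ++ t'), by simp [outcomes], ?_⟩
        simp only [any, List.any_nil]
        grind
    constructor
    · rintro ⟨t', ht', f', h3, rfl⟩
      obtain ⟨t, ht, rfl, rfl⟩ := (h2 t' _).1 h3
      refine ⟨t, ht, t', ht', Prod.ext rfl ?_⟩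
      simp only [any, List.any_nil]
      grind
    · rintro ⟨t, ht, t', ht', h3⟩
      obtain ⟨rfl, rfl⟩ := Prod.mk.injEq .. ▸ h3
      refine ⟨t', ht', _, (h2 t' _).2 ⟨t, ht, rfl, rfl⟩, ?_⟩
      simp only [any, List.any_nil]
      grind
  exact ⟨fun r h => (e2 r).2 ((e1 r).1 h), fun r h => (e1 r).2 ((e2 r).1 h)⟩

lemma sameOutcomes_localMove {α β : List matchedKind.Color} {u v : matchedKind.Word}
    (h : LocalMove GrapheneLocalMove α β u v) : SameOutcomes α u v := by
  cases h with
  | exchange e e' z => exact sameOutcomes_exchange e e' z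
  | zigzag c => rcases c with _ | (_ | _) <;> decide +kernel
  | zagzig c => rcases c with _ | (_ | _) <;> decide +kernel
  | slideCup c d => rcases c with _ | (_ | _) <;> rcases d with _ | (_ | _) <;> decide +kernel
  | slideCap c d => rcases c with _ | (_ | _) <;> rcases d with _ | (_ | _) <;> decide +kernel
  | rotate g c l h =>
    obtain ⟨a, ε, i⟩ := g
    obtain ⟨rfl, rfl⟩ := List.cons_eq_cons.1 h
    exact sameOutcomes_rotate a ε i
  | kink c => rcases c with _ | (_ | _) <;> decide +kernel
  | bigon c d => rcases c with _ | (_ | _) <;> rcases d with _ | (_ | _) <;> decide +kernel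
  | triangle c d e =>
    rcases c with _ | (_ | _) <;> rcases d with _ | (_ | _) <;> rcases e with _ | (_ | _) <;>
      decide +kernel
  | pass c g l₁ l₂ h =>
    have hn : l₁.length < 4 := by
      have := congrArg List.length h
      simp at this
      omega
    have := sameOutcomes_pass c g.solid g.sign g.pos ⟨l₁.length, hn⟩
    rw [h] at this
    simpa using this
  | special h =>
    cases h with
    | m5 ε i => revert ε i; decide +kernel
    | g1 ε => revert ε; decide +kernel
    | g2 ε => revert ε; decide +kernel
    | g3 ε => revert ε; decide +kernel
    | g4 ε a b => revert ε a b; decide +kernel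
    | g5 ε => revert ε; decide +kernel

lemma forget_of_mem_outcomes {α β : List EdgeColor} {a b : List Shade} {f : Bool}
    {w : matchedKind.Word} (h : Runs (S := matchedKind) α w β) (ha : a.map forget = α)
    (hb : (b, f) ∈ outcomes a w) : b.map forget = β := by
  induction w generalizing α a f with
  | nil =>
    simp only [outcomes, List.mem_singleton, Prod.mk.injEq] at hb
    cases h
    rw [hb.1, ha]
  | cons s w ih =>
    obtain ⟨k, e⟩ := s
    obtain ⟨_, ⟨u, v, hu, h1, rfl⟩, h⟩ := h
    subst h1
    obtain ⟨a', v', rfl, h3, hv⟩ := List.map_eq_append_iff.1 ha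
    obtain ⟨u', s, rfl, hu', hs⟩ := List.map_eq_append_iff.1 h3
    have hl : s.length = e.src.length := by simpa using congrArg List.length hs
    have hk : u'.length = k := by rw [← List.length_map (f := forget), hu', hu]
    subst hk
    obtain ⟨t, ht, f', h5, -⟩ := (mem_outcomes_cons hl).1 hb
    exact ih h (by simp [hu', hv, (length_of_mem_next ht).1]) h5

/-- The moves on matched drawings do not change the outcomes of shadings. -/
lemma outcomes_eqv {w w' : matchedKind.Word} (h : Eqv GrapheneMove [] [] w w') (r : List Shade × Bool) :
    r ∈ outcomes [] w ↔ r ∈ outcomes [] w' := by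
  induction h generalizing r with
  | refl _ => rfl
  | symm _ ih => exact (ih r).symm
  | trans _ _ ih ih' => exact (ih r).trans (ih' r)
  | step h hu hv =>
    obtain ⟨p, q, u, v, x, y, a, b, h1, hp, hq, rfl, rfl⟩ :=
      Rewrite.exists_context grapheneLocalMove_isBoundary h hu hv
    have hr := h1.runs grapheneLocalMove_isBoundary
    have hs := sameOutcomes_localMove h1
    have key : ∀ {u v : matchedKind.Word}, Runs a u b → Runs a v b → SameOutcomes a u v → ∀ r,
        r ∈ outcomes [] (p ++ (shift x.length u ++ q)) →
          r ∈ outcomes [] (p ++ (shift x.length v ++ q)) := by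
      rintro u v hu hv hs ⟨c, f⟩ hr
      obtain ⟨A, f₁, f₂, h2, h3, rfl⟩ := mem_outcomes_append.1 hr
      obtain ⟨B, f₃, f₄, h4, h5, rfl⟩ := mem_outcomes_append.1 h3
      obtain ⟨A', y', rfl, h6, -⟩ := List.map_eq_append_iff.1 (forget_of_mem_outcomes hp rfl h2)
      obtain ⟨x', a', rfl, hx, ha⟩ := List.map_eq_append_iff.1 h6
      have hx' : x.length = x'.length := by rw [← hx, List.length_map]
      rw [hx'] at h4 ⊢
      refine mem_outcomes_append.2 ⟨_, f₁, _, h2, mem_outcomes_append.2 ⟨B, f₃, f₄, ?_, h5, rfl⟩, rfl⟩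
      obtain ⟨b', f', h7, h8, h9⟩ := (mem_outcomes_shift hu ha).1 h4
      exact (mem_outcomes_shift hv ha).2 ⟨b', f', (hs a' (mem_allList.2 ha)).1 _ h7, h8, h9⟩
    exact ⟨key hr.1 hr.2 hs r, key hr.2 hr.1 (fun a ha => (hs a ha).symm) r⟩

/-- `L i` is the shading above the `i`-th piece of the drawing in one coherent shading of all of
it. -/
def IsHistory (w : matchedKind.Word) (L : ℕ → List Shade) : Prop :=
  ∀ i k e, w[i]? = some (k, e) → ∃ x s y t, x.length = k ∧ L i = x ++ s ++ y ∧
    L (i + 1) = x ++ t ++ y ∧ t ∈ next e s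

lemma exists_isHistory {α β : List EdgeColor} {a b : List Shade} {f : Bool}
    {w : matchedKind.Word} (h : Runs (S := matchedKind) α w β) (ha : a.map forget = α)
    (hb : (b, f) ∈ outcomes a w) :
    ∃ L, IsHistory w L ∧ L 0 = a ∧ (f = true → ∃ i ≤ w.length, any (L i) = true) := by
  induction w generalizing α a f with
  | nil =>
    simp only [outcomes, List.mem_singleton, Prod.mk.injEq] at hb
    obtain ⟨rfl, rfl⟩ := hb
    exact ⟨fun _ => b, by simp [IsHistory], rfl, fun h => ⟨0, le_rfl, h⟩⟩
  | cons s w ih =>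
    obtain ⟨k, e⟩ := s
    obtain ⟨_, ⟨u, v, hu, h1, rfl⟩, h⟩ := h
    subst h1
    obtain ⟨a', v', rfl, h3, hv⟩ := List.map_eq_append_iff.1 ha
    obtain ⟨u', s, rfl, hu', hs⟩ := List.map_eq_append_iff.1 h3
    have hl : s.length = e.src.length := by simpa using congrArg List.length hs
    have hk : u'.length = k := by rw [← List.length_map (f := forget), hu', hu]
    subst hk
    obtain ⟨t, ht, f', h5, rfl⟩ := (mem_outcomes_cons hl).1 hb
    obtain ⟨L, h6, h7, h8⟩ := ih h (by simp [hu', hv, (length_of_mem_next ht).1]) h5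
    refine ⟨fun i => i.casesOn (u' ++ s ++ v') L, ?_, rfl, ?_⟩
    · rintro (_ | i) k' e' h9
      · simp only [List.getElem?_cons_zero, Option.some.injEq, Prod.mk.injEq] at h9
        obtain ⟨rfl, rfl⟩ := h9
        exact ⟨u', s, v', t, rfl, rfl, h7, ht⟩
      · exact h6 i k' e' (by simpa using h9)
    · intro h9
      rcases f' with _ | _
      · exact ⟨0, by simp, by simpa [or_assoc] using h9⟩
      · obtain ⟨i, h10, h11⟩ := h8 rfl
        exact ⟨i + 1, by simpa using h10, h11⟩

lemma IsHistory.mem_outcomes {w : matchedKind.Word} {L : ℕ → List Shade} (h : IsHistory w L) :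
    ∃ f, (L w.length, f) ∈ outcomes (L 0) w ∧ ∀ i ≤ w.length, any (L i) = true → f = true := by
  induction w generalizing L with
  | nil =>
    refine ⟨any (L 0), by simp [outcomes], fun i hi h => ?_⟩
    cases Nat.le_zero.1 hi
    exact h
  | cons s w ih =>
    obtain ⟨k, e⟩ := s
    obtain ⟨x, s, y, t, rfl, h1, h2, ht⟩ := h 0 k e rfl
    obtain ⟨f, h3, h4⟩ := ih (L := fun i => L (i + 1)) fun i k e hi => h (i + 1) k e (by simpa using hi)
    have hl : s.length = e.src.length := by simpa using congrArg List.length (length_of_mem_next ht).2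
    simp only [zero_add] at h2 h3
    rw [h2] at h3
    refine ⟨_, h1 ▸ (mem_outcomes_cons hl).2 ⟨t, ht, f, h3, rfl⟩, ?_⟩
    rintro (_ | i) hi hL
    · rw [h1] at hL
      simp only [any_append] at hL
      simp [hL]
    · simp [h4 i (by simpa using hi) hL]

lemma IsHistory.runs {w : matchedKind.Word} {L : ℕ → List Shade} (h : IsHistory w L) :
    Runs (S := matchedKind) ((L 0).map forget) w ((L w.length).map forget) := by
  induction w generalizing L with
  | nil => rfl
  | cons s w ih =>
    obtain ⟨k, e⟩ := s
    obtain ⟨x, s, y, t, rfl, h1, h2, ht⟩ := h 0 k e rfl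
    refine ⟨_, ?_, ih (L := fun i => L (i + 1)) fun i k e hi => h (i + 1) k e (by simpa using hi)⟩
    exact ⟨x.map forget, y.map forget, by simp, by simp [h1, (length_of_mem_next ht).2],
      by simp [h2, (length_of_mem_next ht).1]⟩

lemma IsHistory.take {w : matchedKind.Word} {L : ℕ → List Shade} (h : IsHistory w L) (n : ℕ) :
    IsHistory (w.take n) L := by
  intro i k e hi
  rw [List.getElem?_take] at hi
  split at hi
  · exact h i k e hi
  · simp at hi

/-- A point is shaded. -/
def ShadedAt (L : ℕ → List Shade) (p : ℕ × ℕ) : Prop := ∃ ε, (L p.1)[p.2]? = some (edge ε true)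

lemma IsHistory.shadedAt_iff {w : matchedKind.Word} {L : ℕ → List Shade} (h : IsHistory w L)
    {p q : ℕ × ℕ} (hpq : Relation.EqvGen (Neighbours w) p q) : ShadedAt L p ↔ ShadedAt L q := by
  induction hpq with
  | refl _ => rfl
  | symm _ _ _ ih => exact ih.symm
  | trans _ _ _ _ _ ih ih' => exact ih.trans ih'
  | rel p q hpq =>
    have key : ∀ {i j i' j' : ℕ}, (L i)[j]? = (L i')[j']? → (ShadedAt L (i, j) ↔ ShadedAt L (i', j')) := by
      intro i j i' j' h
      simp only [ShadedAt, h]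
    cases hpq with
    | left hw j hj =>
      obtain ⟨x, s, y, t, rfl, h1, h2, ht⟩ := h _ _ _ hw
      apply key
      rw [h1, h2, List.append_assoc, List.append_assoc, List.getElem?_append_left hj,
        List.getElem?_append_left hj]
    | right hw j =>
      obtain ⟨x, s, y, t, rfl, h1, h2, ht⟩ := h _ _ _ hw
      apply key
      have h3 := congrArg List.length (length_of_mem_next ht).1
      have h4 := congrArg List.length (length_of_mem_next ht).2
      simp only [List.length_map] at h3 h4
      rw [h1, h2, ← h3, ← h4, ← List.length_append, ← List.length_append,
        List.getElem?_append_right (by omega), List.getElem?_append_right (by omega)]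
      simp
    | cup hw =>
      obtain ⟨x, s, y, t, rfl, h1, h2, ht⟩ := h _ _ _ hw
      apply key
      rcases s with _ | ⟨s, _⟩ <;> simp [next] at ht
      obtain ⟨s, -, rfl⟩ := ht
      simp [h2]
    | cap hw =>
      obtain ⟨x, s, y, t, rfl, h1, h2, ht⟩ := h _ _ _ hw
      apply key
      rcases s with _ | ⟨s₁, _ | ⟨s₂, _ | ⟨s₃, s⟩⟩⟩ <;> simp [next] at ht
      simp [h1, ht.1.1]
    | crossLeft hw =>
      obtain ⟨x, s, y, t, rfl, h1, h2, ht⟩ := h _ _ _ hw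
      apply key
      rcases s with _ | ⟨s₁, _ | ⟨s₂, _ | ⟨s₃, s⟩⟩⟩ <;> simp [next] at ht
      simp [h1, h2, ht.2]
    | crossRight hw =>
      obtain ⟨x, s, y, t, rfl, h1, h2, ht⟩ := h _ _ _ hw
      apply key
      rcases s with _ | ⟨s₁, _ | ⟨s₂, _ | ⟨s₃, s⟩⟩⟩ <;> simp [next] at ht
      simp [h1, h2, ht.2]

lemma IsHistory.not_shadedAt_of_isLeg {w : matchedKind.Word} {L : ℕ → List Shade}
    (h : IsHistory w L) {p : ℕ × ℕ} (hp : IsLeg w p) : ¬ ShadedAt L p := by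
  obtain ⟨i, k, t, g, hw, ht, rfl⟩ := hp
  obtain ⟨x, s, y, t', rfl, h1, h2, ht'⟩ := h _ _ _ hw
  rintro ⟨ε, hε⟩
  rcases s with _ | ⟨s, _⟩ <;> simp only [next, List.mem_singleton, List.not_mem_nil] at ht'
  simp only [h2] at hε
  rw [List.append_assoc, List.getElem?_append_right (by omega), Nat.add_sub_cancel_left,
    List.getElem?_append_left (by rw [ht', List.length_map]; exact ht), ht', List.getElem?_map,
    Option.map_eq_some_iff] at hε
  obtain ⟨c, -, hc⟩ := hε
  cases c <;> simp [clear] at hc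

/-- The shading of some strands by a set of points. -/
noncomputable def paint (P : ℕ → Prop) (l : List EdgeColor) : List Shade :=
  open Classical in l.mapIdx fun j c =>
    if P j then
      match c with
      | .unmatched => plain
      | .matched ε => edge ε true
    else clear c

lemma paint_append (P : ℕ → Prop) (l l' : List EdgeColor) :
    paint P (l ++ l') = paint P l ++ paint (fun j => P (l.length + j)) l' := by
  classical
  simp only [paint, List.mapIdx_append, add_comm]

lemma paint_congr {P Q : ℕ → Prop} {l : List EdgeColor} (h : ∀ j < l.length, (P j ↔ Q j)) :
    paint P l = paint Q l := by
  classical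
  refine List.ext_getElem (by simp [paint]) fun j h1 h2 => ?_
  have hj : j < l.length := by simpa [paint] using h1
  simp [paint, h j hj]

/-- A closed matched curve without vertices can be shaded. -/
lemma isHistory_paint {w : matchedKind.Word} {a : ℕ → List EdgeColor} {P : ℕ × ℕ → Prop}
    (ha : ∀ i s, w[i]? = some s → Fits (S := matchedKind) (a i) s (a (i + 1)))
    (hP : ∀ p q, Neighbours w p q → (P p ↔ P q)) (hl : ∀ p, IsLeg w p → ¬ P p) :
    IsHistory w fun i => paint (fun j => P (i, j)) (a i) := by
  intro i k e hi
  obtain ⟨x, y, rfl, h1, h2⟩ := ha i _ hi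
  refine ⟨paint (fun j => P (i, j)) x, paint (fun j => P (i, x.length + j)) e.src,
    paint (fun j => P (i, x.length + e.src.length + j)) y,
    paint (fun j => P (i + 1, x.length + j)) e.tgt, by simp [paint], ?_, ?_, ?_⟩
  · simp [h1, paint_append, Nat.add_assoc]
  · simp only [h2, paint_append]
    congr 1
    · congr 1
      exact paint_congr fun j hj => (hP _ _ (.left hi j hj)).symm
    · refine paint_congr fun j _ => ?_
      simpa using (hP _ _ (.right hi j)).symm
  · cases e with
    | cup c =>
      have := hP _ _ (.cup hi)
      cases c <;> by_cases hp : P (i + 1, x.length) <;>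
        simp [next, paint, Piece.src, Piece.tgt, all, clear, ← this, hp]
    | cap c =>
      have := hP _ _ (.cap hi)
      cases c <;> by_cases hp : P (i, x.length) <;>
        simp [next, paint, Piece.src, Piece.tgt, forget, clear, ← this, hp]
    | cross c d =>
      have h3 := hP _ _ (.crossLeft hi)
      have h4 := hP _ _ (.crossRight hi)
      cases c <;> cases d <;> by_cases hp : P (i, x.length) <;>
        by_cases hp' : P (i, x.length + 1) <;>
        simp [next, paint, Piece.src, Piece.tgt, forget, clear, ← h3, ← h4, hp, hp']
    | node g =>
      have h3 : ∀ j < (matchedKind.legs g).length, ¬ P (i + 1, x.length + j) :=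
        fun j hj => hl _ ⟨i, x.length, j, g, hi, hj, rfl⟩
      simp only [next, Piece.src, paint, List.mapIdx_nil, List.mem_singleton]
      classical
      refine List.ext_getElem (by simp [Piece.tgt]) fun j h1 h2 => ?_
      have hj : j < (matchedKind.legs g).length := by simpa using h2
      have := h3 j hj
      simp only [List.getElem_mapIdx, List.getElem_map, this, if_false, Piece.tgt]

end Shade

/-- Every matched edge ends at vertices. -/
abbrev IsMatching (w : matchedKind.Word) : Prop :=
  EdgesEndAtVertices (fun c => ∃ ε, c = EdgeColor.matched ε) w

/-- The matched edges of a closed drawing end at vertices if and only if nothing can be shaded. -/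
lemma isMatching_iff {w : matchedKind.Word} (h : Runs [] w []) :
    IsMatching w ↔ ∀ f, ([], f) ∈ Shade.outcomes [] w → f = false := by
  constructor
  · intro hw f hf
    -- A shaded point lies on an edge that ends at a vertex, where nothing is shaded.
    by_contra hf'
    obtain ⟨L, h1, h2, h3⟩ := Shade.exists_isHistory h (a := []) rfl hf
    obtain ⟨i, hi, h4⟩ := h3 (by simpa using hf')
    simp only [Shade.any, List.any_eq_true, List.mem_iff_getElem?] at h4
    obtain ⟨s, ⟨j, hj⟩, hs⟩ := h4
    have h5 := (h1.take i).runs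
    rw [h2, List.length_take, min_eq_left hi] at h5
    rcases s with _ | ⟨ε, _ | _⟩
    · simp [Shade.isShaded] at hs
    · simp [Shade.isShaded] at hs
    · obtain ⟨p, hp, hp'⟩ := hw i j _ (.matched ε) h5 (by simp [hj, Shade.forget]) ⟨ε, rfl⟩
      exact h1.not_shadedAt_of_isLeg hp ((h1.shadedAt_iff hp').1 ⟨ε, hj⟩)
  · rintro hw i j a c ha hj ⟨ε, rfl⟩
    by_contra hp
    push Not at hp
    have h1 : ∀ i, ∃ a, i ≤ w.length → Runs [] (w.take i) a := by
      intro i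
      rw [← List.take_append_drop i w] at h
      obtain ⟨a, h, -⟩ := runs_append.1 h
      exact ⟨a, fun _ => h⟩
    choose A hA using h1
    -- The edge through the point `(i, j)` does not end at a vertex and can be shaded.
    have h2 := Shade.isHistory_paint (w := w) (a := A)
      (P := fun p => Relation.EqvGen (Neighbours w) (i, j) p) (by
        intro i s hi
        have hi' : i < w.length := (List.getElem?_eq_some_iff.1 hi).1
        have h3 := hA (i + 1) hi'
        rw [List.take_add_one, hi] at h3
        obtain ⟨b, h4, _, h5, h6⟩ := runs_append.1 h3
        cases h4.det (hA i hi'.le)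
        cases h6
        exact h5)
      (fun p q h => ⟨fun h' => h'.trans _ _ _ (.rel _ _ h), fun h' => h'.trans _ _ _ (.symm _ _ (.rel _ _ h))⟩)
      (fun p hp' h => hp p hp' h)
    obtain ⟨f, h3, h4⟩ := h2.mem_outcomes
    have h5 : A 0 = [] := ((hA 0 (Nat.zero_le _)).symm : _)
    have h6 : A w.length = [] := by
      have := hA w.length le_rfl
      rw [List.take_length] at this
      exact this.det h
    rw [h5, h6] at h3
    rcases le_or_gt i w.length with hi | hi
    · cases ha.det (hA i hi)
      refine absurd (h4 i hi ?_) (by simp [hw f h3])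
      rw [Shade.any, List.any_eq_true]
      refine ⟨.edge ε true, List.mem_of_getElem? (i := j) ?_, rfl⟩
      simp [Shade.paint, hj, Relation.EqvGen.refl]
    · rw [List.take_of_length_le hi.le] at ha
      cases ha.det h
      simp at hj

lemma DrawingKind.Eqv.isMatching {w w' : matchedKind.Word} (h : Eqv GrapheneMove [] [] w w')
    (hw : IsMatching w) : IsMatching w' :=
  (isMatching_iff h.runs.2).2 fun f hf =>
    (isMatching_iff h.runs.1).1 hw f ((Shade.outcomes_eqv h _).2 hf)

/-- A sequence of moves from one closed matched diagram to another passes through closed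
matched diagrams only. -/
lemma DrawingKind.Eqv.graphene_eq {w w' : matchedKind.Word} (h : Eqv GrapheneMove [] [] w w')
    (hw : IsClosedDrawing w ∧ IsMatching w) (hw' : IsClosedDrawing w' ∧ IsMatching w') :
    Quotient.mk zGrapheneSetoid ⟨w, hw⟩ = Quotient.mk zGrapheneSetoid ⟨w', hw'⟩ := by
  induction h with
  | refl _ => rfl
  | step h _ _ =>
    refine Quotient.sound (.rel _ _ ?_)
    exact h
  | symm h ih => exact (ih hw' hw).symm
  | trans h h' ih ih' =>
    have := h.isMatching hw.2
    exact (ih hw ⟨h.runs.2, this⟩).trans (ih' ⟨h.runs.2, this⟩ hw')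

lemma DrawingKind.Eqv.link_eq {w w' : linkKind.Word} (h : Eqv LinkMove [] [] w w')
    (hw : IsClosedDrawing w) (hw' : IsClosedDrawing w') :
    Quotient.mk zLinkSetoid ⟨w, hw⟩ = Quotient.mk zLinkSetoid ⟨w', hw'⟩ := by
  induction h with
  | refl _ => rfl
  | step h _ _ =>
    refine Quotient.sound (.rel _ _ ?_)
    exact h
  | symm h ih => exact (ih hw' hw).symm
  | trans h h' ih ih' => exact (ih hw h.runs.2).trans (ih' h.runs.2 hw')

/-! ### Existence of markings -/

/-- Nothing can be shaded in the matched diagram of a link diagram. -/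
lemma Shade.outcomes_toGraphene {a b : List linkKind.Color} {w : linkKind.Word} (h : Runs a w b)
    {B : List Shade} {f : Bool}
    (hB : (B, f) ∈ outcomes (a.map fun _ => plain) (_root_.toGraphene w)) : f = false := by
  have hu : ∀ l : List linkKind.Color,
      ((l.map fun _ => plain).map Shade.forget : List EdgeColor) = unmatched l := by
    intro l
    simp [unmatched, Shade.forget]
  have hu' : ∀ (l : List linkKind.Color) (m : List Shade), m.map Shade.forget = unmatched l →
      m = l.map fun _ => plain := by
    intro l m hm
    refine List.ext_getElem (by simpa [unmatched] using congrArg List.length hm) fun j h1 h2 => ?_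
    have := congrArg (fun l => l[j]?) hm
    simp [unmatched, h1, (by simpa using h2 : j < l.length)] at this
    cases h : m[j] <;> simp [h, forget] at this ⊢
  induction w generalizing a B f with
  | nil =>
    simp only [_root_.toGraphene, resolve, Ladder.toMatched, List.flatMap_nil, outcomes,
      List.mem_singleton, Prod.mk.injEq] at hB
    simp [hB.2, any, isShaded]
  | cons s w ih =>
    obtain ⟨k, e⟩ := s
    obtain ⟨_, ⟨x, y, rfl, rfl, rfl⟩, h⟩ := h
    rw [toGraphene_cons, mem_outcomes_append] at hB
    obtain ⟨C, f₁, f₂, h1, h2, rfl⟩ := hB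
    have h3 : Runs (unmatched e.src) (resolvePiece e).toMatched (unmatched e.tgt) := by
      have := runs_toGraphene (w := [(0, e)]) (a := e.src) (b := e.tgt)
        (runs_singleton.2 ⟨[], [], rfl, by simp, by simp⟩)
      rw [toGraphene_cons] at this
      simpa [_root_.toGraphene, resolve, Ladder.toMatched] using this
    have h4 := mem_outcomes_shift h3 (x := x.map fun _ => plain) (y := y.map fun _ => plain)
      (B := C) (f := f₁) (hu e.src)
    simp only [List.length_map] at h4
    simp only [List.map_append] at h1
    obtain ⟨c, f', h5, rfl, rfl⟩ := h4.1 h1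
    have h6 := forget_of_mem_outcomes h3 (hu _) h5
    rw [hu' _ _ h6] at h2
    have h7 := ih h (by simpa only [List.map_append] using h2)
    have h8 : ∀ l : List linkKind.Color, any (l.map fun _ => plain) = false := by
      intro l
      simp [any, isShaded]
    have h9 : f' = false := by
      have : ∀ r ∈ outcomes (e.src.map fun _ => plain) (resolvePiece e).toMatched, r.2 = false := by
        clear h1 h2 h3 h4 h5 h6 h7 h
        rcases e with ⟨⟨⟩⟩ | ⟨⟨⟩⟩ | ⟨⟨⟩, ⟨⟩⟩ | b
        · decide +kernel
        · decide +kernel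
        · decide +kernel
        · revert b
          decide +kernel
      exact this _ h5
    rw [h7, h8, h8, h9]
    rfl

/-- The matched diagram of a link diagram has no matched circles. -/
lemma isMatching_toGraphene {w : linkKind.Word} (h : Runs [] w []) : IsMatching (toGraphene w) :=
  (isMatching_iff (runs_toGraphene h)).2 fun _ hf => Shade.outcomes_toGraphene h hf

/-- The inner section of a matched edge becomes a part of the first outer section. -/
def XColor.outer : XColor Unit → XColor Empty
  | .plain => .plain
  | .edge ε .dn => .edge ε .dn
  | .edge ε .up => .edge ε .up
  | .edge ε (.inn _) => .edge ε .dn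

/-- A piece of a labelled drawing whose inner sections are made parts of outer sections. The values
at `enter` and `leave` are immaterial, since this is applied to drawings without inner sections. -/
def XPiece.outer : XPiece Unit → XPiece Empty
  | .cup c => .cup c.outer
  | .cap c => .cap c.outer
  | .cross c d => .cross c.outer d.outer
  | .node g => .node g
  | .mark ε => .mark ε
  | .enter ε _ => .mark ε
  | .leave ε _ => .mark ε

/-- The shading of the inner sections. -/
def XColor.shade : XColor Unit → Shade
  | .plain => .plain
  | .edge ε (.inn _) => .edge ε true
  | .edge ε _ => .edge ε false

/-- The labelled drawing with its inner sections made parts of outer sections. -/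
def XWord.outer (Y : XWord Unit) : Marking := Y.map fun s => (s.1.map XColor.outer, s.2.outer)

lemma XColor.forget_outer (c : XColor Unit) : c.outer.forget = c.forget := by
  rcases c with _ | ⟨ε, _ | _ | _⟩ <;> rfl

lemma XColor.forget_shade (c : XColor Unit) : c.shade.forget = c.forget := by
  rcases c with _ | ⟨ε, _ | _ | _⟩ <;> rfl

lemma forgetInterp_outer {Y : XWord Unit} (h : ∀ s ∈ Y, ¬ s.2.IsSlider) :
    forgetInterp.map Y.outer = forgetInterp.map Y := by
  induction Y with
  | nil => rfl
  | cons s Y ih =>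
    have h1 : s.2.outer.forget = s.2.forget := by
      have := h s (by simp)
      rcases h2 : s.2 with _ | _ | _ | _ | _ | _ | _ <;>
        simp_all [XPiece.outer, XPiece.forget, XColor.forget_outer, XPiece.IsSlider]
    have h2 := ih fun s hs => h s (by simp [hs])
    change shift (forgetInterp.width (s.1.map XColor.outer)) s.2.outer.forget ++
      forgetInterp.map (XWord.outer Y) = _
    rw [h2, h1]
    simp [forgetInterp_width]
    rfl

/-- If an edge has inner sections everywhere then it can be shaded. -/
lemma exists_shade {a b : List (XColor Unit)} {Y : XWord Unit} (h : XRuns a Y b)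
    (hY : ∀ s ∈ Y, ¬ s.2.IsSlider) :
    ∃ f, (b.map XColor.shade, f) ∈ Shade.outcomes (a.map XColor.shade) (forgetInterp.map Y) ∧
      (f = false → XRuns (a.map XColor.outer) Y.outer (b.map XColor.outer) ∧
        matchedInterp.map Y.outer = matchedInterp.map Y) := by
  induction Y generalizing a with
  | nil =>
    cases h
    exact ⟨_, List.mem_singleton.2 rfl, fun _ => ⟨rfl, rfl⟩⟩
  | cons s Y ih =>
    obtain ⟨x, e⟩ := s
    obtain ⟨y, rfl, h⟩ := h
    obtain ⟨f, h1, h2⟩ := ih h fun s hs => hY s (by simp [hs])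
    have he := hY _ (by simp : (x, e) ∈ (x, e) :: Y)
    have hr : ∀ c : XColor Unit, c.rev.shade = c.shade := by
      rintro (_ | ⟨ε, _ | _ | _⟩) <;> rfl
    have hl : ∀ c : EdgeColor, (XColor.leg c).shade = Shade.clear c := by rintro (_ | _) <;> rfl
    have hor : ∀ c : XColor Unit, c.shade.isShaded = false → c.rev.outer = c.outer.rev := by
      rintro (_ | ⟨ε, _ | _ | _⟩) hc
      · rfl
      · rfl
      · rfl
      · cases hc
    have hol : ∀ c : EdgeColor, (XColor.leg c).outer = XColor.leg c := by rintro (_ | _) <;> rfl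
    have hos : ∀ c : XColor Unit, c.shade.isShaded = false →
        c.outer.matchedStrands = c.matchedStrands := by
      rintro (_ | ⟨ε, _ | _ | _⟩) hc
      · rfl
      · rfl
      · rfl
      · cases hc
    have how : ∀ x : List (XColor Unit), Shade.any (x.map XColor.shade) = false →
        matchedInterp.width (x.map XColor.outer) = matchedInterp.width x := by
      intro x hx
      simp only [Interp.width, matchedInterp]
      congr 1
      induction x with
      | nil => rfl
      | cons c x ih =>
        simp only [Shade.any, List.map_cons, List.any_cons, Bool.or_eq_false_iff] at hx
        simp only [List.map_cons, List.flatMap_cons, hos c hx.1, ih hx.2]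
    -- The shading of the inner sections is compatible with the first piece, and if nothing is shaded
    -- then the piece does not meet inner sections.
    have key : ∃ f', ((x ++ e.tgt ++ y).map XColor.shade, f') ∈
        Shade.outcomes ((x ++ e.src ++ y).map XColor.shade) (shift x.length (forgetInterp.word e)) ∧
        (f' = false → Shade.any (x.map XColor.shade) = false ∧
          e.src.map XColor.outer = e.outer.src ∧ e.tgt.map XColor.outer = e.outer.tgt ∧
          matchedInterp.word e.outer = matchedInterp.word e) := by
      have hrun := forgetInterp.runs e
      have hf : ∀ l : List (XColor Unit), l.flatMap forgetInterp.col = l.map XColor.forget := by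
        intro l; exact List.flatMap_pure_eq_map _ l
      rw [hf, hf] at hrun
      have hm : (e.src.map XColor.shade).map Shade.forget = e.src.map XColor.forget := by
        simp [Function.comp_def, XColor.forget_shade]
      have hp : ∃ f', (e.tgt.map XColor.shade, f') ∈
          Shade.outcomes (e.src.map XColor.shade) (forgetInterp.word e) ∧
          (f' = false → e.src.map XColor.outer = e.outer.src ∧
            e.tgt.map XColor.outer = e.outer.tgt ∧
          matchedInterp.word e.outer = matchedInterp.word e) := by
        cases e with
        | cup c =>
          refine ⟨Shade.any [c.shade, c.shade], ?_, fun hc => ?_⟩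
          · simp [forgetInterp, XPiece.forget, Shade.outcomes, Shade.next, Piece.src, hr,
              Shade.mem_all, XColor.forget_shade, Shade.any]
          · have hc' : c.shade.isShaded = false := by simpa [Shade.any] using hc
            refine ⟨rfl, by simp [XPiece.outer, hor c hc'], ?_⟩
            rcases c with _ | ⟨ε, _ | _ | _⟩ <;> first | rfl | cases hc'
        | cap c =>
          refine ⟨Shade.any [c.shade, c.shade], ?_, fun hc => ?_⟩
          · simp [forgetInterp, XPiece.forget, Shade.outcomes, Shade.next, Piece.src, hr,
              XColor.forget_shade, Shade.any]
          · have hc' : c.shade.isShaded = false := by simpa [Shade.any] using hc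
            refine ⟨by simp [XPiece.outer, hor c hc'], rfl, ?_⟩
            rcases c with _ | ⟨ε, _ | _ | _⟩ <;> first | rfl | cases hc'
        | cross c d =>
          refine ⟨Shade.any [c.shade, d.shade], ?_, fun hc => ?_⟩
          · simp [forgetInterp, XPiece.forget, Shade.outcomes, Shade.next, Piece.src,
              XColor.forget_shade, Shade.any, Bool.or_comm]
          · have hc' : c.shade.isShaded = false ∧ d.shade.isShaded = false := by
              simpa [Shade.any] using hc
            refine ⟨rfl, rfl, ?_⟩
            change moveLeft c.outer.matchedStrands d.outer.matchedStrands = _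
            rw [hos c hc'.1, hos d hc'.2]
            rfl
        | node g =>
          refine ⟨false, ?_, fun _ => ⟨rfl, ?_, rfl⟩⟩
          · clear h2 h1 h hY he hrun hm
            rcases g with ⟨a, ε, i⟩
            revert a ε i
            decide +kernel
          · simp [XPiece.tgt_node, XPiece.outer, hol]
        | mark ε =>
          refine ⟨false, ?_, fun _ => ⟨rfl, rfl, rfl⟩⟩
          exact List.mem_singleton.2 rfl
        | enter ε i => exact (he trivial).elim
        | leave ε i => exact (he trivial).elim
      obtain ⟨f', h3, h4⟩ := hp
      have := (Shade.mem_outcomes_shift hrun (x := x.map XColor.shade) (y := y.map XColor.shade)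
        hm).2 ⟨_, f', h3, rfl, rfl⟩
      refine ⟨_, by simpa using this, fun h => ?_⟩
      simp only [Bool.or_eq_false_iff] at h
      exact ⟨h.1.1, h4 h.2⟩
    obtain ⟨f', h3, h4⟩ := key
    refine ⟨f' || f, ?_, fun hf => ?_⟩
    · rw [Interp.map_cons, Shade.mem_outcomes_append, forgetInterp_width]
      exact ⟨_, f', f, h3, h1, rfl⟩
    · simp only [Bool.or_eq_false_iff] at hf
      obtain ⟨h5, h6, h7, h8⟩ := h4 hf.1
      obtain ⟨h9, h10⟩ := h2 hf.2
      refine ⟨⟨y.map XColor.outer, by simp [h6], by simpa [← h7, XWord.outer] using h9⟩, ?_⟩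
      change shift (matchedInterp.width (x.map XColor.outer)) (matchedInterp.word e.outer) ++
        matchedInterp.map (XWord.outer Y) = _
      rw [h10, h8, how x h5]
      rfl

/-- A matched diagram without matched circles can be marked, and it is then equivalent to the
matched diagram of the link diagram of the marking. -/
theorem exists_marking {w : matchedKind.Word} (h : Runs [] w []) (hw : IsMatching w) :
    ∃ W : Marking, XRuns [] W [] ∧ forgetInterp.map W = w ∧
      Eqv GrapheneMove [] [] (toGraphene (markedLink.map W)) w := by
  obtain ⟨X, h1, h2, h3⟩ := exists_inner h
  have h4 : ∃ Y : XWord Unit, XRuns [] Y [] ∧ (∀ s ∈ Y, ¬ s.2.IsSlider) ∧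
      forgetInterp.map Y = forgetInterp.map X ∧
      Eqv GrapheneMove [] [] (matchedInterp.map Y) (matchedInterp.map X) := by
    clear h2 h3
    -- All inner sections shrink to marks, unless they belong to closed curves.
    revert X
    refine slide_induction ?_ ?_
    · rintro p q l r x y a b hs hp hq ⟨Y, h1, h2, h3, h4⟩
      refine ⟨Y, h1, h2, h3.trans ?_, h4.trans ?_⟩
      · have : forgetInterp.map l = forgetInterp.map r := by
          rcases hs with hs | hs
          · exact hs.forget
          · exact hs.forget.symm
        simp only [Interp.map_append, Interp.map_lift, this]
      · exact (matchedInterp_lawful.step hs hp hq).symm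
    · exact fun X hX hs => ⟨X, hX, hs, rfl, .refl (matchedInterp.runs_map hX)⟩
  obtain ⟨Y, h5, h6, h7, h8⟩ := h4
  obtain ⟨f, h9, h10⟩ := exists_shade h5 h6
  rw [h7, h2] at h9
  -- There are no matched circles, hence nothing is shaded: no inner sections are left.
  obtain ⟨h11, h12⟩ := h10 ((isMatching_iff h).1 hw f h9)
  refine ⟨Y.outer, h11, by rw [forgetInterp_outer h6, h7, h2], ?_⟩
  have := Eqv.toGraphene_markedLink h11
  rw [h12] at this
  exact this.trans (h8.trans h3)

/-! ### Uniqueness of markings -/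

instance : Reversal Bool where
  rev i := !i
  rev_rev := Bool.not_not

/-- Two markings of the same edge give a labelled drawing in which the inner section of the edge is
the part between the two marks. This is the label in the marking number `b`. -/
def XColor.side (b : Bool) : XColor Bool → XColor Empty
  | .plain => .plain
  | .edge ε .dn => .edge ε .dn
  | .edge ε .up => .edge ε .up
  | .edge ε (.inn i) => .edge ε (if b ^^ i then .up else .dn)

namespace XColor

lemma strands_side (b : Bool) (c : XColor Bool) : (c.side b).strands = c.strands := by
  rcases c with _ | ⟨ε, _ | _ | _⟩ <;> rfl

lemma rev_side (b : Bool) (c : XColor Bool) : c.rev.side b = (c.side b).rev := by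
  rcases c with _ | ⟨ε, _ | _ | _ | _⟩ <;> cases b <;> rfl

lemma side_inj {c d : XColor Bool} (h : c.side true = d.side true) (h' : c.side false = d.side false) :
    c = d := by
  rcases c with _ | ⟨ε, _ | _ | _ | _⟩ <;> rcases d with _ | ⟨ε', _ | _ | _ | _⟩ <;>
    simp_all [side]

lemma exists_side {c d : XColor Empty} (h : c.forget = d.forget) :
    ∃ e : XColor Bool, e.side true = c ∧ e.side false = d := by
  rcases c with _ | ⟨ε, _ | _ | i⟩ <;> rcases d with _ | ⟨ε', _ | _ | j⟩ <;>
    first | exact i.elim | exact j.elim | simp only [forget, EdgeColor.matched.injEq, reduceCtorEq] at h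
  · exact ⟨.plain, rfl, rfl⟩
  · exact ⟨.edge ε .dn, rfl, by rw [h]; rfl⟩
  · exact ⟨.edge ε (.inn true), rfl, by rw [h]; rfl⟩
  · exact ⟨.edge ε (.inn false), rfl, by rw [h]; rfl⟩
  · exact ⟨.edge ε .up, rfl, by rw [h]; rfl⟩

/-- At a mark of one of the markings an inner section begins or ends. -/
lemma exists_slider {b ε : Bool} {c : XColor Bool} (h : c.side b = .edge ε .dn) :
    ∃ (e : XPiece Bool) (c' : XColor Bool), e.src = [c] ∧ e.tgt = [c'] ∧
      c'.side b = .edge ε .up ∧ c'.side (!b) = c.side (!b) ∧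
      linkWord (b ^^ ·) e = tee ε ∧ linkWord ((!b) ^^ ·) e = [] := by
  rcases c with _ | ⟨ε', _ | _ | i⟩
  · cases h
  · cases h
    exact ⟨.enter ε (!b), .edge ε (.inn !b), rfl, rfl, by cases b <;> rfl, by cases b <;> rfl,
      by cases b <;> rfl, by cases b <;> rfl⟩
  · cases h
  · have hi : i = b := by cases b <;> cases i <;> simp_all [side]
    subst hi
    have hε : ε' = ε := by simpa [side] using h
    subst hε
    exact ⟨.leave ε' i, .edge ε' .up, rfl, rfl, rfl, by cases i <;> rfl, by cases i <;> rfl,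
      by cases i <;> rfl⟩

lemma exists_piece {e₁ e₂ : XPiece Empty} {p : matchedKind.Piece} (h₁ : e₁.forget = [(0, p)])
    (h₂ : e₂.forget = [(0, p)]) {s : List (XColor Bool)}
    (hs₁ : s.map (side true) = e₁.src) (hs₂ : s.map (side false) = e₂.src) :
    ∃ e : XPiece Bool, e.src = s ∧ e.tgt.map (side true) = e₁.tgt ∧
      e.tgt.map (side false) = e₂.tgt ∧ linkWord (true ^^ ·) e = linkWord Empty.elim e₁ ∧
      linkWord (false ^^ ·) e = linkWord Empty.elim e₂ := by
  have hw : ∀ b (c : XColor Bool), linkWord Empty.elim (.cup (c.side b)) = linkWord (b ^^ ·) (.cup c) := by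
    intro b c
    rcases c with _ | ⟨ε, _ | _ | _⟩ <;> rfl
  have hw' : ∀ b (c : XColor Bool), linkWord Empty.elim (.cap (c.side b)) = linkWord (b ^^ ·) (.cap c) := by
    intro b c
    rcases c with _ | ⟨ε, _ | _ | _⟩ <;> rfl
  have hl : ∀ b c, (leg c).side b = leg c := by
    intro b c
    cases c <;> rfl
  rcases e₁ with c₁ | c₁ | ⟨c₁, d₁⟩ | g | ε | ⟨ε, i⟩ | ⟨ε, i⟩ <;>
    simp only [XPiece.forget, List.cons.injEq, Prod.mk.injEq, and_true, true_and, reduceCtorEq] at h₁ <;>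
    subst h₁ <;> rcases e₂ with c₂ | c₂ | ⟨c₂, d₂⟩ | g | ε | ⟨ε, i⟩ | ⟨ε, i⟩ <;>
    simp only [XPiece.forget, List.cons.injEq, Prod.mk.injEq, and_true, true_and, reduceCtorEq,
      Piece.cup.injEq, Piece.cap.injEq, Piece.cross.injEq, Piece.node.injEq] at h₂
  · obtain ⟨c, rfl, rfl⟩ := exists_side h₂.symm
    refine ⟨.cup c, ?_, ?_, ?_, (hw _ _).symm, (hw _ _).symm⟩
    · exact (List.map_eq_nil_iff.1 hs₁).symm
    · simp [rev_side]
    · simp [rev_side]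
  · rcases s with _ | ⟨c, _ | ⟨d, _ | ⟨d', s⟩⟩⟩ <;> simp at hs₁ hs₂
    obtain ⟨rfl, h3⟩ := hs₁
    obtain ⟨rfl, h4⟩ := hs₂
    rw [← rev_side] at h3 h4
    cases side_inj h3 h4
    exact ⟨.cap c, rfl, rfl, rfl, (hw' _ _).symm, (hw' _ _).symm⟩
  · rcases s with _ | ⟨c, _ | ⟨d, _ | ⟨d', s⟩⟩⟩ <;> simp at hs₁ hs₂
    obtain ⟨rfl, rfl⟩ := hs₁
    obtain ⟨rfl, rfl⟩ := hs₂
    refine ⟨.cross c d, rfl, rfl, rfl, ?_, ?_⟩ <;> simp only [linkWord, strands_side]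
  · subst h₂
    refine ⟨.node _, ?_, ?_, ?_, rfl, rfl⟩
    · exact (List.map_eq_nil_iff.1 hs₁).symm
    · simp [XPiece.tgt_node, hl]
    · simp [XPiece.tgt_node, hl]

end XColor

lemma linkInterp_width_side (b : Bool) (x : List (XColor Bool)) :
    markedLink.width (x.map (XColor.side b)) = (linkInterp (b ^^ ·)).width x := by
  simp only [Interp.width, linkInterp, List.flatMap_map, XColor.strands_side]

lemma XPiece.forget_eq (e : XPiece Empty) :
    (∃ ε, e = .mark ε) ∨ ∃ p, e.forget = [(0, p)] := by
  rcases e with c | c | ⟨c, d⟩ | g | ε | ⟨ε, i⟩ | ⟨ε, i⟩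
  · exact .inr ⟨_, rfl⟩
  · exact .inr ⟨_, rfl⟩
  · exact .inr ⟨_, rfl⟩
  · exact .inr ⟨_, rfl⟩
  · exact .inl ⟨_, rfl⟩
  · exact i.elim
  · exact i.elim

lemma XPiece.length_src {e : XPiece Empty} {p : matchedKind.Piece} (h : e.forget = [(0, p)]) :
    e.src.length = p.src.length := by
  rcases e with c | c | ⟨c, d⟩ | g | ε | ⟨ε, i⟩ | ⟨ε, i⟩ <;> simp [XPiece.forget] at h <;>
    subst h <;> rfl

/-- A mark of the marking number `b` is put into a common labelled drawing. -/
lemma exists_common_mark {b ε : Bool} {a : List (XColor Bool)} {x y : List (XColor Empty)}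
    (h : a.map (XColor.side b) = x ++ [.edge ε .dn] ++ y) :
    ∃ (z : List (XColor Bool)) (e : XPiece Bool) (a' : List (XColor Bool)),
      (∀ J b', XRuns a' J b' → XRuns a ((z, e) :: J) b') ∧
      a'.map (XColor.side b) = x ++ [.edge ε .up] ++ y ∧
      a'.map (XColor.side !b) = a.map (XColor.side !b) ∧
      shift ((linkInterp (b ^^ ·)).width z) (linkWord (b ^^ ·) e) =
        shift (markedLink.width x) (tee ε) ∧
      shift ((linkInterp ((!b) ^^ ·)).width z) (linkWord ((!b) ^^ ·) e) = [] := by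
  obtain ⟨z', y', rfl, h1, hy⟩ := List.map_eq_append_iff.1 h
  obtain ⟨z, s, rfl, hz, hs⟩ := List.map_eq_append_iff.1 h1
  rcases s with _ | ⟨c, _ | ⟨d, s⟩⟩ <;> simp at hs
  obtain ⟨e, c', h2, h3, h4, h5, h6, h7⟩ := XColor.exists_slider hs
  refine ⟨z, e, z ++ e.tgt ++ y', fun J b' hJ => ⟨y', by rw [h2], hJ⟩, ?_, ?_, ?_, ?_⟩
  · simp [h3, h4, hz, hy]
  · simp [h3, h5]
  · rw [h6, ← linkInterp_width_side, hz]
  · rw [h7]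
    rfl

/-- Two markings of the same matched drawing come from a common labelled drawing. -/
lemma exists_common {W₁ W₂ : Marking} {a : List (XColor Bool)}
    (h₁ : XRuns (a.map (XColor.side true)) W₁ []) (h₂ : XRuns (a.map (XColor.side false)) W₂ [])
    (h : forgetInterp.map W₁ = forgetInterp.map W₂) :
    ∃ J : XWord Bool, XRuns a J [] ∧ (linkInterp (true ^^ ·)).map J = markedLink.map W₁ ∧
      (linkInterp (false ^^ ·)).map J = markedLink.map W₂ := by
  induction hn : W₁.length + W₂.length using Nat.strong_induction_on generalizing W₁ W₂ a with
  | _ n IH =>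
  -- Leading marks of either marking become ends of inner sections.
  by_cases hm : ∃ x ε W, W₁ = (x, .mark ε) :: W
  · obtain ⟨x, ε, W, rfl⟩ := hm
    obtain ⟨y, h3, h4⟩ := h₁
    obtain ⟨z, e, a', h5, h6, h7, h8, h9⟩ := exists_common_mark h3
    obtain ⟨J, h10, h11, h12⟩ := IH (W.length + W₂.length) (by simp at hn; omega) (W₁ := W) (W₂ := W₂)
      (a := a') (by rw [h6]; exact h4) (by rw [← Bool.not_true, h7]; exact h₂) h rfl
    refine ⟨_, h5 J _ h10, ?_, ?_⟩
    · rw [Interp.map_cons, Interp.map_cons, h11]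
      exact congrArg (· ++ _) h8
    · rw [Interp.map_cons, h12]
      exact congrArg (· ++ _) h9
  by_cases hm' : ∃ x ε W, W₂ = (x, .mark ε) :: W
  · obtain ⟨x, ε, W, rfl⟩ := hm'
    obtain ⟨y, h3, h4⟩ := h₂
    obtain ⟨z, e, a', h5, h6, h7, h8, h9⟩ := exists_common_mark h3
    obtain ⟨J, h10, h11, h12⟩ := IH (W₁.length + W.length) (by simp at hn; omega) (W₁ := W₁) (W₂ := W)
      (a := a') (by rw [← Bool.not_false, h7]; exact h₁) (by rw [h6]; exact h4) h rfl
    refine ⟨_, h5 J _ h10, ?_, ?_⟩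
    · rw [Interp.map_cons, h11]
      exact congrArg (· ++ _) h9
    · rw [Interp.map_cons, Interp.map_cons, h12]
      exact congrArg (· ++ _) h8
  -- Without leading marks the first pieces of both markings have the same underlying piece.
  have hp : ∀ {x : List (XColor Empty)} {e : XPiece Empty} {W : Marking},
      (¬ ∃ x' ε W', (x, e) :: W = (x', XPiece.mark ε) :: W') →
      ∃ p, forgetInterp.word e = [(0, p)] := by
    intro x e W h
    rcases e.forget_eq with ⟨ε, rfl⟩ | h'
    · exact absurd ⟨x, ε, W, rfl⟩ h
    · exact h'
  rcases W₁ with _ | ⟨⟨x₁, e₁⟩, W₁⟩ <;> rcases W₂ with _ | ⟨⟨x₂, e₂⟩, W₂⟩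
  · exact ⟨[], by simpa [XRuns] using h₁, rfl, rfl⟩
  · obtain ⟨p, hp⟩ := hp hm'
    simp [hp] at h
  · obtain ⟨p, hp⟩ := hp hm
    simp [hp] at h
  · obtain ⟨p, hp₁⟩ := hp hm
    obtain ⟨q, hp₂⟩ := hp hm'
    simp only [Interp.map_cons, hp₁, hp₂, forgetInterp_width, shift_cons, shift_nil,
      List.cons_append, List.nil_append, List.cons.injEq, Prod.mk.injEq, Nat.add_zero] at h
    obtain ⟨⟨hx, rfl⟩, h⟩ := h
    obtain ⟨y₁, h3, h₁⟩ := h₁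
    obtain ⟨y₂, h4, h₂⟩ := h₂
    simp only at h3 h4 h₁ h₂
    have hl : e₁.src.length = e₂.src.length := by
      rw [XPiece.length_src hp₁, XPiece.length_src hp₂]
    obtain ⟨z', y, rfl, h5, hy₁⟩ := List.map_eq_append_iff.1 h3
    obtain ⟨z, s, rfl, hz₁, hs₁⟩ := List.map_eq_append_iff.1 h5
    have hz : z.length = x₁.length := by rw [← hz₁, List.length_map]
    have hs : s.length = e₁.src.length := by rw [← hs₁, List.length_map]
    simp only [List.map_append] at h4
    obtain ⟨h4, hy₂⟩ := List.append_inj h4 (by simp [hz, hs, hx, hl])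
    obtain ⟨hz₂, hs₂⟩ := List.append_inj h4 (by simp [hz, hx])
    obtain ⟨e, rfl, ht₁, ht₂, hw₁, hw₂⟩ := XColor.exists_piece hp₁ hp₂ hs₁ hs₂
    obtain ⟨J, h10, h11, h12⟩ := IH (W₁.length + W₂.length) (by simp at hn; omega) (W₁ := W₁)
      (W₂ := W₂) (a := z ++ e.tgt ++ y) (by simpa [ht₁, hz₁, hy₁] using h₁)
      (by simpa [ht₂, hz₂, hy₂] using h₂) h rfl
    refine ⟨(z, e) :: J, ⟨y, rfl, h10⟩, ?_, ?_⟩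
    · rw [Interp.map_cons, Interp.map_cons, h11, ← linkInterp_width_side, hz₁]
      exact congrArg (fun w => shift _ w ++ _) hw₁
    · rw [Interp.map_cons, Interp.map_cons, h12, ← linkInterp_width_side, hz₂]
      exact congrArg (fun w => shift _ w ++ _) hw₂

/-- All markings of a matched diagram lead to equivalent link diagrams. -/
theorem Eqv.markedLink {W₁ W₂ : Marking} (h₁ : XRuns [] W₁ []) (h₂ : XRuns [] W₂ [])
    (h : forgetInterp.map W₁ = forgetInterp.map W₂) :
    Eqv LinkMove [] [] (markedLink.map W₁) (markedLink.map W₂) := by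
  obtain ⟨J, h3, h4, h5⟩ := exists_common (a := []) h₁ h₂ h
  rw [← h4, ← h5]
  clear h4 h5
  have hf : ∀ b i : Bool, (b ^^ Reversal.rev i) = !(b ^^ i) := by decide
  revert J
  refine slide_induction ?_ ?_
  · intro p q l r x y a b hs hp hq ih
    -- The interpretations draw the crossing at one end of an inner section or at the other end,
    -- and both drawings do not change if the inner section shrinks.
    exact ((linkInterp_lawful (hf true)).step hs hp hq).trans
      (ih.trans ((linkInterp_lawful (hf false)).step hs hp hq).symm)
  · intro J hJ hs
    have : (linkInterp (true ^^ ·)).map J = (linkInterp (false ^^ ·)).map J := by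
      clear hJ
      induction J with
      | nil => rfl
      | cons s J ih =>
        have h1 : linkWord (true ^^ ·) s.2 = linkWord (false ^^ ·) s.2 := by
          have := hs s (by simp)
          rcases h2 : s.2 with (_ | _) | (_ | _) | _ | _ | _ | _ | _ <;>
            simp_all [XPiece.IsSlider, linkWord]
        rw [Interp.map_cons, Interp.map_cons, ih fun s hs' => hs s (by simp [hs'])]
        exact congrArg (fun w => shift _ w ++ _) h1
    rw [this]
    exact .refl (Interp.runs_map _ hJ)

/-! ### Markings of a part of a diagram -/

/-- The strand `c` becomes the strand `d` at a mark, or without a mark. -/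
inductive XColor.Raise : XColor Empty → XColor Empty → Prop
  | refl (c : XColor Empty) : Raise c c
  | mark (ε : Bool) : Raise (.edge ε .dn) (.edge ε .up)

/-- Some strands become others at some marks. -/
abbrev RaiseList : List (XColor Empty) → List (XColor Empty) → Prop := List.Forall₂ XColor.Raise

lemma XColor.Raise.trans {c d e : XColor Empty} (h : c.Raise d) (h' : d.Raise e) : c.Raise e := by
  cases h with
  | refl => exact h'
  | mark ε => cases h'; exact .mark ε

lemma XColor.Raise.forget_eq {c d : XColor Empty} (h : c.Raise d) : c.forget = d.forget := by
  cases h <;> rfl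

namespace RaiseList

variable {a b c d : List (XColor Empty)}

lemma refl (a : List (XColor Empty)) : RaiseList a a := by
  induction a with
  | nil => exact .nil
  | cons c a ih => exact .cons (.refl c) ih

lemma trans (h : RaiseList a b) (h' : RaiseList b c) : RaiseList a c := by
  induction h generalizing c with
  | nil => exact h'
  | cons h1 _ ih =>
    cases h' with
    | cons h3 h4 => exact .cons (h1.trans h3) (ih h4)

lemma forget_eq (h : RaiseList a b) : a.map XColor.forget = b.map XColor.forget := by
  induction h with
  | nil => rfl
  | cons h1 _ ih => rw [List.map_cons, List.map_cons, ih, h1.forget_eq]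

lemma append (h : RaiseList a b) (h' : RaiseList c d) : RaiseList (a ++ c) (b ++ d) :=
  List.rel_append h h'

lemma exists_of_append (h : RaiseList (a ++ b) c) :
    ∃ a' b', c = a' ++ b' ∧ RaiseList a a' ∧ RaiseList b b' := by
  induction a generalizing c with
  | nil => exact ⟨[], c, rfl, .nil, h⟩
  | cons x a ih =>
    cases h with
    | cons h1 h2 =>
      obtain ⟨a', b', rfl, h3, h4⟩ := ih h2
      exact ⟨_ :: a', b', rfl, .cons h1 h3, h4⟩

lemma of_append (h : RaiseList (a ++ b) (c ++ d)) (hl : a.length = c.length) :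
    RaiseList a c ∧ RaiseList b d := by
  obtain ⟨a', b', h1, h2, h3⟩ := h.exists_of_append
  obtain ⟨rfl, rfl⟩ := List.append_inj h1 (by rw [← h2.length_eq, hl])
  exact ⟨h2, h3⟩

/-- The marks at which some strands are changed. -/
lemma exists_marks (h : RaiseList a b) (x : List (XColor Empty)) :
    ∃ R : Marking, XRuns (x ++ a) R (x ++ b) ∧ forgetInterp.map R = [] := by
  induction h generalizing x with
  | nil => exact ⟨[], rfl, rfl⟩
  | @cons c d l l' h _ ih =>
    obtain ⟨R, h1, h2⟩ := ih (x ++ [d])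
    cases h with
    | refl => exact ⟨R, by simpa using h1, h2⟩
    | mark ε => exact ⟨(x, .mark ε) :: R, ⟨l, by simp, by simpa using h1⟩, h2⟩

end RaiseList

namespace XPiece

variable {e : XPiece Empty} {p : matchedKind.Piece}

lemma map_forget_src (h : e.forget = [(0, p)]) : e.src.map XColor.forget = p.src := by
  have hr : ∀ c : XColor Empty, c.rev.forget = c.forget := by rintro (_ | _) <;> rfl
  rcases e with c | c | ⟨c, d⟩ | g | ε | ⟨ε, i⟩ | ⟨ε, i⟩ <;> simp [forget] at h <;>
    subst h <;> simp [Piece.src, hr]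

lemma map_forget_tgt (h : e.forget = [(0, p)]) : e.tgt.map XColor.forget = p.tgt := by
  have hr : ∀ c : XColor Empty, c.rev.forget = c.forget := by rintro (_ | _) <;> rfl
  have hl : ∀ c, (XColor.leg c : XColor Empty).forget = c := by rintro (_ | _) <;> rfl
  rcases e with c | c | ⟨c, d⟩ | g | ε | ⟨ε, i⟩ | ⟨ε, i⟩ <;> simp [forget] at h <;>
    subst h <;> simp [Piece.tgt, tgt_node, hr, hl]

lemma forget_eq_cup {c : EdgeColor} :
    e.forget = [(0, .cup c)] ↔ ∃ d : XColor Empty, d.forget = c ∧ e = .cup d := by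
  cases e <;> simp [forget]

lemma forget_eq_cap {c : EdgeColor} :
    e.forget = [(0, .cap c)] ↔ ∃ d : XColor Empty, d.forget = c ∧ e = .cap d := by
  cases e <;> simp [forget]

lemma forget_eq_cross {c c' : EdgeColor} : e.forget = [(0, .cross c c')] ↔
    ∃ d d' : XColor Empty, d.forget = c ∧ d'.forget = c' ∧ e = .cross d d' := by
  cases e <;> simp [forget]

lemma forget_eq_node {g : MatchedVertex} : e.forget = [(0, .node g)] ↔ e = .node g := by
  cases e <;> simp [forget]

end XPiece

/-- There is a marking of the drawing `w` with the labels `A` at the upper boundary and `B` at the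
lower boundary. -/
def Markable : List (XColor Empty) → matchedKind.Word → List (XColor Empty) → Prop
  | A, [], B => RaiseList A B
  | A, s :: w, B => ∃ (x : List (XColor Empty)) (e : XPiece Empty) (y : List (XColor Empty)),
      x.length = s.1 ∧ e.forget = [(0, s.2)] ∧ RaiseList A (x ++ e.src ++ y) ∧
        Markable (x ++ e.tgt ++ y) w B

namespace Markable

variable {A B C : List (XColor Empty)} {u w : matchedKind.Word}

lemma raise {A B C : List (XColor Empty)} {w : matchedKind.Word} (h : RaiseList A B)
    (h' : Markable B w C) : Markable A w C := by
  cases w with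
  | nil => exact h.trans h'
  | cons s w =>
    obtain ⟨x, e, y, h1, h2, h3, h4⟩ := h'
    exact ⟨x, e, y, h1, h2, h.trans h3, h4⟩

lemma of_xruns {W : Marking} (h : XRuns A W B) : Markable A (forgetInterp.map W) B := by
  induction W generalizing A with
  | nil =>
    cases h
    exact RaiseList.refl _
  | cons s W ih =>
    obtain ⟨x, e⟩ := s
    obtain ⟨y, rfl, h⟩ := h
    rw [Interp.map_cons, forgetInterp_width]
    rcases e.forget_eq with ⟨ε, rfl⟩ | ⟨p, hp⟩
    · refine raise (B := x ++ [.edge ε .up] ++ y) ?_ (ih h)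
      exact ((RaiseList.refl x).append (.cons (.mark ε) .nil)).append (.refl y)
    · have : forgetInterp.word e = [(0, p)] := hp
      rw [this]
      exact ⟨x, e, y, by simp, hp, .refl _, ih h⟩

lemma exists_marking (h : Markable A w B) :
    ∃ W : Marking, XRuns A W B ∧ forgetInterp.map W = w := by
  induction w generalizing A with
  | nil => simpa using RaiseList.exists_marks h []
  | cons s w ih =>
    obtain ⟨x, e, y, h1, h2, h3, h4⟩ := h
    obtain ⟨R, h5, h6⟩ := h3.exists_marks []
    obtain ⟨W, h7, h8⟩ := ih h4
    refine ⟨R ++ (x, e) :: W, XRuns.append (by simpa using h5) ⟨y, rfl, h7⟩, ?_⟩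
    have : forgetInterp.word e = [(0, s.2)] := h2
    rw [Interp.map_append, h6, Interp.map_cons, h8, forgetInterp_width, this]
    simp [h1]

lemma of_append (h : Markable A (u ++ w) C) : ∃ B, Markable A u B ∧ Markable B w C := by
  induction u generalizing A with
  | nil => exact ⟨A, RaiseList.refl A, h⟩
  | cons s u ih =>
    obtain ⟨x, e, y, h1, h2, h3, h4⟩ := h
    obtain ⟨B, h5, h6⟩ := ih h4
    exact ⟨B, ⟨x, e, y, h1, h2, h3, h5⟩, h6⟩

lemma map_forget {α β : List matchedKind.Color} (h : Markable A w B) (hA : A.map XColor.forget = α)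
    (hw : Runs α w β) : B.map XColor.forget = β := by
  induction w generalizing A α with
  | nil =>
    cases hw
    rw [← hA]
    exact (RaiseList.forget_eq h).symm
  | cons s w ih =>
    obtain ⟨x, e, y, h1, h2, h3, h4⟩ := h
    obtain ⟨_, ⟨x', y', h5, rfl, rfl⟩, hw⟩ := hw
    refine ih h4 ?_ hw
    rw [h3.forget_eq, List.map_append, List.map_append, XPiece.map_forget_src h2] at hA
    obtain ⟨h6, rfl⟩ := List.append_inj hA (by simp [h1, h5])
    obtain ⟨rfl, -⟩ := List.append_inj h6 (by simp [h1, h5])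
    simp [XPiece.map_forget_tgt h2]

/-- A marking of a drawing with further strands on both sides consists of a marking of the
drawing and of marks on the further strands. -/
lemma strip {α β : List matchedKind.Color} {x y : List (XColor Empty)}
    (h : Markable (x ++ A ++ y) (shift x.length w) B) (hA : A.map XColor.forget = α)
    (hw : Runs α w β) :
    ∃ x' b y', B = x' ++ b ++ y' ∧ RaiseList x x' ∧ RaiseList y y' ∧ Markable A w b := by
  induction w generalizing x A y α with
  | nil =>
    obtain ⟨z, y', rfl, h1, h2⟩ := RaiseList.exists_of_append h
    obtain ⟨x', b, rfl, h3, h4⟩ := h1.exists_of_append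
    exact ⟨x', b, y', rfl, h3, h2, h4⟩
  | cons s w ih =>
    obtain ⟨z, e, v, h1, h2, h3, h4⟩ := h
    obtain ⟨_, ⟨x', y', h5, rfl, rfl⟩, hw⟩ := hw
    obtain ⟨z₁, y₁, h6, h7, h8⟩ := h3.exists_of_append
    obtain ⟨x₁, a₁, rfl, h9, h10⟩ := h7.exists_of_append
    rw [h10.forget_eq] at hA
    obtain ⟨z₂, y₂, rfl, h11, hy₂⟩ := List.map_eq_append_iff.1 hA
    obtain ⟨x₂, s₂, rfl, hx₂, hs₂⟩ := List.map_eq_append_iff.1 h11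
    have hl : s₂.length = e.src.length := by
      rw [← List.length_map (f := XColor.forget), hs₂, ← XPiece.map_forget_src h2, List.length_map]
    have hx : z.length = (x₁ ++ x₂).length := by
      have h12 : x₂.length = s.1 := by rw [← h5, ← hx₂, List.length_map]
      simp only at h1
      rw [h1, List.length_append, h12, h9.length_eq]
    rw [show x₁ ++ (x₂ ++ s₂ ++ y₂) ++ y₁ = (x₁ ++ x₂) ++ s₂ ++ (y₂ ++ y₁) by simp] at h6
    obtain ⟨h13, rfl⟩ := List.append_inj h6 (by simp [hx, hl, Nat.add_assoc])
    obtain ⟨rfl, rfl⟩ := List.append_inj h13 hx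
    have h14 : Markable (x₁ ++ (x₂ ++ e.tgt ++ y₂) ++ y₁) (shift x₁.length w) B := by
      rw [← h9.length_eq]
      simpa [shift] using h4
    obtain ⟨x₃, b, y₃, rfl, h15, h16, h17⟩ := ih h14
      (by simp [hx₂, hy₂, XPiece.map_forget_tgt h2]) hw
    exact ⟨x₃, b, y₃, rfl, h9.trans h15, h8.trans h16, x₂, e, y₂,
      by rw [← h5, ← hx₂, List.length_map], h2, h10, h17⟩

end Markable

/-- The drawings `u` and `v` have markings which lead to equivalent link diagrams and which
fit between the boundary labels `A` and `B` up to some marks at the boundaries. -/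
def Follows (A B : List (XColor Empty)) (u v : matchedKind.Word) : Prop :=
  ∃ (a b : List (XColor Empty)) (U V : Marking), RaiseList A a ∧ RaiseList b B ∧
    XRuns a U b ∧ XRuns a V b ∧ forgetInterp.map U = u ∧ forgetInterp.map V = v ∧
    Eqv LinkMove (a.flatMap XColor.strands) (b.flatMap XColor.strands)
      (markedLink.map U) (markedLink.map V)

/-- If the markings of a part `u` of a diagram can be carried over to `v`, then the diagrams that contain
`u` and `v` in the same place have markings with equivalent link diagrams. The marks outside of the
part are the same in both, and further marks are put on its boundary. -/
lemma Follows.exists_marking {p q u v : matchedKind.Word} {x y α β : List matchedKind.Color}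
    {W : Marking} (h : ∀ A B, A.map XColor.forget = α → Markable A u B → Follows A B u v)
    (hp : Runs [] p (x ++ α ++ y)) (hu : Runs α u β) (hW : XRuns [] W [])
    (hW' : forgetInterp.map W = p ++ (shift x.length u ++ q)) :
    ∃ U V : Marking, XRuns [] U [] ∧ XRuns [] V [] ∧
      forgetInterp.map U = p ++ (shift x.length u ++ q) ∧
      forgetInterp.map V = p ++ (shift x.length v ++ q) ∧
      Eqv LinkMove [] [] (markedLink.map U) (markedLink.map V) := by
  have h1 := Markable.of_xruns hW
  rw [hW'] at h1
  obtain ⟨A, h2, h3⟩ := h1.of_append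
  obtain ⟨B, h4, h5⟩ := h3.of_append
  obtain ⟨z, y₁, rfl, h6, rfl⟩ := List.map_eq_append_iff.1 (h2.map_forget rfl hp)
  obtain ⟨x₁, A, rfl, rfl, hA⟩ := List.map_eq_append_iff.1 h6
  rw [List.length_map] at h4 ⊢
  obtain ⟨x₂, B, y₂, rfl, hx, hy, h7⟩ := h4.strip hA hu
  obtain ⟨a, b, U, V, h8, h9, h10, h11, rfl, rfl, h12⟩ := h A B hA h7
  obtain ⟨P, h13, rfl⟩ := h2.exists_marking
  obtain ⟨Q, h14, rfl⟩ := h5.exists_marking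
  obtain ⟨R, h15, h16⟩ := ((hx.append h8).append hy).exists_marks []
  obtain ⟨R', h17, h18⟩ := (((RaiseList.refl x₂).append h9).append (.refl y₂)).exists_marks []
  rw [List.nil_append, List.nil_append] at h15 h17
  refine ⟨P ++ (R ++ (U.lift x₂ ++ (R' ++ Q))), P ++ (R ++ (V.lift x₂ ++ (R' ++ Q))),
    h13.append (h15.append ((h10.lift x₂ y₂).append (h17.append h14))),
    h13.append (h15.append ((h11.lift x₂ y₂).append (h17.append h14))), ?_, ?_, ?_⟩
  · simp only [Interp.map_append, Interp.map_lift, h16, h18, forgetInterp_width, hx.length_eq,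
      List.nil_append]
  · simp only [Interp.map_append, Interp.map_lift, h16, h18, forgetInterp_width, hx.length_eq,
      List.nil_append]
  · have h19 := h12.whisker (x₂.flatMap XColor.strands) (y₂.flatMap XColor.strands)
    have h20 := markedLink.runs_map (h13.append h15)
    have h21 := markedLink.runs_map (h17.append h14)
    have hc : markedLink.col = XColor.strands := rfl
    simp only [List.flatMap_append, hc, Interp.map_append, List.flatMap_nil] at h20 h21
    have h22 := (h19.left h20).right h21
    simpa [Interp.map_lift, Interp.width, hc] using h22

lemma forget_rev (c : XColor Empty) : c.rev.forget = c.forget := by rcases c with _ | _ <;> rfl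

lemma forget_leg (c : EdgeColor) : (XColor.leg c : XColor Empty).forget = c := by
  rcases c with _ | _ <;> rfl

/-- Every strand of a marking is drawn as one strand or as two parallel strands, regardless of the
labels. -/
lemma Empty.strands_induction {P : XColor Empty → Prop} (plain : P .plain)
    (edge : ∀ ε, P (.edge ε .dn)) (edge' : ∀ ε, P (.edge ε .up)) (c : XColor Empty) : P c := by
  rcases c with _ | ⟨ε, _ | _ | i⟩
  exacts [plain, edge ε, edge' ε, i.elim]

/-- The marks that precede the first piece of a drawing can be postponed, except those on the
strands that enter the piece. -/
lemma Markable.exists_piece {x s y B : List (XColor Empty)} {p : matchedKind.Piece}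
    {w : matchedKind.Word} {k : ℕ} (h : Markable (x ++ s ++ y) ((k, p) :: w) B) (hk : x.length = k)
    (hs : s.length = p.src.length) :
    ∃ e : XPiece Empty, e.forget = [(0, p)] ∧ RaiseList s e.src ∧ Markable (x ++ e.tgt ++ y) w B := by
  obtain ⟨x', e, y', hx, he, h1, h2⟩ := h
  have hl := congrArg List.length (XPiece.map_forget_src he)
  rw [List.length_map] at hl
  obtain ⟨h3, h4⟩ := h1.of_append (by simp [hk, hx, hs, hl])
  obtain ⟨h5, h6⟩ := h3.of_append (by simp [hk, hx])
  exact ⟨e, he, h6, h2.raise ((h5.append (.refl _)).append h4)⟩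

lemma follows_exchange (e e' : matchedKind.Piece) (z : List EdgeColor) (A B : List (XColor Empty))
    (hA : A.map XColor.forget = e.src ++ z ++ e'.src)
    (h : Markable A [(0, e), (e.tgt.length + z.length, e')] B) :
    Follows A B [(0, e), (e.tgt.length + z.length, e')]
      [(e.src.length + z.length, e'), (0, e)] := by
  obtain ⟨A', s', rfl, h1, hs'⟩ := List.map_eq_append_iff.1 hA
  obtain ⟨s, z, rfl, hs, rfl⟩ := List.map_eq_append_iff.1 h1
  rw [List.length_map] at h ⊢
  obtain ⟨f, hf, h2, h3⟩ := Markable.exists_piece (x := []) (s := s) (y := z ++ s') (by simpa using h)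
    rfl (by rw [← hs, List.length_map])
  have htgt := congrArg List.length (XPiece.map_forget_tgt hf)
  have hsrc := congrArg List.length (XPiece.map_forget_src hf)
  rw [List.length_map] at htgt hsrc
  obtain ⟨f', hf', h4, h5⟩ := Markable.exists_piece (x := f.tgt ++ z) (s := s') (y := [])
    (by simpa using h3) (by simp [htgt]) (by rw [← hs', List.length_map])
  have h7 : forgetInterp.word f = [(0, e)] := hf
  have h8 : forgetInterp.word f' = [(0, e')] := hf'
  refine ⟨f.src ++ z ++ f'.src, f.tgt ++ z ++ f'.tgt, [([], f), (f.tgt ++ z, f')],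
    [(f.src ++ z, f'), ([], f)], (h2.append (.refl z)).append h4, by simpa [Markable] using h5,
    ⟨z ++ f'.src, by simp, [], by simp, by simp [XRuns]⟩,
    ⟨[], by simp, z ++ f'.tgt, by simp, by simp [XRuns]⟩, ?_, ?_, ?_⟩
  · simp [h7, h8, forgetInterp_width, htgt]
  · simp [h7, h8, forgetInterp_width, hsrc]
  · have h9 := Eqv.interchange (Q := LinkMove) (markedLink.runs f)
      ((markedLink.runs f').whisker (z.flatMap markedLink.col) [])
    have hc : markedLink.col = XColor.strands := rfl
    simpa [Interp.width, shift_shift, hc] using h9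

lemma markable_passRight {c : XColor Empty} {c' : EdgeColor} {x l y B : List (XColor Empty)}
    (h : Markable (x ++ c :: l ++ y) (passRight c' x.length (l.map XColor.forget)) B) :
    RaiseList (x ++ l ++ c :: y) B := by
  induction l generalizing x with
  | nil => simpa [passRight, Markable] using h
  | cons d l ih =>
    obtain ⟨e, he, h1, h2⟩ := Markable.exists_piece (x := x) (s := [c, d]) (y := l ++ y)
      (by simpa [passRight] using h) rfl rfl
    obtain ⟨c₁, d₁, -, -, rfl⟩ := XPiece.forget_eq_cross.1 he
    have hx : x.length + 1 = (x ++ [d]).length := by simp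
    rw [hx] at h2
    have h3 : RaiseList (x ++ [d] ++ c :: l ++ y) (x ++ [d₁, c₁] ++ (l ++ y)) := by
      obtain ⟨h4, h5⟩ := List.forall₂_cons.1 h1
      obtain ⟨h5, -⟩ := List.forall₂_cons.1 h5
      simpa using (RaiseList.refl x).append (.cons h5 (.cons h4 (RaiseList.refl (l ++ y))))
    simpa using ih (h2.raise h3)

/-- A strand of a marking runs to the right across the strands `l`. -/
def XWord.passRight (c : XColor Empty) : List (XColor Empty) → List (XColor Empty) → Marking
  | _, [] => []
  | x, d :: l => (x, .cross c d) :: passRight c (x ++ [d]) l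

/-- A strand of a marking runs to the left across the strands `l`. -/
def XWord.passLeft (c : XColor Empty) : List (XColor Empty) → List (XColor Empty) → Marking
  | _, [] => []
  | x, d :: l => passLeft c (x ++ [d]) l ++ [(x, .cross d c)]

lemma XWord.runs_passRight (c : XColor Empty) (x l y : List (XColor Empty)) :
    XRuns (x ++ c :: l ++ y) (passRight c x l) (x ++ l ++ c :: y) := by
  induction l generalizing x with
  | nil => simp [XRuns, passRight]
  | cons d l ih => exact ⟨l ++ y, by simp, by simpa using ih (x ++ [d])⟩

lemma XWord.runs_passLeft (c : XColor Empty) (x l y : List (XColor Empty)) :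
    XRuns (x ++ l ++ c :: y) (passLeft c x l) (x ++ c :: l ++ y) := by
  induction l generalizing x with
  | nil => simp [XRuns, passLeft]
  | cons d l ih =>
    refine XRuns.append (b := x ++ [d] ++ c :: l ++ y) (by simpa using ih (x ++ [d])) ?_
    exact ⟨l ++ y, by simp, by simp [XRuns]⟩

lemma forget_passRight (c : XColor Empty) (x l : List (XColor Empty)) :
    forgetInterp.map (XWord.passRight c x l) =
      passRight c.forget x.length (l.map XColor.forget) := by
  induction l generalizing x with
  | nil => rfl
  | cons d l ih =>
    rw [XWord.passRight, Interp.map_cons, ih, forgetInterp_width]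
    simp [passRight, forgetInterp, XPiece.forget]

lemma forget_passLeft (c : XColor Empty) (x l : List (XColor Empty)) :
    forgetInterp.map (XWord.passLeft c x l) =
      passLeft c.forget x.length (l.map XColor.forget) := by
  induction l generalizing x with
  | nil => rfl
  | cons d l ih =>
    rw [XWord.passLeft, Interp.map_append, ih, Interp.map_cons, forgetInterp_width]
    simp [passLeft, forgetInterp, XPiece.forget]

lemma eqv_markedLink_pass (c : XColor Empty) (a ε : Bool) (i : Fin 3) (n : Fin 4) :
    Eqv LinkMove ([c].flatMap XColor.strands)
      ((((matchedKind.legs ⟨a, ε, i⟩).map XColor.leg).take n ++ c ::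
        ((matchedKind.legs ⟨a, ε, i⟩).map XColor.leg).drop n : List (XColor Empty)).flatMap XColor.strands)
      (markedLink.map (([c], .node ⟨a, ε, i⟩) ::
        XWord.passRight c [] (((matchedKind.legs ⟨a, ε, i⟩).map XColor.leg).take n)))
      (markedLink.map (([], .node ⟨a, ε, i⟩) ::
        XWord.passLeft c (((matchedKind.legs ⟨a, ε, i⟩).map XColor.leg).take n)
          (((matchedKind.legs ⟨a, ε, i⟩).map XColor.leg).drop n))) := by
  induction c using Empty.strands_induction with
  | plain => exact .of_nf (by revert a ε i n; decide +kernel)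
  | edge δ => exact .of_nf (by revert δ a ε i n; decide +kernel)
  | edge' δ => exact .of_nf (by revert δ a ε i n; decide +kernel)

lemma eqv_markedLink_triangle (c d e : XColor Empty) :
    Eqv LinkMove ([c, d, e].flatMap XColor.strands) ([e, d, c].flatMap XColor.strands)
      (markedLink.map [([], .cross c d), ([d], .cross c e), ([], .cross d e)])
      (markedLink.map [([c], .cross d e), ([], .cross c e), ([e], .cross c d)]) := by
  induction c using Empty.strands_induction <;> induction d using Empty.strands_induction <;>
    induction e using Empty.strands_induction <;> exact .of_nf (by decide +revert +kernel)

lemma follows_slideCup (c d : EdgeColor) (A B : List (XColor Empty))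
    (hA : A.map XColor.forget = [d]) (h : Markable A [(1, .cup c), (0, .cross d c)] B) :
    Follows A B [(1, .cup c), (0, .cross d c)] [(0, .cup c), (1, .cross c d)] := by
  obtain ⟨d, rfl, rfl⟩ := List.map_eq_singleton_iff.1 hA
  obtain ⟨e, he, h1, h2⟩ := Markable.exists_piece (x := [d]) (s := []) (y := []) h rfl rfl
  obtain ⟨c, rfl, rfl⟩ := XPiece.forget_eq_cup.1 he
  obtain ⟨e, he, h3, h4⟩ := Markable.exists_piece (x := []) (s := [d, c]) (y := [c.rev]) h2 rfl rfl
  obtain ⟨d₁, c₁, -, -, rfl⟩ := XPiece.forget_eq_cross.1 he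
  obtain ⟨h5, h6⟩ := List.forall₂_cons.1 h3
  obtain ⟨h6, -⟩ := List.forall₂_cons.1 h6
  refine ⟨[d], [c, d, c.rev], [([d], .cup c), ([], .cross d c)],
    [([], .cup c), ([c], .cross c.rev d)], .refl _,
    RaiseList.trans (.cons h6 (.cons h5 (RaiseList.refl _))) h4,
    ⟨[], rfl, [c.rev], rfl, rfl⟩, ⟨[d], rfl, [], rfl, rfl⟩, rfl, ?_, ?_⟩
  · simp [forgetInterp, Interp.width, XPiece.forget, forget_rev]
  · clear * -
    induction c using Empty.strands_induction <;> induction d using Empty.strands_induction <;>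
      exact .of_nf (by decide +revert +kernel)

lemma follows_slideCap (c d : EdgeColor) (A B : List (XColor Empty))
    (hA : A.map XColor.forget = [c, d, c]) (h : Markable A [(0, .cross c d), (1, .cap c)] B) :
    Follows A B [(0, .cross c d), (1, .cap c)] [(1, .cross d c), (0, .cap c)] := by
  obtain ⟨c, A, rfl, rfl, h0⟩ := List.map_eq_cons_iff.1 hA
  obtain ⟨d, A, rfl, rfl, h0'⟩ := List.map_eq_cons_iff.1 h0
  obtain ⟨c', rfl, hc⟩ := List.map_eq_singleton_iff.1 h0'
  obtain ⟨e, he, h1, h2⟩ := Markable.exists_piece (x := []) (s := [c, d]) (y := [c']) h rfl rfl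
  obtain ⟨c₁, d₁, -, -, rfl⟩ := XPiece.forget_eq_cross.1 he
  obtain ⟨h3, h4⟩ := List.forall₂_cons.1 h1
  obtain ⟨h4, -⟩ := List.forall₂_cons.1 h4
  obtain ⟨e, he, h5, h6⟩ := Markable.exists_piece (x := [d₁]) (s := [c₁, c']) (y := []) h2 rfl rfl
  obtain ⟨c₂, h7, rfl⟩ := XPiece.forget_eq_cap.1 he
  obtain ⟨h8, h9⟩ := List.forall₂_cons.1 h5
  rw [← h7]
  -- All marks on the strands of the minimum are moved up to the boundary.
  refine ⟨[c₂, d₁, c₂.rev], [d₁], [([], .cross c₂ d₁), ([d₁], .cap c₂)],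
    [([c₂], .cross d₁ c₂.rev), ([], .cap c₂)], .cons (h3.trans h8) (.cons h4 h9), h6,
    ⟨[c₂.rev], rfl, [], rfl, rfl⟩, ⟨[], rfl, [d₁], rfl, rfl⟩, ?_, ?_, ?_⟩
  · simp [forgetInterp, Interp.width, XPiece.forget, h4.forget_eq]
  · simp [forgetInterp, Interp.width, XPiece.forget, forget_rev, h4.forget_eq]
  · clear * -
    induction c₂ using Empty.strands_induction <;> induction d₁ using Empty.strands_induction <;>
      exact .of_nf (by decide +revert +kernel)

lemma follows_triangle (c d e : EdgeColor) (A B : List (XColor Empty))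
    (hA : A.map XColor.forget = [c, d, e])
    (h : Markable A [(0, .cross c d), (1, .cross c e), (0, .cross d e)] B) :
    Follows A B [(0, .cross c d), (1, .cross c e), (0, .cross d e)]
      [(1, .cross d e), (0, .cross c e), (1, .cross c d)] := by
  obtain ⟨c, A, rfl, rfl, h0⟩ := List.map_eq_cons_iff.1 hA
  obtain ⟨d, A, rfl, rfl, h0'⟩ := List.map_eq_cons_iff.1 h0
  obtain ⟨e, rfl, rfl⟩ := List.map_eq_singleton_iff.1 h0'
  have key : ∀ {x y : List (XColor Empty)} {c d : XColor Empty} {w : matchedKind.Word},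
      Markable (x ++ [c, d] ++ y) ((x.length, .cross c.forget d.forget) :: w) B →
      Markable (x ++ [d, c] ++ y) w B := by
    intro x y c d w h
    obtain ⟨f, hf, h1, h2⟩ := h.exists_piece rfl rfl
    obtain ⟨c₁, d₁, -, -, rfl⟩ := XPiece.forget_eq_cross.1 hf
    obtain ⟨h3, h4⟩ := List.forall₂_cons.1 h1
    obtain ⟨h4, -⟩ := List.forall₂_cons.1 h4
    exact h2.raise (((RaiseList.refl x).append (.cons h4 (.cons h3 .nil))).append (.refl y))
  have h1 := key (x := []) (y := [e]) h
  have h2 := key (x := [d]) (y := []) h1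
  have h3 := key (x := []) (y := [c]) h2
  exact ⟨_, _, [([], .cross c d), ([d], .cross c e), ([], .cross d e)],
    [([c], .cross d e), ([], .cross c e), ([e], .cross c d)], .refl _, h3,
    ⟨[e], rfl, [], rfl, [c], rfl, rfl⟩, ⟨[], rfl, [d], rfl, [], rfl, rfl⟩, rfl, rfl,
    eqv_markedLink_triangle c d e⟩

lemma follows_pass (c : EdgeColor) (g : MatchedVertex) (l₁ l₂ : List EdgeColor)
    (hg : matchedKind.legs g = l₁ ++ l₂) (A B : List (XColor Empty))
    (hA : A.map XColor.forget = [c]) (h : Markable A ((1, .node g) :: passRight c 0 l₁) B) :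
    Follows A B ((1, .node g) :: passRight c 0 l₁) ((0, .node g) :: passLeft c l₁.length l₂) := by
  obtain ⟨c, rfl, rfl⟩ := List.map_eq_singleton_iff.1 hA
  obtain ⟨e, he, h1, h2⟩ := Markable.exists_piece (x := [c]) (s := []) (y := []) h rfl rfl
  cases XPiece.forget_eq_node.1 he
  have hl : ∀ l : List EdgeColor, (l.map (XColor.leg (I := Empty))).map XColor.forget = l := by
    intro l
    simp [Function.comp_def, forget_leg]
  have h3 := markable_passRight (c := c) (c' := c.forget) (x := []) (l := l₁.map XColor.leg)
    (y := l₂.map XColor.leg) (B := B) (by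
      rw [hl]
      rw [XPiece.tgt_node, hg] at h2
      simpa using h2)
  have hn : l₁.length < 4 := by
    have := congrArg List.length hg
    simp at this
    omega
  have h8 := eqv_markedLink_pass c g.solid g.sign g.pos ⟨l₁.length, hn⟩
  have hlegs : (matchedKind.legs g).map (XColor.leg (I := Empty)) =
      l₁.map XColor.leg ++ l₂.map XColor.leg := by rw [hg, List.map_append]
  have hlen : l₁.length = (l₁.map (XColor.leg (I := Empty))).length := by simp
  simp only [hlegs] at h8
  rw [hlen, List.take_left, List.drop_left] at h8
  refine ⟨[c], l₁.map XColor.leg ++ c :: l₂.map XColor.leg, _, _, .refl [c], ?_, ?_, ?_, ?_, ?_, h8⟩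
  · simpa using h3
  · refine ⟨[], rfl, ?_⟩
    rw [XPiece.tgt_node, hg]
    have := XWord.runs_passRight c [] (l₁.map XColor.leg) (l₂.map XColor.leg)
    simpa using this
  · refine ⟨[c], rfl, ?_⟩
    rw [XPiece.tgt_node, hg]
    have := XWord.runs_passLeft c (l₁.map XColor.leg) (l₂.map XColor.leg) []
    simpa using this
  · rw [Interp.map_cons, forget_passRight, hl]
    rfl
  · rw [Interp.map_cons, forget_passLeft, hl, List.length_map]
    rfl

/-- The marking of a straight matched edge between two vertical strands. -/
def markedRung (ε a b : Bool) : Marking :=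
  [([.plain], .node ⟨a, ε, 2⟩), ([], .cap .plain),
    ([.plain, .edge ε .dn, .plain], .node ⟨b, ε, 1⟩), ([.plain, .edge ε .dn], .cap .plain),
    ([.plain], .mark ε), ([.plain], .cap (.edge ε .up))]

lemma xruns_markedRung (ε a b : Bool) :
    XRuns [.plain, .plain] (markedRung ε a b) [.plain, .plain] :=
  ⟨[.plain], rfl, [.plain, .edge ε .dn, .plain], rfl, [], rfl, [.edge ε .dn, .plain], rfl,
    [.edge ε .dn, .plain], rfl, [.plain], rfl, rfl⟩

lemma eqv_markedRung (ε : Bool) : Eqv LinkMove [(), ()] [(), ()]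
    (markedLink.map (markedRung ε true true)) (classicalCrossing ε ++ virtualCrossing) :=
  .of_nf (by revert ε; decide +kernel)

lemma eqv_markedRung_g1 (ε : Bool) : Eqv LinkMove [] [(), ()]
    (markedLink.map (([], .cup .plain) :: markedRung ε true true))
    (markedLink.map [([], .cup .plain)]) := by
  have h1 : Eqv LinkMove [] [(), ()] ((0, .cup ()) :: classicalCrossing ε) [(0, .cup ())] :=
    .move (.inr (.inr (.inl (.r1 ε)))) (runs_of_runList (by revert ε; decide +kernel))
      (runs_of_runList rfl)
  have h2 := (eqv_markedRung ε).left (u := [(0, .cup ())]) (a := []) (runs_of_runList rfl)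
  refine h2.trans (Eqv.trans ?_ (Eqv.kink (S := linkKind) ()))
  exact h1.right (v := virtualCrossing) (c := [(), ()]) (runs_of_runList rfl)

lemma eqv_markedRung_g2 (ε : Bool) : Eqv LinkMove [(), ()] [(), ()]
    (markedLink.map (markedRung ε true true ++ markedRung (!ε) true true)) [] := by
  have h1 : Eqv LinkMove [(), ()] [(), ()] (classicalCrossing ε ++ classicalCrossing (!ε)) [] :=
    .move (.inr (.inr (.inl (.r2 ε)))) (runs_of_runList (by revert ε; decide +kernel))
      (runs_of_runList rfl)
  have h2 := (eqv_markedRung ε).comp ((eqv_markedRung !ε).trans (Eqv.zMove !ε))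
  rw [Interp.map_append]
  refine h2.trans (Eqv.trans ?_ h1)
  clear h1 h2
  exact .of_nf (by revert ε; decide +kernel)

/-- The marking of one side of the hexagon move, where the strands `x` are to the left of
the first matched edge, and the strands `y` to the left of the last one. -/
def markedHexagon (ε : Bool) (x y : List (XColor Empty)) : Marking :=
  (markedRung ε true true).lift x ++ ([([], .cross .plain .plain)] ++
    (markedRung ε true true).lift [.plain] ++ [([], .cross .plain .plain)]) ++
      (markedRung ε true true).lift y

lemma eqv_markedRung_g3 (ε : Bool) : Eqv LinkMove [(), (), ()] [(), (), ()]
    (markedLink.map (markedHexagon ε [] [.plain])) (markedLink.map (markedHexagon ε [.plain] [])) := by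
  have h1 : Eqv LinkMove [(), (), ()] [(), (), ()]
        (classicalCrossing ε ++ shift 1 (classicalCrossing ε) ++ classicalCrossing ε)
        (shift 1 (classicalCrossing ε) ++ classicalCrossing ε ++ shift 1 (classicalCrossing ε)) :=
    .move (.inr (.inr (.inl (.r3 ε)))) (runs_of_runList (by revert ε; decide +kernel))
      (runs_of_runList (by revert ε; decide +kernel))
  have h2 := h1.right (v := virtualCrossing ++ shift 1 virtualCrossing ++ virtualCrossing)
    (c := [(), (), ()]) (runs_of_runList rfl)
  refine Eqv.trans ?_ (h2.trans ?_)
  · clear h1 h2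
    exact .of_nf (by revert ε; decide +kernel)
  · clear h1 h2
    exact .of_nf (by revert ε; decide +kernel)

lemma eqv_markedRung_g4 (ε a b : Bool) : Eqv LinkMove [(), ()] [(), ()]
    (markedLink.map (markedRung ε a b)) (markedLink.map (markedRung ε (!a) (!b))) :=
  .of_nf_subst [_] (List.forall_mem_singleton.2 Eqv.linkHalfTurn) (by revert ε a b; decide +kernel)

lemma eqv_markedRung_g5 (ε : Bool) : Eqv LinkMove [(), ()] [(), ()]
    (markedLink.map (markedRung ε true false)) (markedLink.map (markedRung (!ε) true true)) := by
  have h : ∀ b : Bool, Eqv LinkMove [] [(), (), (), ()] [(0, .node b)]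
      [(0, .cup ()), (1, .node (!b)), (0, .cap ())] := fun b => by
    simpa using Eqv.linkRotate (!b)
  have h' : ∀ b : Bool, Eqv LinkMove [] [(), (), (), ()] [(0, .node b)] _ := fun b =>
    (Eqv.linkFlip b).trans (Eqv.substNodes (List.forall_mem_singleton.2 h) (Eqv.linkFlip b).runs.2)
  exact .of_nf_subst [_] (List.forall_mem_singleton.2 h') (by revert ε; decide +kernel)

lemma eq_replicate_of_forget {l : List (XColor Empty)} {n : ℕ}
    (h : l.map XColor.forget = List.replicate n EdgeColor.unmatched) : l = List.replicate n .plain := by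
  rw [List.eq_replicate_iff] at h ⊢
  refine ⟨by simpa using h.1, fun c hc => ?_⟩
  have := h.2 c.forget (List.mem_map_of_mem hc)
  cases c
  · rfl
  · cases this

/-- A move on matched diagrams with unmatched strands at its boundaries. -/
lemma follows_of_unmatched {u v : matchedKind.Word} {m n : ℕ} {U V : Marking}
    (hu : Runs (S := matchedKind) (List.replicate m .unmatched) u (List.replicate n .unmatched))
    (hU : XRuns (List.replicate m .plain) U (List.replicate n .plain))
    (hV : XRuns (List.replicate m .plain) V (List.replicate n .plain))
    (hU' : forgetInterp.map U = u) (hV' : forgetInterp.map V = v)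
    (h : Eqv LinkMove ((List.replicate m (.plain : XColor Empty)).flatMap XColor.strands)
      ((List.replicate n (.plain : XColor Empty)).flatMap XColor.strands)
      (markedLink.map U) (markedLink.map V)) (A B : List (XColor Empty))
    (hA : A.map XColor.forget = List.replicate m EdgeColor.unmatched) (hB : Markable A u B) :
    Follows A B u v := by
  have h1 := eq_replicate_of_forget hA
  have h2 := eq_replicate_of_forget (hB.map_forget hA hu)
  rw [h1, h2]
  exact ⟨_, _, U, V, .refl _, .refl _, hU, hV, hU', hV', h⟩

/-- The moves `M5` and `G1`, …, `G5` are followed by the link diagrams. -/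
lemma follows_grapheneLocalMove {α β : List matchedKind.Color} {u v : matchedKind.Word}
    (h : GrapheneLocalMove α β u v) :
    (∀ A B, A.map XColor.forget = α → Markable A u B → Follows A B u v) ∨
      (∀ A B, A.map XColor.forget = α → Markable A v B → Follows A B v u) := by
  cases h with
  | m5 ε i =>
    left
    intro A B hA h
    cases List.map_eq_nil_iff.1 hA
    obtain ⟨e, he, -, h1⟩ := Markable.exists_piece (x := []) (s := []) (y := []) h rfl rfl
    cases XPiece.forget_eq_node.1 he
    refine ⟨[], (XPiece.node ⟨false, ε, i⟩).tgt, [([], .node ⟨false, ε, i⟩)],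
      [([], .node ⟨true, ε, Equiv.swap 0 1 i⟩),
        ([], .cross (.leg (MatchedVertex.leg ⟨true, ε, Equiv.swap 0 1 i⟩ 0))
          (.leg (MatchedVertex.leg ⟨true, ε, Equiv.swap 0 1 i⟩ 1)))], .nil,
      by rwa [List.nil_append, List.append_nil] at h1,
      ⟨[], rfl, by simp [XRuns]⟩, ⟨[], rfl, [.leg (MatchedVertex.leg ⟨true, ε, Equiv.swap 0 1 i⟩ 2)],
        rfl, ?_⟩, rfl, ?_, ?_⟩
    · fin_cases i <;> rfl
    · fin_cases i <;> rfl
    · clear h h1 he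
      exact .of_nf (by revert ε i; decide +kernel)
  | g1 ε =>
    refine .inr (follows_of_unmatched (m := 0) (n := 2) (U := [([], .cup .plain)])
      (V := ([], .cup .plain) :: markedRung ε true true) (runs_of_runList rfl) ⟨[], rfl, rfl⟩
      ⟨[], rfl, xruns_markedRung _ _ _⟩ rfl rfl (eqv_markedRung_g1 ε).symm)
  | g2 ε =>
    exact .inr (follows_of_unmatched (m := 2) (n := 2) (U := [])
      (V := markedRung ε true true ++ markedRung (!ε) true true) rfl rfl
      ((xruns_markedRung _ _ _).append (xruns_markedRung _ _ _)) rfl rfl (eqv_markedRung_g2 ε).symm)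
  | g3 ε =>
    have h1 : ∀ x y : List (XColor Empty), x ++ y = [.plain] →
        XRuns [.plain, .plain, .plain] ((markedRung ε true true).lift x) [.plain, .plain, .plain] := by
      intro x y h
      have := (xruns_markedRung ε true true).lift x y
      rcases x with _ | ⟨c, _ | _⟩ <;> simp at h <;> obtain ⟨rfl, rfl⟩ := h <;> exact this
    have h2 : XRuns [.plain, .plain, .plain] [([], .cross .plain .plain)]
        [(.plain : XColor Empty), .plain, .plain] := ⟨[.plain], rfl, rfl⟩
    have h3 : ∀ x y x' y' : List (XColor Empty), x ++ y = [.plain] → x' ++ y' = [.plain] →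
        XRuns [.plain, .plain, .plain] (markedHexagon ε x x') [.plain, .plain, .plain] :=
      fun x y x' y' hx hx' => ((h1 x y hx).append ((h2.append (h1 [.plain] [] rfl)).append h2)).append
        (h1 x' y' hx')
    exact .inl (follows_of_unmatched (m := 3) (n := 3) (U := markedHexagon ε [] [.plain])
      (V := markedHexagon ε [.plain] []) (grapheneLocalMove_isBoundary.runs (.g3 ε)).1
      (h3 _ [.plain] _ [] rfl rfl) (h3 _ [] _ [.plain] rfl rfl) rfl rfl (eqv_markedRung_g3 ε))
  | g4 ε a b =>
    exact .inl (follows_of_unmatched (m := 2) (n := 2) (runs_rung _ _ _) (xruns_markedRung _ _ _)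
      (xruns_markedRung _ _ _) rfl rfl (eqv_markedRung_g4 ε a b))
  | g5 ε =>
    exact .inl (follows_of_unmatched (m := 2) (n := 2) (runs_rung _ _ _) (xruns_markedRung _ _ _)
      (xruns_markedRung _ _ _) rfl rfl (eqv_markedRung_g5 ε))

lemma eqv_markedLink_rotate (g : MatchedVertex) : Eqv LinkMove []
    ((((matchedKind.legs (matchedKind.rot g)).map XColor.leg : List (XColor Empty))).flatMap
      XColor.strands) (markedLink.map [([], .node (matchedKind.rot g))])
      (markedLink.map [([], .cup (XColor.leg (g.leg 0)).rev),
        ([(XColor.leg (g.leg 0)).rev], .node g), ([], .cap (XColor.leg (g.leg 0)).rev)]) := by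
  obtain ⟨a, ε, i⟩ := g
  exact .of_nf (by revert a ε i; decide +kernel)

/-- For each move one of its two sides is such that the markings of this side can be carried over to
the other side. -/
lemma follows_localMove {α β : List matchedKind.Color} {u v : matchedKind.Word}
    (h : LocalMove GrapheneLocalMove α β u v) :
    (∀ A B, A.map XColor.forget = α → Markable A u B → Follows A B u v) ∨
      (∀ A B, A.map XColor.forget = α → Markable A v B → Follows A B v u) := by
  cases h with
  | exchange e e' z => exact .inl (follows_exchange e e' z)
  | zigzag c =>
    refine .inr fun A B hA h => ?_
    obtain ⟨c, rfl, rfl⟩ := List.map_eq_singleton_iff.1 hA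
    refine ⟨[c], [c], [], [([c], .cup c.rev), ([], .cap c)], .refl _, h, rfl, ⟨[], rfl, [c], ?_, rfl⟩,
      rfl, ?_, ?_⟩
    · rcases c with _ | ⟨ε, _ | _ | i⟩ <;> rfl
    · simp [forgetInterp, Interp.width, XPiece.forget, forget_rev]
    · clear h
      induction c using Empty.strands_induction <;> exact .of_nf (by decide +revert +kernel)
  | zagzig c =>
    refine .inr fun A B hA h => ?_
    obtain ⟨c, rfl, rfl⟩ := List.map_eq_singleton_iff.1 hA
    refine ⟨[c], [c], [], [([], .cup c), ([c], .cap c.rev)], .refl _, h, rfl, ⟨[c], rfl, [], ?_, rfl⟩,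
      rfl, ?_, ?_⟩
    · rcases c with _ | ⟨ε, _ | _ | i⟩ <;> rfl
    · simp [forgetInterp, Interp.width, XPiece.forget, forget_rev]
    · clear h
      induction c using Empty.strands_induction <;> exact .of_nf (by decide +revert +kernel)
  | slideCup c d => exact .inl (follows_slideCup c d)
  | slideCap c d => exact .inl (follows_slideCap c d)
  | rotate g c l hg =>
    refine .inl fun A B hA h => ?_
    cases List.map_eq_nil_iff.1 hA
    obtain ⟨rfl, rfl⟩ := List.cons_eq_cons.1 hg
    obtain ⟨e, he, -, h1⟩ := Markable.exists_piece (x := []) (s := []) (y := []) h rfl rfl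
    cases XPiece.forget_eq_node.1 he
    rw [List.nil_append, List.append_nil] at h1
    refine ⟨[], (XPiece.node (matchedKind.rot g)).tgt, [([], .node (matchedKind.rot g))],
      [([], .cup (XColor.leg (g.leg 0)).rev), ([(XColor.leg (g.leg 0)).rev], .node g),
        ([], .cap (XColor.leg (g.leg 0)).rev)], .nil, h1, ⟨[], rfl, ?_⟩,
      ⟨[], rfl, [(XColor.leg (g.leg 0)).rev.rev], rfl,
        [.leg (g.leg 1), .leg (g.leg 2), .leg (g.leg 0)], ?_, ?_⟩, rfl, ?_, eqv_markedLink_rotate g⟩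
    · simp [XRuns]
    · obtain ⟨a, ε, i⟩ := g
      fin_cases i <;> rfl
    · obtain ⟨a, ε, i⟩ := g
      fin_cases i <;> rfl
    · rw [Interp.map_cons, Interp.map_cons, Interp.map_cons]
      simp [forgetInterp, Interp.width, XPiece.forget, forget_rev, forget_leg]
  | kink c =>
    refine .inr fun A B hA h => ?_
    cases List.map_eq_nil_iff.1 hA
    obtain ⟨e, he, -, h1⟩ := Markable.exists_piece (x := []) (s := []) (y := []) h rfl rfl
    obtain ⟨c, rfl, rfl⟩ := XPiece.forget_eq_cup.1 he
    refine ⟨[], [c, c.rev], [([], .cup c)], [([], .cup c.rev), ([], .cross c.rev c)], .nil, h1,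
      ⟨[], rfl, rfl⟩, ⟨[], rfl, [], ?_, rfl⟩, rfl, ?_, ?_⟩
    · rcases c with _ | ⟨ε, _ | _ | i⟩ <;> rfl
    · simp [forgetInterp, Interp.width, XPiece.forget, forget_rev]
    · clear h h1 he
      induction c using Empty.strands_induction <;> exact .of_nf (by decide +revert +kernel)
  | bigon c d =>
    refine .inr fun A B hA h => ?_
    obtain ⟨c, A, rfl, rfl, h0⟩ := List.map_eq_cons_iff.1 hA
    obtain ⟨d, rfl, rfl⟩ := List.map_eq_singleton_iff.1 h0
    refine ⟨[c, d], [c, d], [], [([], .cross c d), ([], .cross d c)], .refl _, h, rfl,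
      ⟨[], rfl, [], rfl, rfl⟩, rfl, rfl, ?_⟩
    clear h hA h0
    induction c using Empty.strands_induction <;> induction d using Empty.strands_induction <;>
      exact .of_nf (by decide +revert +kernel)
  | triangle c d e => exact .inl (follows_triangle c d e)
  | pass c g l₁ l₂ h => exact .inl (follows_pass c g l₁ l₂ h)
  | special h => exact follows_grapheneLocalMove h

/-- Equivalent matched diagrams have markings with equivalent link diagrams. -/
theorem eqv_markedLink {w w' : matchedKind.Word} (h : Eqv GrapheneMove [] [] w w')
    (hw : IsMatching w) {W W' : Marking} (hW : XRuns [] W []) (hW' : XRuns [] W' [])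
    (h₁ : forgetInterp.map W = w) (h₂ : forgetInterp.map W' = w') :
    Eqv LinkMove [] [] (markedLink.map W) (markedLink.map W') := by
  induction h generalizing W W' with
  | refl _ => exact Eqv.markedLink hW hW' (h₁.trans h₂.symm)
  | symm h ih => exact (ih (h.symm.isMatching hw) hW' hW h₂ h₁).symm
  | trans h h' ih ih' =>
    obtain ⟨V, h3, h4, -⟩ := exists_marking h.runs.2 (h.isMatching hw)
    exact (ih hw hW h3 h₁ h4).trans (ih' (h.isMatching hw) h3 hW' h4 h₂)
  | step h hu hv =>
    obtain ⟨p, q, u, v, x, y, a, b, h3, hp, hq, rfl, rfl⟩ :=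
      Rewrite.exists_context grapheneLocalMove_isBoundary h hu hv
    have hr := h3.runs grapheneLocalMove_isBoundary
    -- Both diagrams may need other markings than the given ones, but these do not matter.
    rcases follows_localMove h3 with h4 | h4
    · obtain ⟨U, V, h5, h6, h7, h8, h9⟩ := Follows.exists_marking h4 hp hr.1 hW h₁
      exact (Eqv.markedLink hW h5 (h₁.trans h7.symm)).trans
        (h9.trans (Eqv.markedLink h6 hW' (h8.trans h₂.symm)))
    · obtain ⟨U, V, h5, h6, h7, h8, h9⟩ := Follows.exists_marking h4 hp hr.2 hW' h₂
      exact ((Eqv.markedLink hW' h5 (h₂.trans h7.symm)).trans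
        (h9.trans (Eqv.markedLink h6 hW (h8.trans h₁.symm)))).symm

/-! ### The functor and its inverse -/

/-- The standard marking of a piece of a ladder. -/
def LadderPiece.marking : LadderPiece → Marking
  | .cup => [([], .cup .plain)]
  | .cap => [([], .cap .plain)]
  | .cross => [([], .cross .plain .plain)]
  | .rung ε _ => markedRung ε true true

/-- The standard marking of a ladder. -/
def Ladder.marking (L : Ladder) : Marking :=
  L.flatMap fun s => XWord.lift (List.replicate s.1 .plain) s.2.marking

lemma Ladder.forget_marking (L : Ladder) : forgetInterp.map L.marking = L.toMatched := by
  induction L with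
  | nil => rfl
  | cons s L ih =>
    have h : forgetInterp.map s.2.marking = s.2.toMatched := by
      rcases s with ⟨k, _ | _ | _ | _⟩ <;> rfl
    change forgetInterp.map (XWord.lift _ s.2.marking ++ Ladder.marking L) = _ ++ Ladder.toMatched L
    rw [Interp.map_append, ih, Interp.map_lift, h, forgetInterp_width, List.length_replicate]

/-- The link diagram of the standard marking of a piece of a ladder is the one obtained by the
replacement. -/
lemma LadderPiece.eqv_marking (e : LadderPiece) {m : ℕ} {b : List matchedKind.Color}
    (h : Runs (S := matchedKind) (List.replicate m .unmatched) e.toMatched b) :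
    ∃ n n' j, m = n + j ∧ b = List.replicate (n' + j) .unmatched ∧
      XRuns (List.replicate n .plain) e.marking (List.replicate n' .plain) ∧
      Eqv LinkMove (List.replicate n ()) (List.replicate n' ()) (markedLink.map e.marking) e.toLink := by
  have key : ∀ n n', m = n + (m - n) → Runs (S := matchedKind) (List.replicate n .unmatched)
      e.toMatched (List.replicate n' .unmatched) → b = List.replicate (n' + (m - n)) .unmatched := by
    intro n n' hn hr
    have := hr.whisker [] (List.replicate (m - n) .unmatched)
    rw [List.nil_append, List.nil_append, ← List.replicate_add, ← hn, List.length_nil, shift_zero,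
      ← List.replicate_add] at this
    exact h.det this
  have hm : ∀ n, n ≤ m → m = n + (m - n) := fun n hn => by omega
  cases e with
  | cup =>
    exact ⟨0, 2, m - 0, by simp, key 0 2 (by simp) (runs_of_runList rfl), ⟨[], rfl, rfl⟩,
      .refl (runs_of_runList rfl)⟩
  | cap =>
    have h2 : 2 ≤ m := by
      rcases m with _ | _ | m
      · simp [LadderPiece.toMatched, runs_cons, Piece.src] at h
      · simp [LadderPiece.toMatched, runs_cons, Piece.src] at h
      · omega
    exact ⟨2, 0, m - 2, hm 2 h2, key 2 0 (hm 2 h2) (runs_of_runList rfl), ⟨[], rfl, rfl⟩,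
      .refl (runs_of_runList rfl)⟩
  | cross =>
    have h2 : 2 ≤ m := by
      rcases m with _ | _ | m
      · simp [LadderPiece.toMatched, runs_cons, Piece.src] at h
      · simp [LadderPiece.toMatched, runs_cons, Piece.src] at h
      · omega
    exact ⟨2, 2, m - 2, hm 2 h2, key 2 2 (hm 2 h2) (runs_of_runList rfl), ⟨[], rfl, rfl⟩,
      .refl (runs_of_runList rfl)⟩
  | rung ε d =>
    have h2 : 2 ≤ m := by
      obtain ⟨y, hy⟩ := exists_of_runs_rung (w := []) (by simpa [LadderPiece.toMatched] using h)
      have := congrArg List.length hy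
      simp [uu] at this
      omega
    refine ⟨2, 2, m - 2, hm 2 h2, key 2 2 (hm 2 h2) (runs_rung _ _ _), xruns_markedRung _ _ _, ?_⟩
    cases d
    · exact (eqv_markedRung ε).trans (Eqv.zMove ε)
    · exact eqv_markedRung ε

lemma Ladder.eqv_marking {L : Ladder} {m : ℕ}
    (h : Runs (S := matchedKind) (List.replicate m .unmatched) L.toMatched []) :
    XRuns (List.replicate m .plain) L.marking [] ∧
      Eqv LinkMove (List.replicate m ()) [] (markedLink.map L.marking) L.toLink := by
  induction L generalizing m with
  | nil =>
    cases m with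
    | zero => exact ⟨rfl, .refl rfl⟩
    | succ m => cases h
  | cons s L ih =>
    obtain ⟨k, e⟩ := s
    change Runs _ (DrawingKind.shift k e.toMatched ++ Ladder.toMatched L) _ at h
    obtain ⟨A, h1, h2⟩ := runs_append.1 h
    obtain ⟨x, a, b, hx, h3, rfl, h4⟩ := h1.strip (.inl (by cases e <;> simp [LadderPiece.toMatched, rung]))
    have h5 := List.append_eq_replicate_iff.1 h3.symm
    obtain ⟨h6, h7, h8⟩ := h5
    rw [hx] at h7 h6
    rw [h8] at h4
    obtain ⟨n, n', j, h9, rfl, h11, h12⟩ := e.eqv_marking h4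
    rw [h7, ← List.replicate_add] at h2
    obtain ⟨h13, h14⟩ := ih h2
    have hs : ∀ n, (List.replicate n (.plain : XColor Empty)).flatMap XColor.strands =
        List.replicate n () := by
      intro n
      induction n with
      | zero => rfl
      | succ n ih => simp [List.replicate_succ, ih]
    have hm : m = k + n + j := by omega
    subst hm
    constructor
    · have := h11.lift (List.replicate k .plain) (List.replicate j .plain)
      simp only [← List.replicate_add] at this
      exact this.append (by rwa [← Nat.add_assoc] at h13)
    · change Eqv _ _ _ (markedLink.map (XWord.lift (List.replicate k .plain) e.marking ++
        Ladder.marking L)) (DrawingKind.shift k e.toLink ++ Ladder.toLink L)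
      rw [Interp.map_append, Interp.map_lift]
      have hw : markedLink.width (List.replicate k (.plain : XColor Empty)) = k := by
        change (List.flatMap XColor.strands _).length = k
        rw [hs, List.length_replicate]
      rw [hw]
      refine (h12.whisker' (List.replicate k ()) (List.replicate j ()) (List.length_replicate ..)
        ?_ rfl).comp (by simpa [← List.replicate_add, Nat.add_assoc] using h14)
      simp

/-- Equivalent matched diagrams are equivalent as drawings with empty boundaries. -/
lemma eqv_of_graphene {D D' : UndirectedMatchedDiagram} (h : Relation.EqvGen ZGrapheneStep D D') :
    Eqv GrapheneMove [] [] D.1 D'.1 := by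
  induction h with
  | rel D D' h => exact .step h D.2.1 D'.2.1
  | refl D => exact .refl D.2.1
  | symm _ _ _ ih => exact ih.symm
  | trans _ _ _ _ _ ih ih' => exact ih.trans ih'

lemma eqv_of_link {D D' : VirtualLinkDiagram} (h : Relation.EqvGen ZLinkStep D D') :
    Eqv LinkMove [] [] D.1 D'.1 := by
  induction h with
  | rel D D' h => exact .step h D.2 D'.2
  | refl D => exact .refl D.2
  | symm _ _ _ ih => exact ih.symm
  | trans _ _ _ _ _ ih ih' => exact ih.trans ih'

/-- A marking of a matched diagram. -/
noncomputable def UndirectedMatchedDiagram.marking (D : UndirectedMatchedDiagram) : Marking :=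
  (exists_marking D.2.1 D.2.2).choose

lemma UndirectedMatchedDiagram.marking_spec (D : UndirectedMatchedDiagram) :
    XRuns [] D.marking [] ∧ forgetInterp.map D.marking = D.1 ∧
      Eqv GrapheneMove [] [] (toGraphene (markedLink.map D.marking)) D.1 :=
  (exists_marking D.2.1 D.2.2).choose_spec

/-- The `Z`-virtual link of a `Z`-graphene. -/
noncomputable def linkOfGraphene : Quotient zGrapheneSetoid → Quotient zLinkSetoid :=
  Quotient.lift
    (fun D => Quotient.mk zLinkSetoid
      ⟨markedLink.map D.marking, markedLink.runs_map D.marking_spec.1⟩)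
    fun D D' h => Eqv.link_eq (eqv_markedLink (eqv_of_graphene h) D.2.2 D.marking_spec.1
      D'.marking_spec.1 D.marking_spec.2.1 D'.marking_spec.2.1) _ _

/-- The `Z`-graphene of a `Z`-virtual link. -/
def grapheneOfLink : Quotient zLinkSetoid → Quotient zGrapheneSetoid :=
  Quotient.lift
    (fun D => Quotient.mk zGrapheneSetoid
      ⟨toGraphene D.1, runs_toGraphene D.2, isMatching_toGraphene D.2⟩)
    fun _ _ h => Eqv.graphene_eq (Eqv.toGraphene (eqv_of_link h)) _ _

lemma linkOfGraphene_toMatched (L : Ladder)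
    (hG : IsClosedDrawing L.toMatched ∧ IsMatching L.toMatched) :
    ∃ hL : IsClosedDrawing L.toLink,
      linkOfGraphene (Quotient.mk _ ⟨L.toMatched, hG⟩) = Quotient.mk _ ⟨L.toLink, hL⟩ := by
  obtain ⟨h1, h2⟩ := Ladder.eqv_marking (m := 0) hG.1
  refine ⟨h2.runs.2, ?_⟩
  have h3 := UndirectedMatchedDiagram.marking_spec ⟨L.toMatched, hG⟩
  exact Eqv.link_eq ((Eqv.markedLink h3.1 h1 (h3.2.1.trans L.forget_marking.symm)).trans h2) _ _

lemma linkOfGraphene_grapheneOfLink (l : Quotient zLinkSetoid) :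
    linkOfGraphene (grapheneOfLink l) = l := by
  induction l using Quotient.ind with
  | _ D =>
    obtain ⟨hL, h⟩ := linkOfGraphene_toMatched (resolve D.1)
      ⟨runs_toGraphene D.2, isMatching_toGraphene D.2⟩
    exact h.trans (Eqv.link_eq (Eqv.toLink_resolve D.2) _ _)

lemma grapheneOfLink_linkOfGraphene (g : Quotient zGrapheneSetoid) :
    grapheneOfLink (linkOfGraphene g) = g := by
  induction g using Quotient.ind with
  | _ D => exact Eqv.graphene_eq D.marking_spec.2.2 _ _

/-- A functor that is induced by the replacement is determined on objects, since every
`Z`-graphene is represented by a ladder. -/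
lemma IsInducedByReplacement.obj_eq {K : CategoryTheory.Functor ZGraphene ZVirtualLink}
    (hK : IsInducedByReplacement K) (g : Quotient zGrapheneSetoid) :
    K.obj ⟨g⟩ = ⟨linkOfGraphene g⟩ := by
  rw [← grapheneOfLink_linkOfGraphene g]
  induction linkOfGraphene g using Quotient.ind with
  | _ D =>
    obtain ⟨hL, h⟩ := hK (resolve D.1) ⟨runs_toGraphene D.2, isMatching_toGraphene D.2⟩
    obtain ⟨hL', h'⟩ := linkOfGraphene_toMatched (resolve D.1)
      ⟨runs_toGraphene D.2, isMatching_toGraphene D.2⟩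
    exact h.trans (congrArg _ h'.symm)

theorem mainTheorem2 :
    (∃! K : CategoryTheory.Functor ZGraphene ZVirtualLink, IsInducedByReplacement K) ∧
    ∀ K : CategoryTheory.Functor ZGraphene ZVirtualLink, IsInducedByReplacement K →
      ∃ K' : CategoryTheory.Functor ZVirtualLink ZGraphene,
        CategoryTheory.Functor.comp K K' = CategoryTheory.Functor.id ZGraphene ∧
        CategoryTheory.Functor.comp K' K = CategoryTheory.Functor.id ZVirtualLink := by
  refine ⟨⟨CategoryTheory.Discrete.functor fun g => ⟨linkOfGraphene g⟩, ?_, ?_⟩, ?_⟩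
  · intro L hG
    obtain ⟨hL, h⟩ := linkOfGraphene_toMatched L hG
    exact ⟨hL, congrArg _ h⟩
  · intro K hK
    exact CategoryTheory.Functor.ext (fun g => hK.obj_eq g.as) fun _ _ _ => Subsingleton.elim _ _
  · intro K hK
    refine ⟨CategoryTheory.Discrete.functor fun l => ⟨grapheneOfLink l⟩, ?_, ?_⟩
    · refine CategoryTheory.Functor.ext (fun g => ?_) fun _ _ _ => Subsingleton.elim _ _
      have := hK.obj_eq g.as
      change (CategoryTheory.Discrete.mk (grapheneOfLink (K.obj ⟨g.as⟩).as) : ZGraphene) = g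
      rw [this, grapheneOfLink_linkOfGraphene]
    · refine CategoryTheory.Functor.ext (fun l => ?_) fun _ _ _ => Subsingleton.elim _ _
      refine (hK.obj_eq (grapheneOfLink l.as)).trans ?_
      rw [linkOfGraphene_grapheneOfLink]
      rfl
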